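/- Let $d\ge 2$ and let $\theta$ be a real skew-symmetric $d\times d$ matrix. Let $\mathbb T^d_\theta$ be the quantum torus, i.e. the von Neumann algebra generated, in the GNS representation of its canonical trace $\tau$, by unitaries $U_1,\dots,U_d$ with $U_kU_j=e^{2\pi \mathrm i\theta_{kj}}U_jU_k$; put $U^m=U_1^{m_1}\cdots U_d^{m_d}$ for $m\in\mathbb Z^d$, so that $\tau(\sum_m\alpha_mU^m)=\alpha_0$ for polynomials, and $\|x\|_p=\tau(|x|^p)^{1/p}$, with the operator norm for $p=\infty$. Let $\mathcal S(\mathbb T^d_\theta)$ be the space of all $\sum_m a_mU^m$ with $(a_m)$ rapidly decreasing, with the topology of the seminorms $x\mapsto\|D^b x\|_\infty$, $b\in\mathbb N_0^d$, where $D^b U^m=\prod_j(2\pi \mathrm i\,m_j)^{b_j}\,U^m$. A distribution $x$ on $\mathbb T^d_\theta$ is a continuous linear functional on $\mathcal S(\mathbb T^d_\theta)$; its Fourier coefficients are $\widehat x(m)=\langle x,(U^m)^*\rangle$, and $x=\sum_m\widehat x(m)U^m$. Write $|m|$ for the Euclidean norm. Let $\varphi$ be a Schwartz function on $\mathbb R^d$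 supported in $\{\frac12\le|\xi|\le2\}$, positive on $\{\frac12<|\xi|<2\}$, with $\sum_{j\in\mathbb Z}\varphi(2^{-j}\xi)=1$ for $\xi\ne0$. For $1\le p,q\le\infty$ and $\alpha\in\mathbb R$ put $$\|x\|_{B^\alpha_{p,q}}=\Big(|\widehat x(0)|^q+\sum_{j\ge0}2^{qj\alpha}\Big\|\sum_{m}\varphi(2^{-j}m)\widehat x(m)U^m\Big\|_p^q\Big)^{1/q}.$$ For $k\in\mathbb Z$ and $s\ge0$ let $C_{s,k}=s(s-1)\cdots(s-k+1)$ if $k\ge0$ and $C_{s,k}=\frac1{(s+1)\cdots(s-k)}$ if $k<0$. For $0<r<1$ let $$\mathcal J^k_r\mathbb P_r(x)=\sum_mC_{|m|,k}\,\widehat x(m)\,r^{|m|-k}U^m,\qquad \mathcal J^k_r\mathbb W_r(x)=\sum_mC_{|m|^2,k}\,\widehat x(m)\,r^{|m|^2-k}U^m;$$ these are the $k$-th derivative in $r$ (for $k\ge0$), or the $(-k)$-th integration (for $k<0$), of the circular Poisson integral $\mathbb P_r(x)=\sum_m\widehat x(m)r^{|m|}U^m$ and of the circular heat integral $\mathbb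 W_r(x)=\sum_m\widehat x(m)r^{|m|^2}U^m$. Theorem. Let $\alpha\in\mathbb R$ and $k\in\mathbb Z$. (i) If $k>\alpha$, then $$\|x\|_{B^\alpha_{p,q}}\approx\Big(\max_{|m|<k}|\widehat x(m)|^q+\int_0^1(1-r)^{q(k-\alpha)}\big\|\mathcal J^k_r\mathbb P_r(x_k)\big\|_p^q\,\frac{dr}{1-r}\Big)^{1/q},\qquad x_k=x-\sum_{|m|<k}\widehat x(m)U^m.$$ (ii) If $k>\frac\alpha2$, then $$\|x\|_{B^\alpha_{p,q}}\approx\Big(\max_{|m|^2<k}|\widehat x(m)|^q+\int_0^1(1-r)^{q(k-\frac\alpha2)}\big\|\mathcal J^k_r\mathbb W_r(x)\big\|_p^q\,\frac{dr}{1-r}\Big)^{1/q}.$$ Here $A\approx B$ means that $A\le C\,B$ and $B\le C\,A$ in $[0,\infty]$ for a finite constant $C$ that depends only on $d,\varphi,\alpha,k$; the equivalences hold for all such $\theta$, all $1\le p,q\le\infty$ and all distributions $x$ on $\mathbb T^d_\theta$. In particular, one side is finite iff the other one is. A maximum over the empty set is $0$, and for $q=\infty$ the $\ell_q$- and $L_q$-norms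 are replaced by suprema (essential suprema over $r\in(0,1)$). -/

import Mathlib

open MeasureTheory Set
open scoped ENNReal NNReal InnerProductSpace

noncomputable section

namespace QTorus

/-! ### The Hilbert space of the GNS representation and weighted translations -/

/-- The Hilbert space `ℓ²(ℤᵈ)`: the GNS space of the canonical trace, in which the canonical basis
vector `e_n` stands for the class of the monomial `U^n`. -/
abbrev Hil (d : ℕ) : Type := lp (fun _ : Fin d → ℤ => ℂ) 2

/-- The bounded operators on the GNS space, in which the quantum torus lives. -/
abbrev Op (d : ℕ) : Type := Hil d →L[ℂ] Hil d

/-- The canonical basis vector `e_n` of `ℓ²(ℤᵈ)`. -/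
def basisVec {d : ℕ} (n : Fin d → ℤ) : Hil d := lp.single 2 n (1 : ℂ)

/-- The orthonormal basis `(c_n e_{n+a})_n`, where the `c_n` are complex numbers of modulus one. -/
def shiftBasis {d : ℕ} (c : (Fin d → ℤ) → Circle) (a : Fin d → ℤ) :
    HilbertBasis (Fin d → ℤ) ℂ (Hil d) :=
  HilbertBasis.mkOfOrthogonalEqBot (v := fun n => (lp.single 2 (n + a) (c n : ℂ) : Hil d))
    (by
      rw [orthonormal_iff_ite]
      intro i j
      rw [lp.inner_single_left, lp.single_apply]
      by_cases h : i = j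
      · subst h
        have hc : ‖(c i : ℂ)‖ = 1 := Circle.norm_coe _
        simp [hc]
      · have h' : i + a ≠ j + a := fun h2 => h (add_right_cancel h2)
        simp [h, h'])
    (by
      rw [Submodule.eq_bot_iff]
      intro f hf
      ext n
      have h := (Submodule.mem_orthogonal _ f).1 hf (lp.single 2 (n - a + a) (c (n - a) : ℂ))
        (Submodule.subset_span ⟨n - a, rfl⟩)
      rw [lp.inner_single_left] at h
      simpa using h)

/-- The unitary operator on `ℓ²(ℤᵈ)` with `e_n ↦ c_n e_{n+a}` for all `n`. -/
def shift {d : ℕ} (c : (Fin d → ℤ) → Circle) (a : Fin d → ℤ) : Hil d ≃ₗᵢ[ℂ] Hil d :=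
  (shiftBasis c a).repr.symm

theorem shift_basisVec {d : ℕ} (c : (Fin d → ℤ) → Circle) (a n : Fin d → ℤ) :
    shift c a (basisVec n) = (c n : ℂ) • basisVec (n + a) := by
  unfold shift basisVec
  rw [HilbertBasis.repr_symm_single, shiftBasis, HilbertBasis.coe_mkOfOrthogonalEqBot,
    ← lp.single_smul]
  simp

theorem op_ext {d : ℕ} {S T : Op d} (h : ∀ n, S (basisVec n) = T (basisVec n)) : S = T := by
  ext1 f
  have hf : HasSum (fun n => lp.single 2 n (f n)) f := lp.hasSum_single (by norm_num) f
  refine (hf.mapL S).unique ?_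
  convert hf.mapL T using 2 with n
  have key : (lp.single 2 n (f n) : Hil d) = f n • basisVec n := by
    rw [basisVec, ← lp.single_smul]
    simp
  rw [key, map_smul, map_smul, h]

theorem ext_basisVec {d : ℕ} {S T : Hil d ≃ₗᵢ[ℂ] Hil d}
    (h : ∀ n, S (basisVec n) = T (basisVec n)) : S = T := by
  ext1 f
  have : ((S.toContinuousLinearEquiv : Op d)) = (T.toContinuousLinearEquiv : Op d) := op_ext h
  exact congrArg (fun A : Op d => A f) this

theorem shift_mul {d : ℕ} (c c' : (Fin d → ℤ) → Circle) (a b : Fin d → ℤ) :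
    shift c a * shift c' b = shift (fun n => c (n + b) * c' n) (b + a) := by
  apply ext_basisVec
  intro n
  change shift c a (shift c' b (basisVec n)) = _
  rw [shift_basisVec, map_smul, shift_basisVec, shift_basisVec, smul_smul, add_assoc]
  simp [mul_comm]

theorem shift_one {d : ℕ} : shift (fun _ : Fin d → ℤ => 1) 0 = 1 := by
  apply ext_basisVec
  intro n
  rw [shift_basisVec]
  simp

/-! ### The generators and the monomials -/

/-- The generator `U_j`. In the GNS representation
`U_j U_1^{n_1}⋯U_d^{n_d} = exp(2πi ∑_{i<j} θ_{ji} n_i) U^{n + e_j}`. -/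
def gen {d : ℕ} (θ : Matrix (Fin d) (Fin d) ℝ) (j : Fin d) : Hil d ≃ₗᵢ[ℂ] Hil d :=
  shift (fun n => Circle.exp (2 * Real.pi * ∑ i with i < j, θ j i * n i)) (Pi.single j 1)

/-- The monomial `U^m = U_1^{m_1} ⋯ U_d^{m_d}`, as a unitary operator. -/
def monomialU {d : ℕ} (θ : Matrix (Fin d) (Fin d) ℝ) (m : Fin d → ℤ) : Hil d ≃ₗᵢ[ℂ] Hil d :=
  ((List.finRange d).map fun j => gen θ j ^ m j).prod

/-- The monomial `U^m`, as a bounded operator. -/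
def monomial {d : ℕ} (θ : Matrix (Fin d) (Fin d) ℝ) (m : Fin d → ℤ) : Op d :=
  ((monomialU θ m).toContinuousLinearEquiv : Hil d →L[ℂ] Hil d)

/-- The commutation relations `U_k U_j = e^{2πi θ_{kj}} U_j U_k`. -/
theorem gen_comm {d : ℕ} (θ : Matrix (Fin d) (Fin d) ℝ) (hθ : θ.transpose = -θ) (k j : Fin d) :
    gen θ k * gen θ j =
      shift (fun _ => Circle.exp (2 * Real.pi * θ k j)) 0 * (gen θ j * gen θ k) := by
  have hkj : θ j k = -θ k j := by simpa using congrFun (congrFun hθ k) j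
  unfold gen
  rw [shift_mul, shift_mul, shift_mul]
  congr 1
  · funext n
    rw [← Circle.exp_add, ← Circle.exp_add, ← Circle.exp_add]
    congr 1
    simp only [Pi.add_apply, Int.cast_add, mul_add, Finset.sum_add_distrib, Pi.single_apply,
      Int.cast_ite, Int.cast_one, Int.cast_zero, mul_ite, mul_one, mul_zero, Finset.sum_ite_eq',
      Finset.mem_filter, Finset.mem_univ, true_and]
    rcases lt_trichotomy j k with h | h | h
    · simp [h, h.not_gt]
      ring
    · subst h
      have : θ j j = 0 := by linarith
      simp [this]
    · simp [h, h.not_gt, hkj]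
      ring
  · abel

/-- The exponent of the phase in the explicit form of the monomials. -/
def phase {d : ℕ} (θ : Matrix (Fin d) (Fin d) ℝ) (m n : Fin d → ℤ) : ℝ :=
  2 * Real.pi * ∑ j, m j * ∑ i with i < j, θ j i * n i

theorem gen_zpow {d : ℕ} (θ : Matrix (Fin d) (Fin d) ℝ) (j : Fin d) (z : ℤ) :
    gen θ j ^ z = shift (fun n => Circle.exp (2 * Real.pi * (z * ∑ i with i < j, θ j i * n i)))
      (Pi.single j z) := by
  let W : ℤ → (Hil d ≃ₗᵢ[ℂ] Hil d) := fun z =>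
    shift (fun n => Circle.exp (2 * Real.pi * (z * ∑ i with i < j, θ j i * n i))) (Pi.single j z)
  have hW : ∀ a b, W (a + b) = W a * W b := by
    intro a b
    simp only [W]
    rw [shift_mul]
    congr 1
    · funext n
      rw [← Circle.exp_add]
      have : ∑ i with i < j, θ j i * ((n + (Pi.single j b : Fin d → ℤ)) i : ℤ) =
          ∑ i with i < j, θ j i * n i := by
        refine Finset.sum_congr rfl fun i hi => ?_
        have : i ≠ j := (Finset.mem_filter.1 hi).2.ne
        simp [this]
      rw [this]
      push_cast
      ring_nf
    · rw [← Pi.single_add, add_comm]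
  let f : Multiplicative ℤ →* (Hil d ≃ₗᵢ[ℂ] Hil d) :=
    MonoidHom.mk' (fun z => W z.toAdd) fun a b => hW _ _
  have h1 : gen θ j = f (Multiplicative.ofAdd 1) := by
    simp [f, W, gen]
  rw [h1, ← map_zpow, ← ofAdd_zsmul]
  simp [f, W]

theorem prod_gen_zpow {d : ℕ} (θ : Matrix (Fin d) (Fin d) ℝ) (m : Fin d → ℤ) (l : List (Fin d))
    (hl : l.Pairwise (· < ·)) :
    (l.map fun j => gen θ j ^ m j).prod =
      shift (fun n => Circle.exp
        (2 * Real.pi * (l.map fun j => m j * ∑ i with i < j, θ j i * n i).sum))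
        (l.map fun j => Pi.single j (m j)).sum := by
  induction l with
  | nil => simpa using shift_one.symm
  | cons j l ih =>
    rw [List.pairwise_cons] at hl
    rw [List.map_cons, List.prod_cons, ih hl.2, gen_zpow, shift_mul]
    congr 1
    · funext n
      rw [← Circle.exp_add]
      have hb : ∀ i, i < j →
          (l.map fun j => (Pi.single j (m j) : Fin d → ℤ)).sum i = 0 := by
        intro i hi
        have : ∀ l' : List (Fin d), (∀ a ∈ l', j < a) →
            (l'.map fun j => (Pi.single j (m j) : Fin d → ℤ)).sum i = 0 := by
          intro l' hl'
          induction l' with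
          | nil => simp
          | cons a l' ih' =>
            have ha : i ≠ a := (hi.trans (hl' a (by simp))).ne
            simp only [List.map_cons, List.sum_cons, Pi.add_apply]
            rw [ih' fun b hb => hl' b (by simp [hb])]
            simp [ha]
        exact this l hl.1
      have : ∑ i with i < j, θ j i *
          ((n + (l.map fun j => (Pi.single j (m j) : Fin d → ℤ)).sum) i : ℤ) =
          ∑ i with i < j, θ j i * n i := by
        refine Finset.sum_congr rfl fun i hi => ?_
        rw [Pi.add_apply, hb i (Finset.mem_filter.1 hi).2, add_zero]
      rw [this]
      simp only [List.map_cons, List.sum_cons]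
      ring_nf
    · rw [List.map_cons, List.sum_cons, add_comm]

theorem monomialU_eq {d : ℕ} (θ : Matrix (Fin d) (Fin d) ℝ) (m : Fin d → ℤ) :
    monomialU θ m = shift (fun n => Circle.exp (phase θ m n)) m := by
  unfold monomialU
  rw [prod_gen_zpow θ m _ (List.pairwise_lt_finRange d)]
  congr 1
  rw [← Fin.sum_univ_def]
  exact Finset.univ_sum_single m

theorem monomial_basisVec {d : ℕ} (θ : Matrix (Fin d) (Fin d) ℝ) (m n : Fin d → ℤ) :
    monomial θ m (basisVec n) = (Circle.exp (phase θ m n) : ℂ) • basisVec (n + m) := by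
  change monomialU θ m (basisVec n) = _
  rw [monomialU_eq, shift_basisVec]

theorem star_monomial {d : ℕ} (θ : Matrix (Fin d) (Fin d) ℝ) (m : Fin d → ℤ) :
    star (monomial θ m) = (Circle.exp (phase θ m m) : ℂ) • monomial θ (-m) := by
  have h : star (monomial θ m) = ((monomialU θ m).symm.toContinuousLinearEquiv : Op d) :=
    LinearIsometryEquiv.adjoint_eq_symm (monomialU θ m)
  rw [h]
  apply op_ext
  intro n
  change (monomialU θ m).symm (basisVec n) = _
  rw [LinearIsometryEquiv.symm_apply_eq]
  change _ = monomial θ m _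
  rw [smul_apply, monomial_basisVec, map_smul, map_smul, monomial_basisVec,
    neg_add_cancel_right, smul_smul, smul_smul, ← Circle.coe_mul, ← Circle.coe_mul,
    ← Circle.exp_add, ← Circle.exp_add]
  have : phase θ m m + (phase θ (-m) n + phase θ m (n + -m)) = 0 := by
    simp only [phase, Pi.neg_apply, Pi.add_apply, Int.cast_neg, Int.cast_add, neg_mul, mul_add,
      mul_neg, Finset.sum_add_distrib, Finset.sum_neg_distrib]
    ring
  rw [add_assoc, this]
  simp

/-! ### The trace, Fourier coefficients and the `L_p`-norms -/

/-- The canonical trace, that is, the vector state of `e_0`; in particular it maps a polynomial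
`∑ α_m U^m` to `α_0`. -/
def trace {d : ℕ} (x : Op d) : ℂ := ⟪basisVec (0 : Fin d → ℤ), x (basisVec 0)⟫_ℂ

/-- The Fourier coefficients `τ((U^m)^* x)`. -/
def opCoeff {d : ℕ} (θ : Matrix (Fin d) (Fin d) ℝ) (x : Op d) (m : Fin d → ℤ) : ℂ :=
  trace (star (monomial θ m) * x)

/-- The `L_p`-norm `τ(|x|^p)^{1/p}` associated to the vector state `τ = ⟨ξ, · ξ⟩` of a bounded
operator `x`; the operator norm for `p = ∞`. -/
def vectorLpNorm {H : Type*} [NormedAddCommGroup H] [InnerProductSpace ℂ H] [CompleteSpace H]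
    (ξ : H) (p : ℝ≥0∞) (x : H →L[ℂ] H) : ℝ :=
  if p = ∞ then ‖x‖
  else (⟪ξ, (CFC.abs x ^ p.toReal : H →L[ℂ] H) ξ⟫_ℂ).re ^ (1 / p.toReal)

/-- The noncommutative `L_p`-norm `‖x‖_p = τ(|x|^p)^{1/p}` of the quantum torus. -/
def torusLpNorm {d : ℕ} (p : ℝ≥0∞) (x : Op d) : ℝ := vectorLpNorm (basisVec (0 : Fin d → ℤ)) p x

/-! ### Smooth elements and distributions -/

/-- The point `m ∈ ℤᵈ` of Euclidean space. -/
def latticePoint {d : ℕ} (m : Fin d → ℤ) : EuclideanSpace ℝ (Fin d) :=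
  WithLp.toLp 2 fun j => (m j : ℝ)

/-- The Euclidean norm `|m|` of `m ∈ ℤᵈ`. -/
def latticeNorm {d : ℕ} (m : Fin d → ℤ) : ℝ := ‖latticePoint m‖

/-- Rapidly decreasing families on `ℤᵈ`. -/
def RapidlyDecreasing {d : ℕ} (a : (Fin d → ℤ) → ℂ) : Prop :=
  ∀ N : ℕ, ∃ C : ℝ, ∀ m, (1 + latticeNorm m) ^ N * ‖a m‖ ≤ C

/-- The space of the `∑ a_m U^m` with `(a_m)` rapidly decreasing. -/
def smoothSubmodule {d : ℕ} (θ : Matrix (Fin d) (Fin d) ℝ) : Submodule ℂ (Op d) where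
  carrier := {x | ∃ a, RapidlyDecreasing a ∧ HasSum (fun m => a m • monomial θ m) x}
  zero_mem' := ⟨0, fun N => ⟨0, fun m => by simp⟩, by simp⟩
  add_mem' := by
    rintro x y ⟨a, ha, hx⟩ ⟨b, hb, hy⟩
    refine ⟨a + b, fun N => ?_, by simpa [add_smul] using hx.add hy⟩
    obtain ⟨A, hA⟩ := ha N
    obtain ⟨B, hB⟩ := hb N
    refine ⟨A + B, fun m => ?_⟩
    have h1 : 0 ≤ (1 + latticeNorm m) ^ N := pow_nonneg (add_nonneg zero_le_one (norm_nonneg _)) N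
    calc (1 + latticeNorm m) ^ N * ‖(a + b) m‖ ≤ (1 + latticeNorm m) ^ N * (‖a m‖ + ‖b m‖) :=
          mul_le_mul_of_nonneg_left (norm_add_le _ _) h1
      _ ≤ A + B := by rw [mul_add]; exact add_le_add (hA m) (hB m)
  smul_mem' := by
    rintro c x ⟨a, ha, hx⟩
    refine ⟨c • a, fun N => ?_, by simpa [smul_smul] using hx.const_smul c⟩
    obtain ⟨A, hA⟩ := ha N
    refine ⟨‖c‖ * A, fun m => ?_⟩
    calc (1 + latticeNorm m) ^ N * ‖(c • a) m‖ = ‖c‖ * ((1 + latticeNorm m) ^ N * ‖a m‖) := by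
          rw [Pi.smul_apply, norm_smul]; ring
      _ ≤ ‖c‖ * A := mul_le_mul_of_nonneg_left (hA m) (norm_nonneg _)

/-- The space `𝒮(𝕋^d_θ)` of smooth elements. It is a type of its own, because its topology is not
that of the operator norm. -/
def Smooth {d : ℕ} (θ : Matrix (Fin d) (Fin d) ℝ) : Type := smoothSubmodule θ

instance {d : ℕ} (θ : Matrix (Fin d) (Fin d) ℝ) : AddCommGroup (Smooth θ) :=
  inferInstanceAs (AddCommGroup (smoothSubmodule θ))

instance {d : ℕ} (θ : Matrix (Fin d) (Fin d) ℝ) : Module ℂ (Smooth θ) :=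
  inferInstanceAs (Module ℂ (smoothSubmodule θ))

/-- The operator underlying a smooth element. -/
def Smooth.toOp {d : ℕ} {θ : Matrix (Fin d) (Fin d) ℝ} : Smooth θ →ₗ[ℂ] Op d :=
  (smoothSubmodule θ).subtype

/-- The partial derivation `D^b = ∂_1^{b_1} ⋯ ∂_d^{b_d}`, where
`∂_j (U^n) = 2πi n_j U^n`. -/
def partialDeriv {d : ℕ} (θ : Matrix (Fin d) (Fin d) ℝ) (b : Fin d → ℕ) (x : Smooth θ) : Op d :=
  ∑' n : Fin d → ℤ,
    ((∏ j, (2 * Real.pi * Complex.I * n j) ^ b j) * opCoeff θ x.toOp n) • monomial θ n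

/-- The topology of `𝒮(𝕋^d_θ)`, generated by the seminorms `x ↦ ‖D^b x‖_∞`. -/
instance {d : ℕ} (θ : Matrix (Fin d) (Fin d) ℝ) : TopologicalSpace (Smooth θ) :=
  ⨅ b : Fin d → ℕ, TopologicalSpace.induced (partialDeriv θ b) inferInstance

/-- The distributions on the quantum torus: the continuous linear functionals on `𝒮(𝕋^d_θ)`. -/
abbrev Distribution {d : ℕ} (θ : Matrix (Fin d) (Fin d) ℝ) : Type := Smooth θ →L[ℂ] ℂ

theorem opCoeff_eq {d : ℕ} (θ : Matrix (Fin d) (Fin d) ℝ) {a : (Fin d → ℤ) → ℂ} {x : Op d}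
    (h : HasSum (fun m => a m • monomial θ m) x) (m : Fin d → ℤ) : opCoeff θ x m = a m := by
  have h0 : ∀ n, monomial θ n (basisVec 0) = basisVec n := by
    intro n
    rw [monomial_basisVec]
    simp [phase]
  have h1 : ∀ y : Op d, opCoeff θ y m = y (basisVec 0) m := by
    intro y
    unfold opCoeff trace
    rw [mul_apply_eq_comp, ContinuousLinearMap.star_eq_adjoint,
      ContinuousLinearMap.adjoint_inner_right, h0, basisVec, lp.inner_single_left]
    simp
  have h2 : HasSum (fun n => opCoeff θ (a n • monomial θ n) m) (opCoeff θ x m) := by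
    let L : Op d →L[ℂ] ℂ :=
      (innerSL ℂ (basisVec m)).comp (ContinuousLinearMap.apply ℂ (Hil d) (basisVec 0))
    have hL : ∀ y : Op d, L y = opCoeff θ y m := by
      intro y
      rw [h1]
      change ⟪basisVec m, y (basisVec 0)⟫_ℂ = _
      rw [basisVec, lp.inner_single_left]
      simp
    simpa only [hL] using h.mapL L
  refine h2.unique ?_
  have h3 : ∀ n, opCoeff θ (a n • monomial θ n) m = if n = m then a m else 0 := by
    intro n
    rw [h1, smul_apply, h0]
    by_cases hnm : n = m
    · subst hnm
      simp [basisVec]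
    · simp [basisVec, hnm, Ne.symm hnm]
  simp only [h3]
  exact hasSum_ite_eq m (a m)

theorem partialDeriv_zero {d : ℕ} (θ : Matrix (Fin d) (Fin d) ℝ) (x : Smooth θ) :
    partialDeriv θ 0 x = x.toOp := by
  obtain ⟨a, -, h⟩ := x.2
  have h' : HasSum (fun m => a m • monomial θ m) x.toOp := h
  simp only [partialDeriv, Pi.zero_apply, pow_zero, Finset.prod_const_one, one_mul, opCoeff_eq θ h']
  exact h'.tsum_eq

theorem continuous_toOp {d : ℕ} (θ : Matrix (Fin d) (Fin d) ℝ) :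
    Continuous (Smooth.toOp : Smooth θ → Op d) := by
  have h : Continuous (partialDeriv θ 0) := continuous_iInf_dom (i := 0) continuous_induced_dom
  exact h.congr (partialDeriv_zero θ)

/-- The distribution `x ↦ τ(yx)` given by a bounded operator `y`. -/
def toDistribution {d : ℕ} (θ : Matrix (Fin d) (Fin d) ℝ) (y : Op d) : Distribution θ where
  toFun x := trace (y * x.toOp)
  map_add' a b := by simp [trace, mul_add]
  map_smul' c a := by simp [trace]
  cont := by
    have h : Continuous fun x : Op d => trace (y * x) := by
      unfold trace
      fun_prop
    exact h.comp (continuous_toOp θ)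

/-- The smooth element `(U^m)^*`. -/
def starMonomial {d : ℕ} (θ : Matrix (Fin d) (Fin d) ℝ) (m : Fin d → ℤ) : Smooth θ :=
  ⟨star (monomial θ m), by
    classical
    refine ⟨Pi.single (-m) (Circle.exp (phase θ m m) : ℂ), fun N => ?_, ?_⟩
    · refine ⟨(1 + latticeNorm (-m)) ^ N, fun n => ?_⟩
      have h1 : ∀ n : Fin d → ℤ, 0 ≤ (1 + latticeNorm n) ^ N := fun n =>
        pow_nonneg (add_nonneg zero_le_one (norm_nonneg _)) N
      by_cases h : n = -m
      · subst h
        simp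
      · simp [h, h1]
    · rw [star_monomial]
      convert hasSum_single (-m) ?_ using 1
      · simp
      · intro n hn
        simp [hn]⟩

/-- The Fourier coefficients `x̂(m) = ⟨x, (U^m)^*⟩` of a distribution. -/
def coeff {d : ℕ} {θ : Matrix (Fin d) (Fin d) ℝ} (x : Distribution θ) (m : Fin d → ℤ) : ℂ :=
  x (starMonomial θ m)

/-- The operator `∑ c_m U^m`; it is used only for families `c` that are summable. -/
def series {d : ℕ} (θ : Matrix (Fin d) (Fin d) ℝ) (c : (Fin d → ℤ) → ℂ) : Op d :=
  ∑' m, c m • monomial θ m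

/-! ### Besov spaces -/

/-- The test functions of the Littlewood-Paley decompositions: Schwartz functions supported in
`{1/2 ≤ |ξ| ≤ 2}`, positive in its interior, with `∑_{k ∈ ℤ} φ(2^{-k}ξ) = 1` for `ξ ≠ 0`. -/
structure IsLittlewoodPaley {d : ℕ} (φ : SchwartzMap (EuclideanSpace ℝ (Fin d)) ℝ) : Prop where
  support_subset : tsupport φ ⊆ {ξ | 1 / 2 ≤ ‖ξ‖ ∧ ‖ξ‖ ≤ 2}
  pos : ∀ ξ : EuclideanSpace ℝ (Fin d), 1 / 2 < ‖ξ‖ → ‖ξ‖ < 2 → 0 < φ ξ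
  hasSum_one : ∀ ξ : EuclideanSpace ℝ (Fin d), ξ ≠ 0 →
    HasSum (fun k : ℤ => φ ((2 : ℝ) ^ (-k) • ξ)) 1

/-- The Littlewood-Paley piece `∑_m φ(2^{-k}m) x̂(m) U^m` (a polynomial). -/
def lpPiece {d : ℕ} {θ : Matrix (Fin d) (Fin d) ℝ}
    (φ : SchwartzMap (EuclideanSpace ℝ (Fin d)) ℝ) (x : Distribution θ) (k : ℕ) : Op d :=
  series θ fun m => (φ ((2 : ℝ) ^ (-(k : ℤ)) • latticePoint m) : ℂ) * coeff x m

/-- The Besov norm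
`‖x‖_{B^α_{p,q}} = (|x̂(0)|^q + ∑_{k ≥ 0} 2^{qkα} ‖φ_k * x‖_p^q)^{1/q}`,
with the supremum instead of the `ℓ_q`-norm for `q = ∞`; the Besov space consists of the
distributions for which it is finite. -/
def besovNorm {d : ℕ} {θ : Matrix (Fin d) (Fin d) ℝ}
    (φ : SchwartzMap (EuclideanSpace ℝ (Fin d)) ℝ) (α : ℝ) (p q : ℝ≥0∞)
    (x : Distribution θ) : ℝ≥0∞ :=
  if q = ∞ then
    max ‖coeff x 0‖ₑ
      (⨆ k : ℕ, ENNReal.ofReal ((2 : ℝ) ^ (k * α) * torusLpNorm p (lpPiece φ x k)))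
  else
    (‖coeff x 0‖ₑ ^ q.toReal +
      ∑' k : ℕ, ENNReal.ofReal ((2 : ℝ) ^ (k * α) * torusLpNorm p (lpPiece φ x k)) ^ q.toReal) ^
        (1 / q.toReal)

/-! ### The circular Poisson and heat semigroups -/

/-- For `k ≥ 0` the factor `s (s-1) ⋯ (s-k+1)` by which the `k`-th derivative takes `r^s` to
`r^{s-k}`; for `k < 0` the factor `1 / ((s+1) ⋯ (s-k))` by which the `(-k)`-th integration (from
`0`) takes `r^s` to `r^{s-k}`. -/
def diffFactor (s : ℝ) (k : ℤ) : ℝ :=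
  if 0 ≤ k then ∏ i ∈ Finset.range k.toNat, (s - i)
  else 1 / ∏ i ∈ Finset.range (-k).toNat, (s + (i + 1))

/-- `𝒥^k_r ℙ_r(x) = ∑_m C_{m,k} x̂(m) r^{|m|-k} U^m`: the `k`-th derivative, or the `(-k)`-th
integration, in `r` of the circular Poisson integral `ℙ_r(x) = ∑_m x̂(m) r^{|m|} U^m`. -/
def poissonJ {d : ℕ} {θ : Matrix (Fin d) (Fin d) ℝ} (k : ℤ) (r : ℝ) (x : Distribution θ) :
    Op d :=
  series θ fun m => ((diffFactor (latticeNorm m) k * r ^ (latticeNorm m - k) : ℝ) : ℂ) * coeff x m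

/-- `𝒥^k_r 𝕎_r(x)`, the same for the circular heat semigroup
`𝕎_r(x) = ∑_m x̂(m) r^{|m|^2} U^m`. -/
def heatJ {d : ℕ} {θ : Matrix (Fin d) (Fin d) ℝ} (k : ℤ) (r : ℝ) (x : Distribution θ) :
    Op d :=
  series θ fun m => ((diffFactor (latticeNorm m ^ 2) k * r ^ (latticeNorm m ^ 2 - k) : ℝ) : ℂ) * coeff x m

/-- `x_k = x - ∑_{|m| < k} x̂(m) U^m` (a finite sum). -/
def tail {d : ℕ} {θ : Matrix (Fin d) (Fin d) ℝ} (k : ℤ) (x : Distribution θ) : Distribution θ :=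
  x - ∑ᶠ m ∈ {m : Fin d → ℤ | latticeNorm m < k}, coeff x m • toDistribution θ (monomial θ m)

/-- `(a^q + ∫_0^1 g(r)^q dr/(1-r))^{1/q}`; for `q = ∞`, the maximum of `a` and of the essential
supremum of `g` over `(0, 1)`. -/
def radialNorm (q : ℝ≥0∞) (a : ℝ≥0∞) (g : ℝ → ℝ≥0∞) : ℝ≥0∞ :=
  if q = ∞ then max a (essSup g (volume.restrict (Ioo 0 1)))
  else
    (a ^ q.toReal + ∫⁻ r in Ioo (0 : ℝ) 1, g r ^ q.toReal * ENNReal.ofReal (1 / (1 - r))) ^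
      (1 / q.toReal)

/-- The expression
`(max_{|m|<k} |x̂(m)|^q + ∫_0^1 (1-r)^{q(k-α)} ‖𝒥^k_r ℙ_r(x_k)‖_p^q dr/(1-r))^{1/q}`,
where a maximum over the empty set is zero. -/
def poissonNorm {d : ℕ} {θ : Matrix (Fin d) (Fin d) ℝ} (k : ℤ) (α : ℝ) (p q : ℝ≥0∞)
    (x : Distribution θ) : ℝ≥0∞ :=
  radialNorm q (⨆ (m : Fin d → ℤ) (_ : latticeNorm m < k), ‖coeff x m‖ₑ) fun r =>
    ENNReal.ofReal ((1 - r) ^ (k - α) * torusLpNorm p (poissonJ k r (tail k x)))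

/-- The expression
`(max_{|m|^2<k} |x̂(m)|^q + ∫_0^1 (1-r)^{q(k-α/2)} ‖𝒥^k_r 𝕎_r(x)‖_p^q dr/(1-r))^{1/q}`,
where a maximum over the empty set is zero. -/
def heatNorm {d : ℕ} {θ : Matrix (Fin d) (Fin d) ℝ} (k : ℤ) (α : ℝ) (p q : ℝ≥0∞)
    (x : Distribution θ) : ℝ≥0∞ :=
  radialNorm q (⨆ (m : Fin d → ℤ) (_ : latticeNorm m ^ 2 < k), ‖coeff x m‖ₑ) fun r =>
    ENNReal.ofReal ((1 - r) ^ (k - α / 2) * torusLpNorm p (heatJ k r x))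

end QTorus

end

/-! Both equivalences are one statement about the semigroup with generator `|m|^γ`, with `γ = 1` for
Poisson and `γ = 2` for heat. Put `κ = k - α/γ > 0`. The comparison rests on Fourier multipliers
whose norms depend neither on `θ` nor on `p`.

The map `U^m ↦ e^{i w·m} U^m` is conjugation by a diagonal unitary that fixes `e_0`, hence an
isometry for every `L_p`-norm. Averaging such maps shows that `∫ g(y) e^{i w(y)·m} dy` is a
multiplier with norm at most `∫ |g|` (`IsMultiplier.integral`). By Fourier inversion `m ↦ f(l m)`
has norm at most the `L_1`-norm of the Fourier transform of `f`, for every dilation `l`. Averaging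
needs the triangle inequality. Since the `L_p`-norm is given by functional calculus, that inequality
is proved first: trace Jensen for self-adjoint elements, then a `2 × 2` dilation for general ones
(`IsTracial.minkowski`).

Let `L = 2^{γj}`, and look at frequencies `|m| ≈ 2^j`. With `u = |2^{-j}m|^γ` and `t = -L log r`,
the symbol `C_{|m|^γ,k} r^{|m|^γ-k}` equals `L^k r^{-k} q(m) e^{-tu}`. For large `j` both `q` and
`1/q` are multipliers with uniform norm. Two bounds follow.

Forward (`exists_forward_symbol`): the `j`-th piece of the derivative is at most `L^k e^{-c L(1-r)}`
times the `j`-th piece of `x`, up to a constant. The factor `(1-r)^κ` and the Besov weight `2^{jα} =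
L^{k-κ}` turn this into the kernel `v^κ e^{-cv}` at `v = L(1-r)`. Its sums over `j` and its
integrals against `dr/(1-r)` are bounded because `κ > 0`, so Schur's test bounds the semigroup norm
by the Besov norm (`exists_semigroupNorm_le`).

Backward (`exists_inverse_symbol`): if `1 - r ≤ 1/L`, then `t` is bounded and the symbol can be
inverted on the `j`-th piece at the cost `L^{-k}`. The shells `1 - r ≈ 1/L` are disjoint and each
has `dr/(1-r)`-mass bounded below, so the sequence norm is at most the integral norm
(`exists_besovNorm_le`).

The finitely many small `j`, where the symbol may vanish, involve finitely many Fourier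
coefficients; each of these is controlled by either side. -/

noncomputable section

namespace QTorus

/-! ### Traces on C⋆-algebras and trace inequalities -/

section Tracial

variable {M : Type*} [CStarAlgebra M]

/-- Positive tracial functionals on a C⋆-algebra. -/
structure IsTracial (τ : M →L[ℂ] ℂ) : Prop where
  nonneg : ∀ x : M, 0 ≤ (τ (star x * x)).re
  comm : ∀ x y : M, τ (x * y) = τ (y * x)

variable {τ : M →L[ℂ] ℂ}

/-- With `u = √f(a)` and `v = √h(b)`, cyclicity turns `τ(u u v v)` into `τ((uv)⋆(uv))`. No
commutation of `a` and `b` is required, which is what makes the trace Jensen inequality possible. -/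
theorem IsTracial.re_mul_nonneg (hτ : IsTracial τ) {f h : ℝ → ℝ} (hf : Continuous f)
    (hh : Continuous h) {a b : M} (hf0 : ∀ t ∈ spectrum ℝ a, 0 ≤ f t) (hh0 : ∀ t ∈ spectrum ℝ b, 0 ≤ h t) :
    0 ≤ (τ (cfc f a * cfc h b)).re := by
  set u := cfc (fun t => Real.sqrt (f t)) a with hu
  set v := cfc (fun t => Real.sqrt (h t)) b with hv
  have h1 : cfc f a = u * u := by
    rw [hu, ← cfc_mul (fun t => Real.sqrt (f t)) (fun t => Real.sqrt (f t)) a (by fun_prop)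
      (by fun_prop)]
    exact cfc_congr fun t ht => (Real.mul_self_sqrt (hf0 t ht)).symm
  have h2 : cfc h b = v * v := by
    rw [hv, ← cfc_mul (fun t => Real.sqrt (h t)) (fun t => Real.sqrt (h t)) b (by fun_prop)
      (by fun_prop)]
    exact cfc_congr fun t ht => (Real.mul_self_sqrt (hh0 t ht)).symm
  have hu' : IsSelfAdjoint u := cfc_predicate _ _
  have hv' : IsSelfAdjoint v := cfc_predicate _ _
  have h3 : τ (cfc f a * cfc h b) = τ (star (u * v) * (u * v)) := by
    rw [h1, h2, star_mul, hu'.star_eq, hv'.star_eq, ← mul_assoc, hτ.comm]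
    simp only [mul_assoc]
  rw [h3]
  exact hτ.nonneg _

theorem IsTracial.re_cfc_nonneg (hτ : IsTracial τ) {f : ℝ → ℝ} (hf : Continuous f)
    {a : M} (ha : IsSelfAdjoint a) (hf0 : ∀ t ∈ spectrum ℝ a, 0 ≤ f t) :
    0 ≤ (τ (cfc f a)).re := by
  have := hτ.re_mul_nonneg hf (h := fun _ => 1) (a := a) (b := a) continuous_const hf0 (by simp)
  rwa [cfc_const_one ℝ a ha, mul_one] at this

theorem IsTracial.re_cfc_mono (hτ : IsTracial τ) {f g : ℝ → ℝ} (hf : Continuous f)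
    (hg : Continuous g) {a : M} (ha : IsSelfAdjoint a)
    (h : ∀ t ∈ spectrum ℝ a, f t ≤ g t) : (τ (cfc f a)).re ≤ (τ (cfc g a)).re := by
  have := hτ.re_cfc_nonneg (hg.sub hf) ha fun t ht => sub_nonneg.2 (h t ht)
  change 0 ≤ (τ (cfc (fun t => g t - f t) a)).re at this
  rw [cfc_sub g f a (by fun_prop) (by fun_prop), map_sub, Complex.sub_re] at this
  linarith

theorem cfc_affine (c m t : ℝ) {a : M} (ha : IsSelfAdjoint a) :
    cfc (fun s => c + m * (s - t)) a = (c - m * t) • (1 : M) + m • a := by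
  have : (fun s : ℝ => c + m * (s - t)) = fun s => (c - m * t) + m * s := by
    funext s; ring
  rw [this, cfc_add a (fun _ => c - m * t) (fun s => m * s) (by fun_prop) (by fun_prop),
    cfc_const _ a ha, cfc_const_mul_id m a ha, Algebra.algebraMap_eq_smul_one]

theorem map_real_smul (τ : M →L[ℂ] ℂ) (c : ℝ) (x : M) : (τ (c • x)).re = c * (τ x).re := by
  have : c • x = (c : ℂ) • x := (Complex.coe_smul c x).symm
  rw [this, map_smul, smul_eq_mul, Complex.re_ofReal_mul]

/-- The trace version of Jensen's inequality. -/
theorem IsTracial.re_cfc_convex (hτ : IsTracial τ) {f : ℝ → ℝ} (hf : Continuous f)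
    (hsupp : ∀ t, ∃ m, ∀ s, f t + m * (s - t) ≤ f s) {a b : M} (ha : IsSelfAdjoint a)
    (hb : IsSelfAdjoint b) {v w : ℝ} (hv : 0 ≤ v) (hw : 0 ≤ w) (hvw : v + w = 1) :
    (τ (cfc f (v • a + w • b))).re ≤ v * (τ (cfc f a)).re + w * (τ (cfc f b)).re := by
  choose m hm using hsupp
  set c := v • a + w • b with hc_def
  have hc : IsSelfAdjoint c := (IsSelfAdjoint.all v |>.smul ha).add (IsSelfAdjoint.all w |>.smul hb)
  -- A partition of unity `h_i` on the spectrum of `c` is chosen so that `f` exceeds its supporting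
  -- line `ℓ_i` by less than `ε` on the support of `h_i`. Then `τ(f(c)) - ε τ(1) ≤ ∑ τ(ℓ_i(c)
  -- h_i(c))`. Each `ℓ_i` is affine, so `ℓ_i(c) = v ℓ_i(a) + w ℓ_i(b)`, and `ℓ_i ≤ f` can be used on
  -- `a` and `b` against the positive weight `h_i(c)`. Summing over `i` removes the weights.
  have hmain : ∀ ε > 0, (τ (cfc f c)).re - ε * (τ 1).re ≤
      v * (τ (cfc f a)).re + w * (τ (cfc f b)).re := by
    intro ε hε
    have hK : IsCompact (spectrum ℝ c) := ContinuousFunctionalCalculus.isCompact_spectrum c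
    let U : ℝ → Set ℝ := fun t => {s | f s - (f t + m t * (s - t)) < ε}
    have hUo : ∀ t, IsOpen (U t) := fun t => isOpen_lt (by fun_prop) continuous_const
    obtain ⟨T, hT⟩ := hK.elim_finite_subcover U hUo fun t _ =>
      mem_iUnion.2 ⟨t, by simpa [U] using hε⟩
    obtain ⟨h, hsub⟩ := PartitionOfUnity.exists_isSubordinate hK.isClosed
      (fun i : T => U i) (fun i => hUo i) (by
        intro s hs
        obtain ⟨t, ht, hst⟩ := mem_iUnion₂.1 (hT hs)
        exact mem_iUnion.2 ⟨⟨t, ht⟩, hst⟩)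
    have hsum : ∀ s ∈ spectrum ℝ c, ∑ i, h i s = 1 := by
      intro s hs
      rw [← finsum_eq_sum_of_fintype]
      exact h.sum_eq_one hs
    have hcont : ∀ i, Continuous fun s => h i s := fun i => (h i).continuous
    have hone : ∑ i, cfc (fun s => h i s) c = 1 := by
      rw [← cfc_sum (fun (i : T) s => h i s) c Finset.univ (fun i _ => (hcont i).continuousOn),
        ← cfc_const_one ℝ c]
      refine cfc_congr fun s hs => ?_
      simpa using hsum s hs
    have key : ∀ x : M, IsSelfAdjoint x → ∀ i : T,
        (τ (((f i - m i * i) • (1 : M) + m i • x) * cfc (fun s => h i s) c)).re ≤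
          (τ (cfc f x * cfc (fun s => h i s) c)).re := by
      intro x hx i
      have h1 := hτ.re_mul_nonneg (f := fun s => f s - (f i + m i * (s - i))) (by fun_prop)
        (hcont i) (a := x) (b := c) (fun s _ => sub_nonneg.2 (hm i s)) fun s _ => h.nonneg i s
      rw [cfc_sub f (fun s => f i + m i * (s - i)) x (by fun_prop) (by fun_prop),
        cfc_affine _ _ _ hx, sub_mul, map_sub, Complex.sub_re] at h1
      linarith
    have hexp : ∀ x : M, ∑ i : T, (τ (x * cfc (fun s => h i s) c)).re = (τ x).re := by
      intro x
      rw [← Complex.re_sum, ← map_sum, ← Finset.mul_sum, hone, mul_one]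
    have hlow : (τ (cfc f c)).re - ε * (τ 1).re ≤
        ∑ i : T, (τ (((f i - m i * i) • (1 : M) + m i • c) * cfc (fun s => h i s) c)).re := by
      have e1 : ∀ i : T, ((f i - m i * i) • (1 : M) + m i • c) * cfc (fun s => h i s) c =
          cfc (fun s => (f i + m i * (s - i)) * h i s) c := by
        intro i
        rw [cfc_mul (fun s => f i + m i * (s - i)) (fun s => h i s) c (by fun_prop)
          (hcont i).continuousOn, cfc_affine _ _ _ hc]
      simp only [e1]
      rw [← Complex.re_sum, ← map_sum, ← cfc_sum (fun (i : T) s => (f i + m i * (s - i)) * h i s) c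
        Finset.univ (fun i _ => by have := hcont i; fun_prop)]
      have e2 : (τ (cfc (fun s => f s - ε) c)).re = (τ (cfc f c)).re - ε * (τ 1).re := by
        rw [cfc_sub f (fun _ => ε) c (by fun_prop) (by fun_prop), cfc_const _ c hc,
          Algebra.algebraMap_eq_smul_one, map_sub, Complex.sub_re, map_real_smul]
      rw [← e2]
      have hcs : Continuous (∑ i : T, fun s => (f i + m i * (s - i)) * h i s) := by
        rw [Finset.sum_fn]
        exact continuous_finsetSum _ fun i _ => by have := hcont i; fun_prop
      refine hτ.re_cfc_mono (by fun_prop) hcs hc fun s hs => ?_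
      rw [Finset.sum_apply]
      have e3 : f s - ε = ∑ i : T, (f s - ε) * h i s := by
        rw [← Finset.mul_sum, hsum s hs, mul_one]
      rw [e3]
      refine Finset.sum_le_sum fun i _ => ?_
      by_cases hi : h i s = 0
      · simp [hi]
      · have hsU : s ∈ U i := hsub i (subset_tsupport _ hi)
        have : f s - (f i + m i * (s - i)) < ε := hsU
        exact mul_le_mul_of_nonneg_right (by linarith) (h.nonneg i s)
    refine hlow.trans ?_
    rw [← hexp (cfc f a), ← hexp (cfc f b), Finset.mul_sum, Finset.mul_sum,
      ← Finset.sum_add_distrib]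
    refine Finset.sum_le_sum fun i _ => ?_
    have e4 : (f i - m i * i) • (1 : M) + m i • c = v • ((f i - m i * i) • (1 : M) + m i • a) +
        w • ((f i - m i * i) • (1 : M) + m i • b) := by
      have : (f i - m i * i) • (1 : M) = (v + w) • (f i - m i * i) • (1 : M) := by
        rw [hvw, one_smul]
      rw [hc_def]
      nth_rw 1 [this]
      rw [add_smul]
      simp only [smul_add, smul_comm (m (i : ℝ)) v, smul_comm (m (i : ℝ)) w]
      abel
    rw [e4, add_mul, smul_mul_assoc, smul_mul_assoc, map_add, Complex.add_re, map_real_smul,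
      map_real_smul]
    exact add_le_add (mul_le_mul_of_nonneg_left (key a ha i) hv)
      (mul_le_mul_of_nonneg_left (key b hb i) hw)
  refine le_of_forall_pos_le_add fun δ hδ => ?_
  have h1 : 0 ≤ (τ 1).re := by simpa using hτ.nonneg 1
  have := hmain (δ / ((τ 1).re + 1)) (by positivity)
  have h2 : δ / ((τ 1).re + 1) * (τ 1).re ≤ δ := by
    rw [div_mul_eq_mul_div, div_le_iff₀ (by positivity)]
    nlinarith
  linarith

/-- The trace of a function of a self-adjoint element is determined by the moments. -/
theorem trace_cfc_eq_of_moments {M' : Type*} [CStarAlgebra M'] {τ : M →L[ℂ] ℂ} {τ' : M' →L[ℂ] ℂ}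
    {a : M} {b : M'} (ha : IsSelfAdjoint a) (hb : IsSelfAdjoint b)
    (h : ∀ n : ℕ, τ (a ^ n) = τ' (b ^ n)) {f : ℝ → ℝ} (hf : Continuous f) :
    τ (cfc f a) = τ' (cfc f b) := by
  have hpoly : ∀ p : Polynomial ℝ, τ (cfc (fun t => p.eval t) a) = τ' (cfc (fun t => p.eval t) b) := by
    intro p
    rw [cfc_polynomial p a ha, cfc_polynomial p b hb, Polynomial.aeval_eq_sum_range,
      Polynomial.aeval_eq_sum_range, map_sum, map_sum]
    refine Finset.sum_congr rfl fun n _ => ?_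
    rw [← Complex.coe_smul, ← Complex.coe_smul, map_smul, map_smul, h]
  -- The factor with `‖1‖` makes the bound on the spectrum valid without assuming that the algebras
  -- are nontrivial.
  set R := max ‖a‖ ‖b‖ * max ‖(1 : M)‖ ‖(1 : M')‖ with hR
  have hsa : ∀ t ∈ spectrum ℝ a, t ∈ Icc (-R) R := by
    intro t ht
    have h1 := spectrum.norm_le_norm_mul_of_mem ht
    rw [Real.norm_eq_abs] at h1
    refine abs_le.1 (h1.trans ?_)
    exact mul_le_mul (le_max_left _ _) (le_max_left _ _) (norm_nonneg _)
      (le_max_of_le_left (norm_nonneg _))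
  have hsb : ∀ t ∈ spectrum ℝ b, t ∈ Icc (-R) R := by
    intro t ht
    have h1 := spectrum.norm_le_norm_mul_of_mem ht
    rw [Real.norm_eq_abs] at h1
    refine abs_le.1 (h1.trans ?_)
    exact mul_le_mul (le_max_right _ _) (le_max_right _ _) (norm_nonneg _)
      (le_max_of_le_left (norm_nonneg _))
  refine eq_of_forall_dist_le fun ε hε => ?_
  have hC : 0 < ‖τ‖ + ‖τ'‖ + 1 := by positivity
  obtain ⟨p, hp⟩ := exists_polynomial_near_of_continuousOn (-R) R f hf.continuousOn
    (ε / (‖τ‖ + ‖τ'‖ + 1)) (by positivity)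
  have e1 : ‖cfc f a - cfc (fun t => p.eval t) a‖ ≤ ε / (‖τ‖ + ‖τ'‖ + 1) := by
    rw [← cfc_sub f (fun t => p.eval t) a (by fun_prop) (by fun_prop)]
    refine norm_cfc_le (by positivity) fun t ht => ?_
    rw [Real.norm_eq_abs, abs_sub_comm]
    exact (hp t (hsa t ht)).le
  have e2 : ‖cfc (fun t => p.eval t) b - cfc f b‖ ≤ ε / (‖τ‖ + ‖τ'‖ + 1) := by
    rw [← cfc_sub (fun t => p.eval t) f b (by fun_prop) (by fun_prop)]
    refine norm_cfc_le (by positivity) fun t ht => ?_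
    rw [Real.norm_eq_abs]
    exact (hp t (hsb t ht)).le
  have e3 : τ (cfc f a) - τ' (cfc f b) = τ (cfc f a - cfc (fun t => p.eval t) a) +
      τ' (cfc (fun t => p.eval t) b - cfc f b) := by
    rw [map_sub, map_sub, hpoly]; ring
  rw [dist_eq_norm, e3]
  calc _ ≤ ‖τ‖ * (ε / (‖τ‖ + ‖τ'‖ + 1)) + ‖τ'‖ * (ε / (‖τ‖ + ‖τ'‖ + 1)) :=
        (norm_add_le _ _).trans (add_le_add
          ((τ.le_opNorm _).trans (mul_le_mul_of_nonneg_left e1 (norm_nonneg _)))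
          ((τ'.le_opNorm _).trans (mul_le_mul_of_nonneg_left e2 (norm_nonneg _))))
    _ = (‖τ‖ + ‖τ'‖) * ε / (‖τ‖ + ‖τ'‖ + 1) := by ring
    _ ≤ ε := by
      rw [div_le_iff₀ hC]
      nlinarith

end Tracial
end QTorus

namespace QTorus

/-! ### Convexity of `τ(|x|^p)` and Minkowski's inequality -/

section TracePower

attribute [local instance] CStarAlgebra.spectralOrder CStarAlgebra.spectralOrderedRing

variable {M : Type*} [CStarAlgebra M]

/-- The self-adjoint dilation `[[0, x], [x⋆, 0]]`. -/
def dilation (x : M) : CStarMatrix (Fin 2) (Fin 2) M := CStarMatrix.ofMatrix !![0, x; star x, 0]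

/-- The functional `τ ⊗ Tr` on `2 × 2` matrices. -/
def matrixTrace (τ : M →L[ℂ] ℂ) : CStarMatrix (Fin 2) (Fin 2) M →L[ℂ] ℂ where
  toFun X := τ (X 0 0) + τ (X 1 1)
  map_add' X Y := by simp only [CStarMatrix.add_apply, map_add]; ring
  map_smul' c X := by simp only [CStarMatrix.smul_apply, map_smul, smul_add, RingHom.id_apply]
  cont := by
    have h : ∀ i j : Fin 2, Continuous fun X : CStarMatrix (Fin 2) (Fin 2) M => X i j :=
      fun i j => (continuous_apply j).comp (continuous_apply i)
    exact (τ.continuous.comp (h 0 0)).add (τ.continuous.comp (h 1 1))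

theorem matrixTrace_apply (τ : M →L[ℂ] ℂ) (X : CStarMatrix (Fin 2) (Fin 2) M) :
    matrixTrace τ X = τ (X 0 0) + τ (X 1 1) := rfl

variable {τ : M →L[ℂ] ℂ}

theorem IsTracial.matrixTrace (hτ : IsTracial τ) : IsTracial (matrixTrace τ) where
  nonneg X := by
    rw [matrixTrace_apply]
    simp only [CStarMatrix.mul_apply, Fin.sum_univ_two, CStarMatrix.star_apply, map_add,
      Complex.add_re]
    have := hτ.nonneg
    linarith [hτ.nonneg (X 0 0), hτ.nonneg (X 0 1), hτ.nonneg (X 1 0), hτ.nonneg (X 1 1)]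
  comm X Y := by
    simp only [matrixTrace_apply, CStarMatrix.mul_apply, Fin.sum_univ_two, map_add]
    rw [hτ.comm (X 0 0), hτ.comm (X 0 1), hτ.comm (X 1 0), hτ.comm (X 1 1)]
    ring

theorem isSelfAdjoint_dilation (x : M) : IsSelfAdjoint (dilation x) := by
  rw [IsSelfAdjoint]
  ext i j
  fin_cases i <;> fin_cases j <;> simp [dilation, CStarMatrix.star_apply]

theorem dilation_combination (v w : ℝ) (x y : M) :
    dilation (v • x + w • y) = (v : ℂ) • dilation x + (w : ℂ) • dilation y := by
  ext i j
  fin_cases i <;> fin_cases j <;> simp [dilation]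

theorem dilation_sq_pow (x : M) (n : ℕ) : (dilation x ^ 2) ^ n =
    CStarMatrix.ofMatrix !![(x * star x) ^ n, 0; 0, (star x * x) ^ n] := by
  induction n with
  | zero =>
    ext i j
    fin_cases i <;> fin_cases j <;> simp
  | succ n ih =>
    rw [pow_succ, ih]
    ext i j
    fin_cases i <;> fin_cases j <;>
      simp [dilation, pow_succ, CStarMatrix.mul_apply, Fin.sum_univ_two]

theorem IsTracial.pow_mul_star (hτ : IsTracial τ) (x : M) (n : ℕ) :
    τ ((x * star x) ^ n) = τ ((star x * x) ^ n) := by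
  cases n with
  | zero => simp
  | succ n =>
    have h : (x * star x) ^ (n + 1) = x * ((star x * x) ^ n * star x) := by
      induction n with
      | zero => simp
      | succ n ih => rw [pow_succ', ih, pow_succ' (star x * x)]; simp only [mul_assoc]
    rw [h, hτ.comm, mul_assoc, ← pow_succ]

/-- `τ(|x|^p)`, written as `τ((x⋆x)^{p/2})`. -/
def tracePow (τ : M →L[ℂ] ℂ) (p : ℝ) (x : M) : ℝ :=
  (τ (cfc (fun t : ℝ => t ^ (p / 2)) (star x * x))).re

/-- Comparing moments avoids computing the functional calculus of a block matrix entry by entry: the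
even moments of `X` already determine the trace of `|X|^p = (X²)^{p/2}`. -/
theorem re_cfc_abs_rpow_of_moments {M' : Type*} [CStarAlgebra M'] {τ' : M' →L[ℂ] ℂ} {X : M'}
    (hX : IsSelfAdjoint X) {x : M} (h : ∀ n : ℕ, τ' ((X ^ 2) ^ n) = 2 * τ ((star x * x) ^ n))
    {p : ℝ} (hp : 0 ≤ p) : (τ' (cfc (fun t : ℝ => |t| ^ p) X)).re = 2 * tracePow τ p x := by
  have hc : Continuous fun t : ℝ => t ^ (p / 2) := Real.continuous_rpow_const (by positivity)
  have h1 : cfc (fun t : ℝ => |t| ^ p) X = cfc (fun t : ℝ => t ^ (p / 2)) (X ^ 2) := by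
    rw [← cfc_comp_pow (fun t : ℝ => t ^ (p / 2)) 2 X hc.continuousOn hX]
    refine cfc_congr fun t _ => ?_
    rw [← sq_abs, ← Real.rpow_natCast, ← Real.rpow_mul (abs_nonneg t)]
    congr 1
    push_cast
    ring
  have h2 : τ' (cfc (fun t : ℝ => t ^ (p / 2)) (X ^ 2)) =
      ((2 : ℂ) • τ) (cfc (fun t : ℝ => t ^ (p / 2)) (star x * x)) :=
    trace_cfc_eq_of_moments (hX.pow 2) (IsSelfAdjoint.star_mul_self x) (fun n => by simp [h]) hc
  rw [h1, h2, tracePow, smul_apply, smul_eq_mul]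
  simp

theorem IsTracial.matrixTrace_dilation (hτ : IsTracial τ) (x : M) (n : ℕ) :
    QTorus.matrixTrace τ ((dilation x ^ 2) ^ n) = 2 * τ ((star x * x) ^ n) := by
  rw [dilation_sq_pow, matrixTrace_apply]
  simp [hτ.pow_mul_star]
  ring

/-- For nonnegative arguments this is Bernoulli's inequality for `v/u`. The sign of `t` transfers it
to the whole line because `sign t · (s - t) ≤ |s| - |t|`. -/
theorem exists_supporting_line {p : ℝ} (hp : 1 ≤ p) (t : ℝ) :
    ∃ m, ∀ s, |t| ^ p + m * (s - t) ≤ |s| ^ p := by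
  have hpos : ∀ u v : ℝ, 0 ≤ u → 0 ≤ v → u ^ p + p * u ^ (p - 1) * (v - u) ≤ v ^ p := by
    intro u v hu hv
    rcases hu.eq_or_lt with rfl | hu
    · rcases hp.eq_or_lt with rfl | hp
      · simp
      · rw [Real.zero_rpow (by linarith), Real.zero_rpow (by linarith)]
        simpa using Real.rpow_nonneg hv p
    · have h1 := one_add_mul_self_le_rpow_one_add (s := v / u - 1) (by
        have : 0 ≤ v / u := by positivity
        linarith) hp
      rw [add_sub_cancel, Real.div_rpow hv hu.le, le_div_iff₀ (by positivity)] at h1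
      refine le_trans (le_of_eq ?_) h1
      rw [Real.rpow_sub_one hu.ne']
      field_simp
  refine ⟨SignType.sign t * (p * |t| ^ (p - 1)), fun s => ?_⟩
  refine le_trans ?_ (hpos |t| |s| (abs_nonneg _) (abs_nonneg _))
  have h2 : 0 ≤ p * |t| ^ (p - 1) := by positivity
  have h3 : SignType.sign t * (s - t) ≤ |s| - |t| := by
    rcases lt_trichotomy t 0 with ht | rfl | ht
    · rw [sign_neg ht, abs_of_neg ht]
      have := neg_abs_le s
      simp
      linarith
    · simp
    · rw [sign_pos ht, abs_of_pos ht]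
      have := le_abs_self s
      simp
      linarith
  nlinarith [mul_le_mul_of_nonneg_left h3 h2]

/-- Jensen's inequality needs self-adjoint arguments, while `x` and `y` are arbitrary. A
self-adjoint `D x`, compatible with real combinations and with even moments twice those of `|x|`,
moves convexity of `|t|^p` to `τ(|x|^p)`. -/
theorem tracePow_convex_of_dilation {M' : Type*} [CStarAlgebra M'] {τ' : M' →L[ℂ] ℂ}
    (hτ' : IsTracial τ') (D : M → M') (hD : ∀ x, IsSelfAdjoint (D x))
    (hadd : ∀ (v w : ℝ) (x y : M), D (v • x + w • y) = (v : ℂ) • D x + (w : ℂ) • D y)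
    (hmom : ∀ (x : M) (n : ℕ), τ' ((D x ^ 2) ^ n) = 2 * τ ((star x * x) ^ n))
    {p : ℝ} (hp : 1 ≤ p) (x y : M) {v w : ℝ} (hv : 0 ≤ v) (hw : 0 ≤ w) (hvw : v + w = 1) :
    tracePow τ p (v • x + w • y) ≤ v * tracePow τ p x + w * tracePow τ p y := by
  have hp0 : 0 ≤ p := by linarith
  have h := hτ'.re_cfc_convex (f := fun t => |t| ^ p)
    ((Real.continuous_rpow_const hp0).comp continuous_abs) (exists_supporting_line hp)
    (hD x) (hD y) hv hw hvw
  rw [← Complex.coe_smul v, ← Complex.coe_smul w, ← hadd, re_cfc_abs_rpow_of_moments (hD _) (hmom _) hp0,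
    re_cfc_abs_rpow_of_moments (hD _) (hmom _) hp0,
    re_cfc_abs_rpow_of_moments (hD _) (hmom _) hp0] at h
  linarith

theorem IsTracial.tracePow_convex (hτ : IsTracial τ) {p : ℝ} (hp : 1 ≤ p) (x y : M) {v w : ℝ}
    (hv : 0 ≤ v) (hw : 0 ≤ w) (hvw : v + w = 1) :
    tracePow τ p (v • x + w • y) ≤ v * tracePow τ p x + w * tracePow τ p y :=
  tracePow_convex_of_dilation hτ.matrixTrace dilation isSelfAdjoint_dilation dilation_combination
    hτ.matrixTrace_dilation hp x y hv hw hvw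

theorem IsTracial.tracePow_nonneg (hτ : IsTracial τ) {p : ℝ} (hp : 0 ≤ p) (x : M) :
    0 ≤ tracePow τ p x :=
  hτ.re_cfc_nonneg (Real.continuous_rpow_const (by positivity)) (IsSelfAdjoint.star_mul_self x)
    fun t ht => Real.rpow_nonneg (spectrum_star_mul_self_nonneg t ht) _

theorem tracePow_smul (τ : M →L[ℂ] ℂ) {p : ℝ} (hp : 0 ≤ p) (c : ℝ) (x : M) :
    tracePow τ p (c • x) = |c| ^ p * tracePow τ p x := by
  have hc : Continuous fun t : ℝ => t ^ (p / 2) := Real.continuous_rpow_const (by positivity)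
  have h1 : star (c • x) * (c • x) = (c ^ 2) • (star x * x) := by
    rw [star_smul, smul_mul_smul_comm, star_trivial, sq]
  rw [tracePow, h1, ← cfc_comp_smul (c ^ 2) (fun t : ℝ => t ^ (p / 2)) (star x * x)
    hc.continuousOn (IsSelfAdjoint.star_mul_self x)]
  have h2 : cfc (fun t : ℝ => (c ^ 2 • t) ^ (p / 2)) (star x * x) =
      |c| ^ p • cfc (fun t : ℝ => t ^ (p / 2)) (star x * x) := by
    rw [← cfc_smul _ _ _ hc.continuousOn]
    refine cfc_congr fun t ht => ?_
    change (c ^ 2 * t) ^ (p / 2) = |c| ^ p * t ^ (p / 2)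
    rw [Real.mul_rpow (sq_nonneg c) (spectrum_star_mul_self_nonneg t ht), ← sq_abs,
      ← Real.rpow_natCast, ← Real.rpow_mul (abs_nonneg c)]
    congr 2
    push_cast
    ring
  rw [h2, map_real_smul, tracePow]

/-- Minkowski's inequality for the noncommutative `L_p`-norm of a tracial functional. -/
theorem IsTracial.minkowski (hτ : IsTracial τ) {p : ℝ} (hp : 1 ≤ p) (x y : M) :
    tracePow τ p (x + y) ^ (1 / p) ≤ tracePow τ p x ^ (1 / p) + tracePow τ p y ^ (1 / p) := by
  have hp0 : 0 < p := by linarith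
  refine le_of_forall_pos_le_add fun ε hε => ?_
  -- This is the gauge argument: `x/u` and `y/v` lie in the convex set `τ(|·|^p) ≤ 1`, and
  -- `(x+y)/(u+v)` is a convex combination of them. The added `ε/2` keeps `u` and `v` positive when
  -- a norm vanishes.
  set u := tracePow τ p x ^ (1 / p) + ε / 2 with hu
  set v := tracePow τ p y ^ (1 / p) + ε / 2 with hv
  have key : ∀ z : M, ∀ s : ℝ, s = tracePow τ p z ^ (1 / p) + ε / 2 →
      0 < s ∧ tracePow τ p (s⁻¹ • z) ≤ 1 := by
    intro z s hs
    have h0 := hτ.tracePow_nonneg hp0.le z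
    have h1 : 0 ≤ tracePow τ p z ^ (1 / p) := Real.rpow_nonneg h0 _
    have hs0 : 0 < s := by linarith
    refine ⟨hs0, ?_⟩
    rw [tracePow_smul τ hp0.le, abs_of_pos (inv_pos.2 hs0), Real.inv_rpow hs0.le,
      inv_mul_le_iff₀ (by positivity), mul_one]
    calc tracePow τ p z = (tracePow τ p z ^ (1 / p)) ^ p := by
          rw [← Real.rpow_mul h0, one_div_mul_cancel hp0.ne', Real.rpow_one]
      _ ≤ s ^ p := Real.rpow_le_rpow h1 (by linarith) hp0.le
  obtain ⟨hu0, hu1⟩ := key x u hu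
  obtain ⟨hv0, hv1⟩ := key y v hv
  have hs0 : 0 < u + v := by linarith
  have hconv := hτ.tracePow_convex hp (u⁻¹ • x) (v⁻¹ • y) (v := u / (u + v)) (w := v / (u + v))
    (by positivity) (by positivity) (by rw [← add_div, div_self hs0.ne'])
  have e1 : (u / (u + v)) • (u⁻¹ • x) + (v / (u + v)) • (v⁻¹ • y) = (u + v)⁻¹ • (x + y) := by
    rw [smul_smul, smul_smul, smul_add]
    congr 2 <;> field_simp
  rw [e1, tracePow_smul τ hp0.le, abs_of_pos (inv_pos.2 hs0), Real.inv_rpow hs0.le] at hconv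
  have h2 : tracePow τ p (x + y) ≤ (u + v) ^ p := by
    have h3 : ((u + v) ^ p)⁻¹ * tracePow τ p (x + y) ≤ 1 := by
      refine hconv.trans ?_
      have := mul_le_mul_of_nonneg_left hu1 (show 0 ≤ u / (u + v) by positivity)
      have := mul_le_mul_of_nonneg_left hv1 (show 0 ≤ v / (u + v) by positivity)
      have : u / (u + v) + v / (u + v) = 1 := by rw [← add_div, div_self hs0.ne']
      linarith
    rwa [inv_mul_le_iff₀ (by positivity), mul_one] at h3
  calc tracePow τ p (x + y) ^ (1 / p) ≤ ((u + v) ^ p) ^ (1 / p) :=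
        Real.rpow_le_rpow (hτ.tracePow_nonneg hp0.le _) h2 (by positivity)
    _ = u + v := by rw [← Real.rpow_mul hs0.le, mul_one_div_cancel hp0.ne', Real.rpow_one]
    _ = _ := by rw [hu, hv]; ring

end TracePower
end QTorus

namespace QTorus

/-! ### The `C⋆`-algebra of the quantum torus and its trace -/

variable {d : ℕ} (θ : Matrix (Fin d) (Fin d) ℝ)

theorem monomial_mul (m n : Fin d → ℤ) :
    monomial θ m * monomial θ n = (Circle.exp (phase θ m n) : ℂ) • monomial θ (m + n) := by
  apply op_ext
  intro k
  change monomial θ m (monomial θ n (basisVec k)) = _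
  have h : phase θ n k + phase θ m (k + n) = phase θ m n + phase θ (m + n) k := by
    simp only [phase, Pi.add_apply, Int.cast_add, mul_add, add_mul, Finset.sum_add_distrib]
    ring
  rw [smul_apply, monomial_basisVec, map_smul, monomial_basisVec, monomial_basisVec, smul_smul,
    smul_smul, ← Circle.coe_mul, ← Circle.coe_mul, ← Circle.exp_add, ← Circle.exp_add, h,
    add_assoc, add_comm n m]

theorem monomial_zero : monomial θ 0 = 1 := by
  apply op_ext
  intro k
  rw [monomial_basisVec]
  simp [phase]

theorem monomial_mem_unitary (m : Fin d → ℤ) : star (monomial θ m) * monomial θ m = 1 := by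
  rw [star_monomial, smul_mul_assoc, monomial_mul, smul_smul, neg_add_cancel, monomial_zero,
    ← Circle.coe_mul, ← Circle.exp_add]
  have : phase θ m m + phase θ (-m) m = 0 := by
    simp only [phase, Pi.neg_apply, Int.cast_neg, neg_mul, Finset.sum_neg_distrib]
    ring
  simp [this]

/-- The trace as a continuous linear functional. -/
def traceL (d : ℕ) : Op d →L[ℂ] ℂ :=
  (innerSL ℂ (basisVec (0 : Fin d → ℤ))).comp (ContinuousLinearMap.apply ℂ (Hil d) (basisVec 0))

theorem traceL_apply (x : Op d) : traceL d x = trace x := rfl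

theorem trace_monomial (m : Fin d → ℤ) : trace (monomial θ m) = if m = 0 then 1 else 0 := by
  unfold trace
  rw [monomial_basisVec, inner_smul_right, basisVec, lp.inner_single_left, zero_add]
  by_cases h : m = 0
  · subst h
    simp [basisVec, phase]
  · simp [basisVec, h, Ne.symm h]

/-- The polynomials in the generators. -/
def polyAlgebra : StarSubalgebra ℂ (Op d) where
  carrier := Submodule.span ℂ (range (monomial θ))
  add_mem' := Submodule.add_mem _
  zero_mem' := Submodule.zero_mem _
  one_mem' := Submodule.subset_span ⟨0, monomial_zero θ⟩
  mul_mem' {x y} hx hy := by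
    have : x * y ∈ Submodule.span ℂ (range (monomial θ)) * Submodule.span ℂ (range (monomial θ)) :=
      Submodule.mul_mem_mul hx hy
    rw [Submodule.span_mul_span] at this
    refine Submodule.span_le.2 ?_ this
    rintro _ ⟨_, ⟨m, rfl⟩, _, ⟨n, rfl⟩, rfl⟩
    change monomial θ m * monomial θ n ∈ _
    rw [monomial_mul]
    exact Submodule.smul_mem _ _ (Submodule.subset_span ⟨_, rfl⟩)
  algebraMap_mem' r := by
    rw [Algebra.algebraMap_eq_smul_one, ← monomial_zero θ]
    exact Submodule.smul_mem _ _ (Submodule.subset_span ⟨_, rfl⟩)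
  star_mem' {x} hx := by
    induction hx using Submodule.span_induction with
    | mem x hx =>
      obtain ⟨m, rfl⟩ := hx
      rw [star_monomial]
      exact Submodule.smul_mem _ _ (Submodule.subset_span ⟨_, rfl⟩)
    | zero => simp
    | add x y _ _ hx hy => rw [star_add]; exact Submodule.add_mem _ hx hy
    | smul c x _ hx => rw [star_smul]; exact Submodule.smul_mem _ _ hx

/-- The `C⋆`-algebra generated by the generators. -/
def torusAlgebra : StarSubalgebra ℂ (Op d) := (polyAlgebra θ).topologicalClosure

instance isClosed_torusAlgebra : IsClosed (torusAlgebra θ : Set (Op d)) :=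
  StarSubalgebra.isClosed_topologicalClosure _

theorem mem_torusAlgebra_of_mem_span {x : Op d}
    (hx : x ∈ Submodule.span ℂ (range (monomial θ))) : x ∈ torusAlgebra θ :=
  StarSubalgebra.le_topologicalClosure (polyAlgebra θ) hx

theorem monomial_mem (m : Fin d → ℤ) : monomial θ m ∈ torusAlgebra θ :=
  mem_torusAlgebra_of_mem_span θ (Submodule.subset_span ⟨m, rfl⟩)

/-- Unless `n = -m` both traces vanish. If `n = -m`, the two phases coincide because `phase` is
bilinear; skew-symmetry of `θ` plays no role. -/
theorem trace_monomial_mul_comm (m n : Fin d → ℤ) :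
    trace (monomial θ m * monomial θ n) = trace (monomial θ n * monomial θ m) := by
  rw [monomial_mul, monomial_mul, ← traceL_apply, ← traceL_apply, map_smul, map_smul, traceL_apply,
    traceL_apply, trace_monomial, trace_monomial, add_comm n m]
  by_cases h : m + n = 0
  · have hn : n = -m := (neg_eq_of_add_eq_zero_right h).symm
    subst hn
    congr 3
    simp only [phase, Pi.neg_apply, Int.cast_neg, neg_mul, mul_neg, Finset.sum_neg_distrib]
  · simp [h]

theorem trace_mul_comm {x y : Op d} (hx : x ∈ torusAlgebra θ) (hy : y ∈ torusAlgebra θ) :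
    trace (x * y) = trace (y * x) := by
  have hcl : ∀ z : Op d, IsClosed {x : Op d | trace (x * z) = trace (z * x)} := by
    intro z
    refine isClosed_eq ((traceL d).continuous.comp (continuous_id.mul continuous_const))
      ((traceL d).continuous.comp (continuous_const.mul continuous_id))
  have hspan : ∀ z : Op d, (∀ m, trace (monomial θ m * z) = trace (z * monomial θ m)) →
      ∀ x ∈ torusAlgebra θ, trace (x * z) = trace (z * x) := by
    intro z hz x hx
    refine closure_minimal (s := (polyAlgebra θ : Set (Op d)))
      (t := {x : Op d | trace (x * z) = trace (z * x)}) (fun w hw => ?_) (hcl z) hx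
    change w ∈ Submodule.span ℂ (range (monomial θ)) at hw
    change trace (w * z) = trace (z * w)
    induction hw using Submodule.span_induction with
    | mem w hw =>
      obtain ⟨m, rfl⟩ := hw
      exact hz m
    | zero => simp
    | add u v _ _ hu hv =>
      rw [add_mul, mul_add, ← traceL_apply, ← traceL_apply, map_add, map_add]
      simp only [traceL_apply, hu, hv]
    | smul c u _ hu =>
      rw [smul_mul_assoc, mul_smul_comm, ← traceL_apply, ← traceL_apply, map_smul, map_smul]
      simp only [traceL_apply, hu]
  refine hspan y (fun m => ?_) x hx
  exact (hspan (monomial θ m) (fun n => trace_monomial_mul_comm θ n m) y hy).symm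

/-- The trace on the `C⋆`-algebra of the quantum torus. -/
def torusTrace : torusAlgebra θ →L[ℂ] ℂ where
  toFun x := trace (x : Op d)
  map_add' x y := (traceL d).map_add x y
  map_smul' c x := (traceL d).map_smul c x
  cont := (traceL d).continuous.comp continuous_subtype_val

theorem re_trace_star_mul_self_nonneg (x : Op d) : 0 ≤ (trace (star x * x)).re := by
  unfold trace
  rw [mul_apply_eq_comp, ContinuousLinearMap.star_eq_adjoint,
    ContinuousLinearMap.adjoint_inner_right]
  exact inner_self_nonneg (𝕜 := ℂ)

theorem isTracial_torusTrace : IsTracial (torusTrace θ) where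
  nonneg x := re_trace_star_mul_self_nonneg (x : Op d)
  comm x y := trace_mul_comm θ x.2 y.2

/-! ### Properties of the `L_p`-norms -/

section VectorNorm

variable {H : Type*} [NormedAddCommGroup H] [InnerProductSpace ℂ H] [CompleteSpace H]
  {ξ : H} {p : ℝ≥0∞}

theorem one_le_toReal (hp1 : 1 ≤ p) (hp : p ≠ ∞) : 1 ≤ p.toReal := by
  simpa using ENNReal.toReal_mono hp hp1

theorem abs_rpow_eq_cfc {s : ℝ} (hs : 0 ≤ s) (x : H →L[ℂ] H) :
    CFC.abs x ^ s = cfc (fun t : ℝ => t ^ (s / 2)) (star x * x) := by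
  have h0 : 0 ≤ star x * x := star_mul_self_nonneg x
  rw [CFC.abs, CFC.sqrt_eq_rpow, CFC.rpow_rpow_of_exponent_nonneg _ _ _ (by norm_num) hs,
    CFC.rpow_eq_cfc_real]
  congr 1
  funext t
  congr 1
  ring

theorem vectorLpNorm_top (ξ : H) (x : H →L[ℂ] H) : vectorLpNorm ξ ∞ x = ‖x‖ := by
  simp [vectorLpNorm]

theorem vectorLpNorm_of_ne_top (ξ : H) (hp : p ≠ ∞) (x : H →L[ℂ] H) : vectorLpNorm ξ p x =
      (⟪ξ, cfc (fun t : ℝ => t ^ (p.toReal / 2)) (star x * x) ξ⟫_ℂ).re ^ (1 / p.toReal) := by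
  rw [vectorLpNorm, if_neg hp, abs_rpow_eq_cfc ENNReal.toReal_nonneg]

/-- The vector state is tracial only on a suitable subalgebra, so the norm defined through operators
on `H` must be computed inside it. Closedness of the subalgebra makes the two functional calculi
agree. -/
theorem vectorLpNorm_coe (hp : p ≠ ∞) {S : StarSubalgebra ℂ (H →L[ℂ] H)}
    [hS : IsClosed (S : Set (H →L[ℂ] H))] {τ : S →L[ℂ] ℂ}
    (hτ : ∀ y : S, τ y = ⟪ξ, (y : H →L[ℂ] H) ξ⟫_ℂ) (x : S) :
    vectorLpNorm ξ p (x : H →L[ℂ] H) = tracePow τ p.toReal x ^ (1 / p.toReal) := by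
  rw [vectorLpNorm_of_ne_top _ hp, tracePow]
  have h := StarAlgHomClass.map_cfc S.subtype
    (fun t : ℝ => t ^ (p.toReal / 2)) (star x * x)
    ((Real.continuous_rpow_const (by positivity)).continuousOn) continuous_subtype_val
    (IsSelfAdjoint.star_mul_self x) (IsSelfAdjoint.star_mul_self (x : H →L[ℂ] H))
  change ((cfc (fun t : ℝ => t ^ (p.toReal / 2)) (star x * x) : S) : H →L[ℂ] H) =
    cfc (fun t : ℝ => t ^ (p.toReal / 2)) (star (x : H →L[ℂ] H) * (x : H →L[ℂ] H)) at h
  rw [← h, hτ]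

theorem re_inner_cfc_le (hξ : ‖ξ‖ = 1) {s : ℝ} (hs : 0 ≤ s) (x : H →L[ℂ] H) :
    (⟪ξ, cfc (fun t : ℝ => t ^ (s / 2)) (star x * x) ξ⟫_ℂ).re ≤ ‖x‖ ^ s := by
  have h1 : ‖cfc (fun t : ℝ => t ^ (s / 2)) (star x * x)‖ ≤ ‖x‖ ^ s := by
    refine norm_cfc_le (by positivity) fun t ht => ?_
    have h0 : 0 ≤ t := spectrum_star_mul_self_nonneg t ht
    have h2 : ‖t‖ ≤ ‖star x * x‖ := by
      have : Nontrivial H := ⟨ξ, 0, fun h => by simp [h] at hξ⟩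
      exact spectrum.norm_le_norm_of_mem ht
    rw [CStarRing.norm_star_mul_self, Real.norm_of_nonneg h0] at h2
    rw [Real.norm_of_nonneg (Real.rpow_nonneg h0 _)]
    calc t ^ (s / 2) ≤ (‖x‖ * ‖x‖) ^ (s / 2) := Real.rpow_le_rpow h0 h2 (by positivity)
      _ = ‖x‖ ^ s := by
        rw [← sq, ← Real.rpow_natCast, ← Real.rpow_mul (norm_nonneg x)]
        congr 1
        push_cast
        ring
  calc _ ≤ ‖⟪ξ, cfc (fun t : ℝ => t ^ (s / 2)) (star x * x) ξ⟫_ℂ‖ := Complex.re_le_norm _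
    _ ≤ ‖ξ‖ * ‖cfc (fun t : ℝ => t ^ (s / 2)) (star x * x) ξ‖ := norm_inner_le_norm _ _
    _ ≤ ‖ξ‖ * (‖cfc (fun t : ℝ => t ^ (s / 2)) (star x * x)‖ * ‖ξ‖) :=
      mul_le_mul_of_nonneg_left (ContinuousLinearMap.le_opNorm _ _) (norm_nonneg _)
    _ ≤ ‖x‖ ^ s := by rw [hξ]; simpa using h1

theorem re_inner_nonneg (ξ : H) {x : H →L[ℂ] H} (hx : 0 ≤ x) : 0 ≤ (⟪ξ, x ξ⟫_ℂ).re :=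
  (Complex.le_def.1 (((ContinuousLinearMap.nonneg_iff_isPositive _).1 hx).inner_nonneg_right ξ)).1

theorem vectorLpNorm_nonneg (ξ : H) (p : ℝ≥0∞) (x : H →L[ℂ] H) : 0 ≤ vectorLpNorm ξ p x := by
  unfold vectorLpNorm
  split_ifs
  · exact norm_nonneg _
  · exact Real.rpow_nonneg (re_inner_nonneg _ CFC.rpow_nonneg) _

theorem vectorLpNorm_le_norm (hp1 : 1 ≤ p) (hξ : ‖ξ‖ = 1) (x : H →L[ℂ] H) :
    vectorLpNorm ξ p x ≤ ‖x‖ := by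
  by_cases hp : p = ∞
  · subst hp
    rw [vectorLpNorm_top]
  · have hp' := one_le_toReal hp1 hp
    have h2 := re_inner_cfc_le hξ (s := p.toReal) (by linarith) x
    rw [vectorLpNorm_of_ne_top _ hp]
    have h5 : 0 ≤ cfc (fun t : ℝ => t ^ (p.toReal / 2)) (star x * x) :=
      cfc_nonneg fun t ht => Real.rpow_nonneg (spectrum_star_mul_self_nonneg t ht) _
    calc _ ≤ (‖x‖ ^ p.toReal) ^ (1 / p.toReal) :=
          Real.rpow_le_rpow (re_inner_nonneg ξ h5) h2 (by positivity)
      _ = ‖x‖ := by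
        rw [← Real.rpow_mul (norm_nonneg x), mul_one_div_cancel (by linarith), Real.rpow_one]

theorem vectorLpNorm_smul (hp1 : 1 ≤ p) (ξ : H) (c : ℂ) (x : H →L[ℂ] H) :
    vectorLpNorm ξ p (c • x) = ‖c‖ * vectorLpNorm ξ p x := by
  by_cases hp : p = ∞
  · subst hp
    rw [vectorLpNorm_top, vectorLpNorm_top, norm_smul]
  · have hp' := one_le_toReal hp1 hp
    have h0 : 0 ≤ p.toReal := by linarith
    have hc : Continuous fun t : ℝ => t ^ (p.toReal / 2) :=
      Real.continuous_rpow_const (by positivity)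
    have h1 : star (c • x) * (c • x) = (‖c‖ ^ 2) • (star x * x) := by
      rw [star_smul, smul_mul_smul_comm, ← Complex.coe_smul]
      congr 1
      have := Complex.conj_mul' c
      simpa using this
    have h2 : cfc (fun t : ℝ => t ^ (p.toReal / 2)) (star (c • x) * (c • x)) =
        ‖c‖ ^ p.toReal • cfc (fun t : ℝ => t ^ (p.toReal / 2)) (star x * x) := by
      rw [h1, ← cfc_comp_smul (‖c‖ ^ 2) (fun t : ℝ => t ^ (p.toReal / 2)) (star x * x)
        hc.continuousOn (IsSelfAdjoint.star_mul_self x), ← cfc_smul _ _ _ hc.continuousOn]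
      refine cfc_congr fun t ht => ?_
      change (‖c‖ ^ 2 * t) ^ (p.toReal / 2) = ‖c‖ ^ p.toReal * t ^ (p.toReal / 2)
      rw [Real.mul_rpow (sq_nonneg _) (spectrum_star_mul_self_nonneg t ht),
        ← Real.rpow_natCast, ← Real.rpow_mul (norm_nonneg c)]
      congr 2
      push_cast
      ring
    have h5 : 0 ≤ cfc (fun t : ℝ => t ^ (p.toReal / 2)) (star x * x) :=
      cfc_nonneg fun t ht => Real.rpow_nonneg (spectrum_star_mul_self_nonneg t ht) _
    rw [vectorLpNorm_of_ne_top _ hp, vectorLpNorm_of_ne_top _ hp, h2, ← Complex.coe_smul,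
      smul_apply, inner_smul_right, Complex.re_ofReal_mul,
      Real.mul_rpow (by positivity) (re_inner_nonneg ξ h5), ← Real.rpow_mul (norm_nonneg c),
      mul_one_div_cancel (by linarith), Real.rpow_one]

theorem vectorLpNorm_of_star_mul_self (hξ : ‖ξ‖ = 1) {x : H →L[ℂ] H} (hx : star x * x = 1) :
    vectorLpNorm ξ p x = 1 := by
  by_cases hp : p = ∞
  · subst hp
    rw [vectorLpNorm_top]
    have h1 := CStarRing.norm_star_mul_self (x := x)
    have : Nontrivial H := ⟨ξ, 0, fun h => by simp [h] at hξ⟩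
    rw [hx, norm_one] at h1
    nlinarith [norm_nonneg x]
  · rw [vectorLpNorm_of_ne_top _ hp, hx]
    have : cfc (fun t : ℝ => t ^ (p.toReal / 2)) (1 : H →L[ℂ] H) = 1 := by
      have := cfc_algebraMap (A := H →L[ℂ] H) (1 : ℝ) (fun t : ℝ => t ^ (p.toReal / 2))
      simpa using this
    rw [this]
    simp [hξ]

/-- Conjugation by `u` commutes with functional calculus, and `u⋆ξ = ξ` makes the vector state
invariant under it. No trace property is used. -/
theorem vectorLpNorm_unitary_conj (u : unitary (H →L[ℂ] H))
    (hu : star (u : H →L[ℂ] H) ξ = ξ) (x : H →L[ℂ] H) :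
    vectorLpNorm ξ p ((u : H →L[ℂ] H) * x * star (u : H →L[ℂ] H)) = vectorLpNorm ξ p x := by
  have huu : star (u : H →L[ℂ] H) * (u : H →L[ℂ] H) = 1 := Unitary.coe_star_mul_self u
  by_cases hp : p = ∞
  · subst hp
    rw [vectorLpNorm_top, vectorLpNorm_top]
    exact NonUnitalStarAlgHom.norm_map (Unitary.conjStarAlgAut ℂ (H →L[ℂ] H) u)
      (EquivLike.injective _) x
  · rw [vectorLpNorm_of_ne_top _ hp, vectorLpNorm_of_ne_top _ hp]
    have h1 : star ((u : H →L[ℂ] H) * x * star (u : H →L[ℂ] H)) *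
        ((u : H →L[ℂ] H) * x * star (u : H →L[ℂ] H)) =
        Unitary.conjStarAlgAut ℂ (H →L[ℂ] H) u (star x * x) := by
      rw [Unitary.conjStarAlgAut_apply]
      simp only [star_mul, star_star]
      calc _ = (u : H →L[ℂ] H) * star x * (star (u : H →L[ℂ] H) * (u : H →L[ℂ] H)) * x *
            star (u : H →L[ℂ] H) := by simp only [mul_assoc]
        _ = _ := by rw [huu]; simp only [mul_assoc, mul_one]
    have h := StarAlgHomClass.map_cfc (Unitary.conjStarAlgAut ℂ (H →L[ℂ] H) u)
      (fun t : ℝ => t ^ (p.toReal / 2)) (star x * x)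
      ((Real.continuous_rpow_const (by positivity)).continuousOn)
      (by
        change Continuous fun y : H →L[ℂ] H => (u : H →L[ℂ] H) * y * star (u : H →L[ℂ] H)
        fun_prop)
      (IsSelfAdjoint.star_mul_self x) ((IsSelfAdjoint.star_mul_self x).map _)
    rw [h1, ← h, Unitary.conjStarAlgAut_apply]
    have hadj : ∀ y : H, ⟪ξ, (u : H →L[ℂ] H) y⟫_ℂ = ⟪ξ, y⟫_ℂ := by
      intro y
      rw [← ContinuousLinearMap.adjoint_inner_left, ← ContinuousLinearMap.star_eq_adjoint, hu]
    rw [mul_apply_eq_comp, mul_apply_eq_comp, hu, hadj]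

end VectorNorm

variable {θ} {p : ℝ≥0∞}

theorem torusLpNorm_nonneg (p : ℝ≥0∞) (x : Op d) : 0 ≤ torusLpNorm p x := vectorLpNorm_nonneg _ _ _

theorem torusLpNorm_add_le (hp1 : 1 ≤ p) {x y : Op d} (hx : x ∈ torusAlgebra θ)
    (hy : y ∈ torusAlgebra θ) : torusLpNorm p (x + y) ≤ torusLpNorm p x + torusLpNorm p y := by
  unfold torusLpNorm
  by_cases hp : p = ∞
  · subst hp
    simp only [vectorLpNorm_top]
    exact norm_add_le _ _
  · have h := (isTracial_torusTrace θ).minkowski (one_le_toReal hp1 hp) (⟨x, hx⟩ : torusAlgebra θ)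
      ⟨y, hy⟩
    have hτ : ∀ y : torusAlgebra θ, torusTrace θ y = ⟪basisVec 0, (y : Op d) (basisVec 0)⟫_ℂ :=
      fun _ => rfl
    rwa [← vectorLpNorm_coe hp hτ, ← vectorLpNorm_coe hp hτ, ← vectorLpNorm_coe hp hτ] at h

theorem norm_basisVec (n : Fin d → ℤ) : ‖basisVec n‖ = 1 := by
  simp [basisVec, lp.norm_single]

theorem torusLpNorm_le_norm (hp1 : 1 ≤ p) (x : Op d) : torusLpNorm p x ≤ ‖x‖ :=
  vectorLpNorm_le_norm hp1 (norm_basisVec 0) x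

theorem torusLpNorm_smul (hp1 : 1 ≤ p) (c : ℂ) (x : Op d) :
    torusLpNorm p (c • x) = ‖c‖ * torusLpNorm p x := vectorLpNorm_smul hp1 _ c x

theorem torusLpNorm_monomial (θ : Matrix (Fin d) (Fin d) ℝ) (p : ℝ≥0∞) (m : Fin d → ℤ) :
    torusLpNorm p (monomial θ m) = 1 :=
  vectorLpNorm_of_star_mul_self (norm_basisVec 0) (monomial_mem_unitary θ m)

end QTorus

namespace QTorus

/-! ### Fourier multipliers -/

variable {d : ℕ}

/-- The polynomial `∑_{m ∈ s} a_m U^m`. -/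
def poly (θ : Matrix (Fin d) (Fin d) ℝ) (s : Finset (Fin d → ℤ)) (a : (Fin d → ℤ) → ℂ) : Op d :=
  ∑ m ∈ s, a m • monomial θ m

theorem poly_mem (θ : Matrix (Fin d) (Fin d) ℝ) (s : Finset (Fin d → ℤ)) (a : (Fin d → ℤ) → ℂ) :
    poly θ s a ∈ torusAlgebra θ :=
  sum_mem fun m _ => (torusAlgebra θ).smul_mem (monomial_mem θ m) (a m)

theorem poly_add (θ : Matrix (Fin d) (Fin d) ℝ) (s : Finset (Fin d → ℤ))
    (a b : (Fin d → ℤ) → ℂ) : poly θ s (a + b) = poly θ s a + poly θ s b := by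
  simp [poly, add_smul, Finset.sum_add_distrib]

theorem poly_smul (θ : Matrix (Fin d) (Fin d) ℝ) (s : Finset (Fin d → ℤ)) (c : ℂ)
    (a : (Fin d → ℤ) → ℂ) : poly θ s (c • a) = c • poly θ s a := by
  simp [poly, Finset.smul_sum, smul_smul]

/-- The function `c` is a Fourier multiplier with norm at most `K` on the polynomials of all quantum
tori of dimension `d`, for all `L_p`-norms. -/
def IsMultiplier (c : (Fin d → ℤ) → ℂ) (K : ℝ) : Prop :=
  0 ≤ K ∧ ∀ (θ : Matrix (Fin d) (Fin d) ℝ) (p : ℝ≥0∞), 1 ≤ p →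
    ∀ (s : Finset (Fin d → ℤ)) (a : (Fin d → ℤ) → ℂ),
      torusLpNorm p (poly θ s (c * a)) ≤ K * torusLpNorm p (poly θ s a)

namespace IsMultiplier

variable {c c' : (Fin d → ℤ) → ℂ} {K K' : ℝ}

theorem mono (h : IsMultiplier c K) (hK : K ≤ K') : IsMultiplier c K' :=
  ⟨h.1.trans hK, fun θ p hp s a => (h.2 θ p hp s a).trans
    (mul_le_mul_of_nonneg_right hK (torusLpNorm_nonneg _ _))⟩

theorem norm_le (h : IsMultiplier c K) (m : Fin d → ℤ) : ‖c m‖ ≤ K := by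
  have := h.2 0 1 le_rfl {m} 1
  simpa [poly, torusLpNorm_smul, torusLpNorm_monomial] using this

theorem const (z : ℂ) : IsMultiplier (fun _ : Fin d → ℤ => z) ‖z‖ := by
  refine ⟨norm_nonneg _, fun θ p hp s a => ?_⟩
  have : (fun _ : Fin d → ℤ => z) * a = z • a := by ext; simp
  rw [this, poly_smul, torusLpNorm_smul hp]

theorem one : IsMultiplier (1 : (Fin d → ℤ) → ℂ) 1 := by
  have h := const (d := d) 1
  rwa [norm_one] at h

theorem add (h : IsMultiplier c K) (h' : IsMultiplier c' K') : IsMultiplier (c + c') (K + K') := by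
  refine ⟨add_nonneg h.1 h'.1, fun θ p hp s a => ?_⟩
  rw [add_mul, add_mul, poly_add]
  exact (torusLpNorm_add_le hp (poly_mem θ s _) (poly_mem θ s _)).trans
    (add_le_add (h.2 θ p hp s a) (h'.2 θ p hp s a))

theorem mul (h : IsMultiplier c K) (h' : IsMultiplier c' K') : IsMultiplier (c * c') (K * K') := by
  refine ⟨mul_nonneg h.1 h'.1, fun θ p hp s a => ?_⟩
  rw [mul_assoc, mul_assoc]
  exact (h.2 θ p hp s _).trans (mul_le_mul_of_nonneg_left (h'.2 θ p hp s a) h.1)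

theorem const_mul (z : ℂ) (h : IsMultiplier c K) : IsMultiplier (fun m => z * c m) (‖z‖ * K) :=
  (const z).mul h

theorem pow (h : IsMultiplier c K) (n : ℕ) : IsMultiplier (c ^ n) (K ^ n) := by
  induction n with
  | zero => simpa using one
  | succ n ih => simpa only [pow_succ] using ih.mul h

theorem sum {ι : Type*} (t : Finset ι) {f : ι → (Fin d → ℤ) → ℂ} {B : ι → ℝ}
    (h : ∀ i ∈ t, IsMultiplier (f i) (B i)) : IsMultiplier (∑ i ∈ t, f i) (∑ i ∈ t, B i) := by
  classical
  induction t using Finset.induction_on with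
  | empty =>
    have h := const (d := d) 0
    rwa [norm_zero] at h
  | insert i t hi ih =>
    rw [Finset.sum_insert hi, Finset.sum_insert hi]
    exact (h i (Finset.mem_insert_self i t)).add
      (ih fun j hj => h j (Finset.mem_insert_of_mem hj))

/-- On a fixed finite set of frequencies pointwise convergence of symbols is convergence in operator
norm, which dominates every `L_p`-norm. Thus power series of multipliers are multipliers, which
yields `exp` and the Neumann series `one_sub_inv`. -/
theorem of_tendsto {f : ℕ → (Fin d → ℤ) → ℂ} (h : ∀ n, IsMultiplier (f n) K)
    (hlim : ∀ m, Filter.Tendsto (fun n => f n m) Filter.atTop (nhds (c m))) : IsMultiplier c K := by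
  refine ⟨(h 0).1, fun θ p hp s a => ?_⟩
  have h1 : Filter.Tendsto (fun n => poly θ s (f n * a)) Filter.atTop
      (nhds (poly θ s (c * a))) := by
    unfold poly
    refine tendsto_finsetSum _ fun m _ => ?_
    exact ((hlim m).mul_const (a m)).smul_const _
  have h2 : Filter.Tendsto (fun n => K * torusLpNorm p (poly θ s a) +
      ‖poly θ s (c * a) - poly θ s (f n * a)‖) Filter.atTop
      (nhds (K * torusLpNorm p (poly θ s a) + 0)) := by
    refine tendsto_const_nhds.add ?_
    have := (tendsto_const_nhds (x := poly θ s (c * a)) (f := Filter.atTop)).sub h1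
    simpa using this.norm
  rw [add_zero] at h2
  refine ge_of_tendsto' h2 fun n => ?_
  calc torusLpNorm p (poly θ s (c * a))
      = torusLpNorm p (poly θ s (f n * a) + (poly θ s (c * a) - poly θ s (f n * a))) := by
        rw [add_sub_cancel]
    _ ≤ _ := torusLpNorm_add_le hp (poly_mem θ s _) (sub_mem (poly_mem θ s _) (poly_mem θ s _))
    _ ≤ _ := add_le_add ((h n).2 θ p hp s a) (torusLpNorm_le_norm hp _)

theorem exp (h : IsMultiplier c K) : IsMultiplier (fun m => Complex.exp (c m)) (Real.exp K) := by
  refine of_tendsto (f := fun n => ∑ i ∈ Finset.range n, fun m => ((i.factorial : ℂ)⁻¹) * (c ^ i) m)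
    (fun n => ?_) fun m => ?_
  · refine (sum (Finset.range n) fun i _ => (h.pow i).const_mul ((i.factorial : ℂ)⁻¹)).mono ?_
    refine le_trans (Finset.sum_le_sum fun i _ => ?_) (Real.sum_le_exp_of_nonneg h.1 n)
    rw [norm_inv, Complex.norm_natCast]
    exact le_of_eq (by ring)
  · have := (NormedSpace.exp_series_hasSum_exp' (𝕂 := ℂ) (c m)).tendsto_sum_nat
    rw [← Complex.exp_eq_exp_ℂ] at this
    refine this.congr fun n => ?_
    simp [Finset.sum_apply]

theorem one_sub_inv (h : IsMultiplier c K) (hK : K < 1) :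
    IsMultiplier (fun m => (1 - c m)⁻¹) (1 - K)⁻¹ := by
  refine of_tendsto (f := fun n => ∑ i ∈ Finset.range n, c ^ i) (fun n => ?_) fun m => ?_
  · refine (sum (Finset.range n) fun i _ => h.pow i).mono ?_
    rw [← tsum_geometric_of_lt_one h.1 hK]
    exact (summable_geometric_of_lt_one h.1 hK).sum_le_tsum _ fun i _ => pow_nonneg h.1 i
  · have := (hasSum_geometric_of_norm_lt_one ((h.norm_le m).trans_lt hK)).tendsto_sum_nat
    refine this.congr fun n => ?_
    simp [Finset.sum_apply]

end IsMultiplier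

/-- The character `m ↦ e^{i w·m}`. -/
def character (w : Fin d → ℝ) (m : Fin d → ℤ) : Circle := Circle.exp (∑ j, w j * m j)

theorem conj_monomial (θ : Matrix (Fin d) (Fin d) ℝ) (w : Fin d → ℝ) (m : Fin d → ℤ) :
    ((shift (character w) 0).toContinuousLinearEquiv : Op d) * monomial θ m *
      star ((shift (character w) 0).toContinuousLinearEquiv : Op d) =
        (character w m : ℂ) • monomial θ m := by
  have h : star ((shift (character w) 0).toContinuousLinearEquiv : Op d) =
      ((shift (character w) 0).symm.toContinuousLinearEquiv : Op d) :=
    LinearIsometryEquiv.adjoint_eq_symm _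
  rw [h]
  apply op_ext
  intro n
  have h1 : (shift (character w) 0).symm (basisVec n) = (character w n : ℂ)⁻¹ • basisVec n := by
    rw [LinearIsometryEquiv.symm_apply_eq, map_smul, shift_basisVec, smul_smul,
      inv_mul_cancel₀ (Circle.coe_ne_zero _), one_smul, add_zero]
  change (shift (character w) 0) (monomial θ m ((shift (character w) 0).symm (basisVec n))) = _
  rw [h1, map_smul, monomial_basisVec, map_smul, map_smul, shift_basisVec, smul_apply,
    monomial_basisVec, smul_smul, smul_smul, smul_smul, add_zero]
  congr 1
  have h2 : (character w (n + m) : ℂ) = character w n * character w m := by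
    rw [← Circle.coe_mul]
    congr 1
    rw [character, character, character, ← Circle.exp_add]
    congr 1
    simp only [Pi.add_apply, Int.cast_add, mul_add, Finset.sum_add_distrib]
  rw [h2]
  have := Circle.coe_ne_zero (character w n)
  field_simp

/-- The diagonal unitary `e_n ↦ e^{i w·n} e_n` implements multiplication by the character, by
`conj_monomial`, and fixes `e_0`. -/
theorem torusLpNorm_character_mul (θ : Matrix (Fin d) (Fin d) ℝ) (p : ℝ≥0∞) (w : Fin d → ℝ)
    (s : Finset (Fin d → ℤ)) (a : (Fin d → ℤ) → ℂ) :
    torusLpNorm p (poly θ s fun m => character w m * a m) = torusLpNorm p (poly θ s a) := by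
  set V : Op d := ((shift (character w) 0).toContinuousLinearEquiv : Op d) with hV
  have hs : star V = ((shift (character w) 0).symm.toContinuousLinearEquiv : Op d) :=
    LinearIsometryEquiv.adjoint_eq_symm _
  have hmem : V ∈ unitary (Op d) := by
    rw [Unitary.mem_iff, hs, hV]
    constructor <;> ext1 x
    · exact (shift (character w) 0).symm_apply_apply x
    · exact (shift (character w) 0).apply_symm_apply x
  have h0 : star V (basisVec 0) = basisVec 0 := by
    rw [hs]
    change (shift (character w) 0).symm (basisVec 0) = _
    rw [LinearIsometryEquiv.symm_apply_eq, shift_basisVec]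
    simp [character]
  have h := vectorLpNorm_unitary_conj (p := p) (⟨V, hmem⟩ : unitary (Op d)) h0 (poly θ s a)
  rw [torusLpNorm, torusLpNorm, ← h]
  congr 1
  change _ = V * poly θ s a * star V
  simp only [poly, Finset.mul_sum, Finset.sum_mul]
  refine Finset.sum_congr rfl fun m _ => ?_
  rw [mul_smul_comm, smul_mul_assoc, conj_monomial, smul_smul, mul_comm]

/-- Averages of characters are multipliers. -/
theorem IsMultiplier.integral {Ω : Type*} [MeasurableSpace Ω] {μ : Measure Ω} {g : Ω → ℂ}
    (hg : Integrable g μ) {w : Ω → Fin d → ℝ} (hw : Measurable w) :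
    IsMultiplier (fun m => ∫ y, g y * character (w y) m ∂μ) (∫ y, ‖g y‖ ∂μ) := by
  classical
  refine ⟨integral_nonneg fun _ => norm_nonneg _, fun θ p hp s a => ?_⟩
  -- Only a seminorm on coefficient families is used. A norming functional reduces the estimate to
  -- scalar integrals, so no operator-valued integral and no measurability of the norm are involved.
  let N : ((Fin d → ℤ) → ℂ) → ℝ := fun a => torusLpNorm p (poly θ s a)
  have hsmul : ∀ (z : ℂ) a, N (z • a) = ‖z‖ * N a := fun z a => by
    simp only [N, poly_smul, torusLpNorm_smul hp]
  have hadd : ∀ a b, N (a + b) ≤ N a + N b := fun a b => by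
    simp only [N, poly_add]
    exact torusLpNorm_add_le hp (poly_mem θ s _) (poly_mem θ s _)
  have hrsmul : ∀ (r : ℝ) a, N (r • a) = |r| * N a := fun r a => by
    rw [← Complex.coe_smul, hsmul, Complex.norm_real, Real.norm_eq_abs]
  have hN0 : ∀ a, 0 ≤ N a := fun a => torusLpNorm_nonneg _ _
  set v : (Fin d → ℤ) → ℂ := (fun m => ∫ y, g y * character (w y) m ∂μ) * a with hv
  -- Truncation to `s` leaves `N` unchanged and turns the functional into a finite sum of
  -- functionals on `ℂ`, each of which is automatically continuous and commutes with the integral.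
  let res : ((Fin d → ℤ) → ℂ) → ((Fin d → ℤ) → ℂ) := fun b => ∑ m ∈ s, Pi.single m (b m)
  have hres : ∀ b, N (res b) = N b := by
    intro b
    simp only [N]
    congr 1
    refine Finset.sum_congr rfl fun m hm => ?_
    congr 1
    simp [res, Finset.sum_apply, Pi.single_apply, hm]
  -- Hahn-Banach for the sublinear function `N` on the line through `res v`. If `res v = 0` there is
  -- no line to start from, and the zero functional serves.
  obtain ⟨l, hl1, hl2⟩ : ∃ l : ((Fin d → ℤ) → ℂ) →ₗ[ℝ] ℝ, l (res v) = N (res v) ∧ ∀ b, l b ≤ N b := by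
    by_cases h0 : res v = 0
    · refine ⟨0, ?_, fun b => hN0 b⟩
      have := hrsmul 0 (res v)
      rw [zero_smul, abs_zero, zero_mul] at this
      rw [h0, this]
      rfl
    · obtain ⟨l, h1, h2⟩ := exists_extension_of_le_sublinear
        (LinearPMap.mkSpanSingleton (K := ℝ) (res v) (N (res v)) h0) N
        (fun r hr b => by rw [hrsmul, abs_of_pos hr]) hadd (by
          rintro ⟨x, hx⟩
          obtain ⟨r, rfl⟩ := Submodule.mem_span_singleton.1 hx
          refine (LinearPMap.mkSpanSingleton'_apply _ _ _ r hx).trans_le ?_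
          change r * N (res v) ≤ N (r • res v)
          rw [hrsmul]
          exact mul_le_mul_of_nonneg_right (le_abs_self r) (hN0 _))
      refine ⟨l, ?_, h2⟩
      exact (h1 ⟨res v, Submodule.mem_span_singleton_self _⟩).trans
        (LinearPMap.mkSpanSingleton_apply ℝ ℝ h0 (N (res v)))
  let L : (Fin d → ℤ) → (ℂ →L[ℝ] ℝ) := fun m =>
    LinearMap.toContinuousLinearMap (l.comp (LinearMap.single ℝ (fun _ => ℂ) m))
  have hL : ∀ b, l (res b) = ∑ m ∈ s, L m (b m) := by
    intro b
    simp [res, L, map_sum]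
  have hchar : ∀ m, Measurable fun y => (character (w y) m : ℂ) := by
    intro m
    unfold character
    have h1 : Measurable fun y => ∑ j, w y j * (m j : ℝ) := by
      refine Finset.measurable_sum _ fun j _ => ?_
      exact ((measurable_pi_apply j).comp hw).mul_const _
    have h2 : Continuous fun t : ℝ => (Circle.exp t : ℂ) := by fun_prop
    exact h2.measurable.comp h1
  have hint : ∀ m, Integrable (fun y => g y * character (w y) m * a m) μ := by
    intro m
    refine Integrable.mul_const ?_ _
    refine hg.mul_bdd (c := 1) (hchar m).aestronglyMeasurable (Filter.Eventually.of_forall fun y => ?_)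
    rw [Circle.norm_coe]
  have e1 : N v = ∫ y, ∑ m ∈ s, L m (g y * character (w y) m * a m) ∂μ := by
    rw [← hres, ← hl1, hL, integral_finsetSum _ fun m _ => (L m).integrable_comp (hint m)]
    refine Finset.sum_congr rfl fun m _ => ?_
    rw [(L m).integral_comp_comm (hint m), integral_mul_const]
    rfl
  change N v ≤ _
  rw [e1, ← integral_mul_const]
  refine integral_mono (integrable_finsetSum _ fun m _ => (L m).integrable_comp (hint m))
    (hg.norm.mul_const _) fun y => ?_
  change ∑ m ∈ s, L m (g y * character (w y) m * a m) ≤ ‖g y‖ * N a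
  rw [← hL fun m => g y * character (w y) m * a m]
  refine (hl2 _).trans ?_
  rw [hres]
  have e2 : (fun m => g y * (character (w y) m : ℂ) * a m) =
      g y • fun m => (character (w y) m : ℂ) * a m := by
    ext m
    simp [mul_assoc]
  rw [e2, hsmul]
  exact le_of_eq (congrArg _ (torusLpNorm_character_mul θ p (w y) s a))

/-! ### Absolutely convergent series -/

theorem norm_monomial (θ : Matrix (Fin d) (Fin d) ℝ) (m : Fin d → ℤ) : ‖monomial θ m‖ = 1 := by
  rw [← vectorLpNorm_top (basisVec (0 : Fin d → ℤ))]
  exact torusLpNorm_monomial θ ∞ m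

theorem hasSum_series (θ : Matrix (Fin d) (Fin d) ℝ) {a : (Fin d → ℤ) → ℂ}
    (ha : Summable fun m => ‖a m‖) : HasSum (fun m => a m • monomial θ m) (series θ a) := by
  refine Summable.hasSum (Summable.of_norm ?_)
  simpa [norm_smul, norm_monomial] using ha

theorem series_mem (θ : Matrix (Fin d) (Fin d) ℝ) (a : (Fin d → ℤ) → ℂ) :
    series θ a ∈ torusAlgebra θ := by
  by_cases h : Summable fun m => a m • monomial θ m
  · exact (isClosed_torusAlgebra θ).mem_of_tendsto h.hasSum
      (Filter.Eventually.of_forall fun s => poly_mem θ s a)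
  · rw [series, tsum_eq_zero_of_not_summable h]
    exact zero_mem _

/-- On the `C⋆`-algebra of the torus the `L_p`-norm is 1-Lipschitz for the operator norm, by
Minkowski and `torusLpNorm_le_norm`. -/
theorem tendsto_torusLpNorm {θ : Matrix (Fin d) (Fin d) ℝ} {p : ℝ≥0∞} (hp : 1 ≤ p) {ι : Type*}
    {f : Filter ι} {x : ι → Op d} {y : Op d} (hx : ∀ i, x i ∈ torusAlgebra θ)
    (hy : y ∈ torusAlgebra θ) (h : Filter.Tendsto x f (nhds y)) :
    Filter.Tendsto (fun i => torusLpNorm p (x i)) f (nhds (torusLpNorm p y)) := by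
  rw [tendsto_iff_norm_sub_tendsto_zero] at h ⊢
  refine squeeze_zero (fun _ => norm_nonneg _) (fun i => ?_) h
  rw [Real.norm_eq_abs, abs_le]
  constructor
  · have h1 : torusLpNorm p y ≤ torusLpNorm p (x i) + torusLpNorm p ((-1 : ℂ) • (x i - y)) := by
      have := torusLpNorm_add_le hp (hx i)
        ((torusAlgebra θ).smul_mem (sub_mem (hx i) hy) (-1 : ℂ))
      rwa [show x i + (-1 : ℂ) • (x i - y) = y by rw [neg_one_smul]; abel] at this
    rw [torusLpNorm_smul hp] at h1
    have := torusLpNorm_le_norm hp (x i - y)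
    simp at h1
    linarith
  · have h1 := torusLpNorm_add_le hp hy (sub_mem (hx i) hy)
    rw [add_sub_cancel] at h1
    have := torusLpNorm_le_norm hp (x i - y)
    linarith

theorem IsMultiplier.series {c : (Fin d → ℤ) → ℂ} {K : ℝ} (h : IsMultiplier c K)
    (θ : Matrix (Fin d) (Fin d) ℝ) {p : ℝ≥0∞} (hp : 1 ≤ p) {a : (Fin d → ℤ) → ℂ}
    (ha : Summable fun m => ‖a m‖) :
    torusLpNorm p (series θ (c * a)) ≤ K * torusLpNorm p (series θ a) := by
  have hca : Summable fun m => ‖(c * a) m‖ := by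
    refine Summable.of_nonneg_of_le (fun _ => norm_nonneg _) (fun m => ?_) (ha.mul_left K)
    rw [Pi.mul_apply, norm_mul]
    exact mul_le_mul_of_nonneg_right (h.norm_le m) (norm_nonneg _)
  have h1 := tendsto_torusLpNorm hp (fun s => poly_mem θ s (c * a)) (series_mem θ _)
    (hasSum_series θ hca)
  have h2 := tendsto_torusLpNorm hp (fun s => poly_mem θ s a) (series_mem θ _)
    (hasSum_series θ ha)
  exact le_of_tendsto_of_tendsto' h1 (h2.const_mul K) fun s => h.2 θ p hp s a

end QTorus

namespace QTorus

/-! ### Multipliers from Schwartz functions -/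

open scoped SchwartzMap FourierTransform ContDiff

variable {d : ℕ}

/-- Fourier inversion writes `f(l m)` as the average of the characters `e^{2πi l v·m}` with density
`𝓕 f(v)`. The dilation enters only the characters, so the bound is the same for all `l`. -/
theorem isMultiplier_integral_norm_fourier (f : 𝓢(EuclideanSpace ℝ (Fin d), ℂ)) (l : ℝ) :
    IsMultiplier (fun m : Fin d → ℤ => f (l • latticePoint m)) (∫ ξ, ‖𝓕 f ξ‖) := by
  have hw : Measurable fun (v : EuclideanSpace ℝ (Fin d)) (j : Fin d) => 2 * Real.pi * l * v j := by
    refine measurable_pi_lambda _ fun j => ?_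
    have : Continuous fun v : EuclideanSpace ℝ (Fin d) => 2 * Real.pi * l * v j := by fun_prop
    exact this.measurable
  have h := IsMultiplier.integral (𝓕 f).integrable hw (μ := volume)
  convert h using 1
  funext m
  have h1 : 𝓕⁻ (𝓕 f) = f := FourierTransform.fourierInv_fourier_eq f
  conv_lhs => rw [← h1]
  rw [SchwartzMap.fourierInv_coe, Real.fourierInv_eq']
  refine integral_congr_ae (Filter.Eventually.of_forall fun v => ?_)
  change _ • (𝓕 f) v = _
  rw [smul_eq_mul, mul_comm]
  congr 1
  rw [character, Circle.coe_exp]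
  congr 3
  rw [inner_smul_right, PiLp.inner_apply, Finset.mul_sum, Finset.mul_sum]
  refine Finset.sum_congr rfl fun j _ => ?_
  simp [latticePoint]
  ring

/-- Dilates of a Schwartz function are multipliers, with a norm that is bounded by a continuous
seminorm of the function. -/
theorem exists_seminorm_isMultiplier (d : ℕ) : ∃ (t : Finset (ℕ × ℕ)) (C : ℝ), 0 ≤ C ∧
    ∀ (f : 𝓢(EuclideanSpace ℝ (Fin d), ℂ)) (l : ℝ),
      IsMultiplier (fun m : Fin d → ℤ => f (l • latticePoint m))
        (C * (t.sup (schwartzSeminormFamily ℝ (EuclideanSpace ℝ (Fin d)) ℂ)) f) := by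
  -- The map `f ↦ 𝓕 f ∈ L_1` is continuous on the Schwartz space, so its norm is bounded by finitely
  -- many Schwartz seminorms of `f`.
  let T : 𝓢(EuclideanSpace ℝ (Fin d), ℂ) →L[ℝ] Lp ℂ 1 (volume : Measure (EuclideanSpace ℝ (Fin d))) :=
    (SchwartzMap.toLpCLM ℝ ℂ 1 volume).comp (SchwartzMap.fourierTransformCLM ℝ)
  obtain ⟨t, C, -, hC⟩ := Seminorm.bound_of_continuous
    (schwartz_withSeminorms ℝ (EuclideanSpace ℝ (Fin d)) ℂ)
    ((normSeminorm ℝ (Lp ℂ 1 (volume : Measure (EuclideanSpace ℝ (Fin d))))).comp T.toLinearMap)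
    (T.continuous.norm)
  refine ⟨t, C, C.2, fun f l => (isMultiplier_integral_norm_fourier f l).mono ?_⟩
  have h := hC f
  have h1 : ‖(𝓕 f).toLp 1 (volume : Measure (EuclideanSpace ℝ (Fin d)))‖ = ∫ ξ, ‖𝓕 f ξ‖ :=
    SchwartzMap.norm_toLp_one
  rw [← h1]
  exact h

theorem exists_isMultiplier_of_contDiff {f : EuclideanSpace ℝ (Fin d) → ℝ}
    (hf : ContDiff ℝ ∞ f) (hc : HasCompactSupport f) :
    ∃ K, ∀ l : ℝ, IsMultiplier (fun m : Fin d → ℤ => (f (l • latticePoint m) : ℂ)) K := by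
  have h1 : ContDiff ℝ ∞ fun ξ => (f ξ : ℂ) := Complex.ofRealCLM.contDiff.comp hf
  have h2 : HasCompactSupport fun ξ => (f ξ : ℂ) := hc.comp_left (g := Complex.ofReal) rfl
  exact ⟨_, fun l => isMultiplier_integral_norm_fourier (h2.toSchwartzMap h1) l⟩

theorem exists_norm_iteratedFDeriv_le {f : EuclideanSpace ℝ (Fin d) → ℝ}
    (hf : ContDiff ℝ ∞ f) (hc : HasCompactSupport f) (n : ℕ) :
    ∃ A, 1 ≤ A ∧ ∀ i ≤ n, ∀ x, ‖iteratedFDeriv ℝ i f x‖ ≤ A := by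
  let F := hc.toSchwartzMap hf
  refine ⟨1 + ∑ i ∈ Finset.range (n + 1), SchwartzMap.seminorm ℝ 0 i F, ?_, fun i hi x => ?_⟩
  · have : 0 ≤ ∑ i ∈ Finset.range (n + 1), SchwartzMap.seminorm ℝ 0 i F :=
      Finset.sum_nonneg fun i _ => apply_nonneg _ _
    linarith
  · have h1 := SchwartzMap.le_seminorm ℝ 0 i F x
    have h2 : SchwartzMap.seminorm ℝ 0 i F ≤ ∑ i ∈ Finset.range (n + 1), SchwartzMap.seminorm ℝ 0 i F :=
      Finset.single_le_sum (f := fun i => SchwartzMap.seminorm ℝ 0 i F)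
        (fun i _ => apply_nonneg _ _) (Finset.mem_range.2 (by lia))
    rw [pow_zero, one_mul] at h1
    change ‖iteratedFDeriv ℝ i f x‖ ≤ _ at h1
    linarith

theorem one_add_pow_mul_exp_le (n : ℕ) {c : ℝ} (hc : 0 < c) :
    ∃ C, 0 ≤ C ∧ ∀ t, 0 ≤ t → (1 + t) ^ n * Real.exp (-(c * t)) ≤ C * Real.exp (-(c / 2 * t)) := by
  refine ⟨n.factorial * ((c / 2) ^ n)⁻¹ * Real.exp (c / 2), by positivity, fun t ht => ?_⟩
  have h1 := Real.pow_div_factorial_le_exp (c / 2 * (1 + t)) (by positivity) n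
  rw [div_le_iff₀ (by positivity), mul_pow] at h1
  have h2 : (1 + t) ^ n ≤ n.factorial * ((c / 2) ^ n)⁻¹ * Real.exp (c / 2 * (1 + t)) := by
    rw [mul_comm (n.factorial : ℝ), mul_assoc, ← div_eq_inv_mul, le_div_iff₀ (by positivity)]
    linarith
  calc (1 + t) ^ n * Real.exp (-(c * t))
      ≤ n.factorial * ((c / 2) ^ n)⁻¹ * Real.exp (c / 2 * (1 + t)) * Real.exp (-(c * t)) :=
        mul_le_mul_of_nonneg_right h2 (Real.exp_pos _).le
    _ = _ := by
      rw [mul_assoc, mul_assoc _ (Real.exp (c / 2)), ← Real.exp_add, ← Real.exp_add]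
      congr 2
      ring

/-- Differentiating `e^{-tη}` up to `n` times produces powers of `t` of degree at most `n` and
bounded derivatives of `η`. Where `χ` lives, the remaining exponential is at most `e^{-ct}`.
Leibniz' rule then adds the bounded derivatives of `χ`. -/
theorem iteratedFDeriv_cutoff_exp_le {χ η : EuclideanSpace ℝ (Fin d) → ℝ} (hχ : ContDiff ℝ ∞ χ)
    (hχc : HasCompactSupport χ) (hη : ContDiff ℝ ∞ η) (hηc : HasCompactSupport η) {c : ℝ}
    (hηχ : ∀ ξ ∈ tsupport χ, c ≤ η ξ) (k n : ℕ) :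
    ∃ C, 0 ≤ C ∧ ∀ t, 0 ≤ t → ∀ x,
      ‖x‖ ^ k * ‖iteratedFDeriv ℝ n (fun ξ => χ ξ * Real.exp (-t * η ξ)) x‖ ≤
        C * ((1 + t) ^ n * Real.exp (-(c * t))) := by
  obtain ⟨A, hA1, hA⟩ := exists_norm_iteratedFDeriv_le hχ hχc n
  obtain ⟨D, hD1, hD⟩ := exists_norm_iteratedFDeriv_le hη hηc n
  obtain ⟨R, hR⟩ := hχc.isBounded.exists_norm_le
  have hR' : ∀ x ∈ tsupport χ, ‖x‖ ^ k ≤ (max R 0) ^ k := fun x hx =>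
    pow_le_pow_left₀ (norm_nonneg _) ((hR x hx).trans (le_max_left _ _)) k
  have hexp : ∀ t, 0 ≤ t → ∀ x ∈ tsupport χ, ∀ i ≤ n,
      ‖iteratedFDeriv ℝ i (fun ξ => Real.exp (-t * η ξ)) x‖ ≤
        n.factorial * ((1 + t) ^ n * Real.exp (-(c * t))) * D ^ n := by
    intro t ht x hx i hi
    have hb := norm_iteratedFDeriv_comp_le (𝕜 := ℝ) (g := fun u : ℝ => Real.exp (-t * u)) (f := η)
      (n := i) (N := ∞) (by fun_prop) hη (by exact_mod_cast le_top) x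
      (C := (1 + t) ^ n * Real.exp (-(c * t))) (D := D) (fun j hj => ?_) (fun j hj1 hj => ?_)
    · refine hb.trans ?_
      have h1 : (i.factorial : ℝ) ≤ n.factorial := by exact_mod_cast Nat.factorial_le hi
      have h2 : D ^ i ≤ D ^ n := pow_le_pow_right₀ hD1 hi
      gcongr
    · rw [norm_iteratedFDeriv_eq_norm_iteratedDeriv, iteratedDeriv_exp_const_mul, norm_mul, norm_pow,
        Real.norm_eq_abs, Real.norm_eq_abs, abs_neg, abs_of_nonneg ht, Real.abs_exp]
      have h1 : t ^ j ≤ (1 + t) ^ n :=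
        (pow_le_pow_left₀ ht (by linarith) j).trans (pow_le_pow_right₀ (by linarith) (hj.trans hi))
      have h2 : Real.exp (-t * η x) ≤ Real.exp (-(c * t)) := by
        rw [Real.exp_le_exp]
        nlinarith [hηχ x hx]
      exact mul_le_mul h1 h2 (Real.exp_pos _).le (by positivity)
    · refine (hD j (hj.trans hi) x).trans ?_
      exact le_self_pow₀ hD1 (by lia)
  have hC0 : 0 ≤ (max R 0) ^ k * ((∑ i ∈ Finset.range (n + 1), (n.choose i : ℝ)) * (A * (n.factorial * D ^ n))) := by
    have h1 : 0 ≤ max R 0 := le_max_right _ _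
    positivity
  refine ⟨_, hC0, fun t ht x => ?_⟩
  by_cases hx : x ∈ tsupport χ
  · have hm := norm_iteratedFDeriv_mul_le (𝕜 := ℝ) (N := ∞) (n := n) hχ
      (g := fun ξ => Real.exp (-t * η ξ)) (by fun_prop) x (by exact_mod_cast le_top)
    rw [mul_assoc]
    refine mul_le_mul (hR' x hx) (hm.trans ?_) (norm_nonneg _) (by
      have h1 : 0 ≤ max R 0 := le_max_right _ _
      positivity)
    rw [Finset.sum_mul, Finset.sum_mul]
    refine Finset.sum_le_sum fun i hi => ?_
    have hi' : i ≤ n := by have := Finset.mem_range.1 hi; lia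
    have h1 := hA i hi' x
    have h2 := hexp t ht x hx (n - i) (Nat.sub_le _ _)
    calc _ ≤ (n.choose i : ℝ) * A * (n.factorial * ((1 + t) ^ n * Real.exp (-(c * t))) * D ^ n) := by
          gcongr
      _ = _ := by ring
  · have h0 : iteratedFDeriv ℝ n (fun ξ => χ ξ * Real.exp (-t * η ξ)) x = 0 := by
      by_contra h
      have h1 := support_iteratedFDeriv_subset (𝕜 := ℝ) n (Function.mem_support.2 h)
      exact hx (tsupport_mul_subset_left h1)
    rw [h0, norm_zero, mul_zero]
    positivity

/-- Exponential decay of the multiplier norm of a localized semigroup. -/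
theorem exists_isMultiplier_cutoff_exp {χ η : EuclideanSpace ℝ (Fin d) → ℝ} (hχ : ContDiff ℝ ∞ χ)
    (hχc : HasCompactSupport χ) (hη : ContDiff ℝ ∞ η) (hηc : HasCompactSupport η) {c : ℝ}
    (hc : 0 < c) (hηχ : ∀ ξ ∈ tsupport χ, c ≤ η ξ) :
    ∃ C, 0 ≤ C ∧ ∀ t, 0 ≤ t → ∀ l : ℝ, IsMultiplier (fun m : Fin d → ℤ =>
      ((χ (l • latticePoint m) * Real.exp (-t * η (l • latticePoint m)) : ℝ) : ℂ))
        (C * Real.exp (-(c / 2 * t))) := by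
  obtain ⟨T, B, hB0, hB⟩ := exists_seminorm_isMultiplier d
  have hsem : ∀ i : ℕ × ℕ, ∃ C, 0 ≤ C ∧ ∀ t, 0 ≤ t → ∀ x,
      ‖x‖ ^ i.1 * ‖iteratedFDeriv ℝ i.2 (fun ξ => χ ξ * Real.exp (-t * η ξ)) x‖ ≤
        C * Real.exp (-(c / 2 * t)) := by
    intro i
    obtain ⟨C1, hC1, h1⟩ := iteratedFDeriv_cutoff_exp_le hχ hχc hη hηc hηχ i.1 i.2
    -- Half of the decay rate `c` pays for the polynomial factor created by the derivatives.
    obtain ⟨C2, hC2, h2⟩ := one_add_pow_mul_exp_le i.2 hc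
    refine ⟨C1 * C2, by positivity, fun t ht x => (h1 t ht x).trans ?_⟩
    rw [mul_assoc]
    exact mul_le_mul_of_nonneg_left (h2 t ht) hC1
  choose C hC0 hC using hsem
  refine ⟨B * ∑ i ∈ T, C i, mul_nonneg hB0 (Finset.sum_nonneg fun i _ => hC0 i), fun t ht l => ?_⟩
  have h1 : ContDiff ℝ ∞ fun ξ => χ ξ * Real.exp (-t * η ξ) := by fun_prop
  have h2 : ContDiff ℝ ∞ fun ξ => ((χ ξ * Real.exp (-t * η ξ) : ℝ) : ℂ) :=
    Complex.ofRealCLM.contDiff.comp h1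
  have h3 : HasCompactSupport fun ξ => ((χ ξ * Real.exp (-t * η ξ) : ℝ) : ℂ) :=
    (hχc.mul_right (f' := fun ξ => Real.exp (-t * η ξ))).comp_left (g := Complex.ofReal) rfl
  refine (hB (h3.toSchwartzMap h2) l).mono ?_
  rw [mul_assoc]
  refine mul_le_mul_of_nonneg_left ?_ hB0
  refine Seminorm.finset_sup_apply_le (mul_nonneg (Finset.sum_nonneg fun i _ => hC0 i)
    (Real.exp_pos _).le) fun i hi => ?_
  refine SchwartzMap.seminorm_le_bound ℝ i.1 i.2 _ (mul_nonneg (Finset.sum_nonneg fun i _ => hC0 i)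
    (Real.exp_pos _).le) fun x => ?_
  have h4 : ‖iteratedFDeriv ℝ i.2 (fun ξ => ((χ ξ * Real.exp (-t * η ξ) : ℝ) : ℂ)) x‖ =
      ‖iteratedFDeriv ℝ i.2 (fun ξ => χ ξ * Real.exp (-t * η ξ)) x‖ :=
    Complex.ofRealLI.norm_iteratedFDeriv_comp_left (f := fun ξ => χ ξ * Real.exp (-t * η ξ))
      h1.contDiffAt (by exact_mod_cast le_top)
  change ‖x‖ ^ i.1 * ‖iteratedFDeriv ℝ i.2 (fun ξ => ((χ ξ * Real.exp (-t * η ξ) : ℝ) : ℂ)) x‖ ≤ _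
  rw [h4]
  refine (hC i t ht x).trans (mul_le_mul_of_nonneg_right ?_ (Real.exp_pos _).le)
  exact Finset.single_le_sum (f := C) (fun j _ => hC0 j) hi

/-! ### Cutoff functions and radial symbols -/

theorem exists_annulus_cutoff (d : ℕ) {R : ℝ} (hR : 1 ≤ R) : ∃ χ : EuclideanSpace ℝ (Fin d) → ℝ,
    ContDiff ℝ ∞ χ ∧ (∀ ξ, R⁻¹ ≤ ‖ξ‖ → ‖ξ‖ ≤ R → χ ξ = 1) ∧
      tsupport χ ⊆ {ξ | (2 * R)⁻¹ ≤ ‖ξ‖ ∧ ‖ξ‖ ≤ 2 * R} := by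
  have hR0 : 0 < R := by linarith
  let b1 : ContDiffBump (0 : EuclideanSpace ℝ (Fin d)) := ⟨R, 2 * R, hR0, by linarith⟩
  let b0 : ContDiffBump (0 : EuclideanSpace ℝ (Fin d)) :=
    ⟨(2 * R)⁻¹, R⁻¹, by positivity, by rw [inv_lt_inv₀ (by positivity) hR0]; linarith⟩
  refine ⟨fun ξ => b1 ξ * (1 - b0 ξ), b1.contDiff.mul (contDiff_const.sub b0.contDiff),
    fun ξ h1 h2 => ?_, closure_minimal (fun ξ hξ => ?_) ?_⟩
  · have e1 : b1 ξ = 1 := b1.one_of_mem_closedBall (by simpa using h2)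
    have e0 : b0 ξ = 0 := b0.zero_of_le_dist (by simpa using h1)
    simp [e1, e0]
  · have hξ' : b1 ξ * (1 - b0 ξ) ≠ 0 := hξ
    constructor
    · by_contra h
      have e0 : b0 ξ = 1 := b0.one_of_mem_closedBall (by simpa [b0] using (not_le.1 h).le)
      exact hξ' (by simp [e0])
    · by_contra h
      have e1 : b1 ξ = 0 := b1.zero_of_le_dist (by simpa using (not_le.1 h).le)
      exact hξ' (by simp [e1])
  · exact (isClosed_le continuous_const continuous_norm).inter
      (isClosed_le continuous_norm continuous_const)

theorem hasCompactSupport_of_tsupport_subset {f : EuclideanSpace ℝ (Fin d) → ℝ} {R : ℝ}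
    (h : ∀ ξ ∈ tsupport f, ‖ξ‖ ≤ R) : HasCompactSupport f :=
  HasCompactSupport.of_support_subset_isCompact (isCompact_closedBall 0 R) fun ξ hξ => by
    simpa using h ξ (subset_tsupport _ hξ)

/-- The norm is smooth away from `0`, and the product vanishes identically near every point outside
the support of `χ`, in particular near `0`. -/
theorem contDiff_cutoff_mul_norm_zpow {χ : EuclideanSpace ℝ (Fin d) → ℝ} (hχ : ContDiff ℝ ∞ χ)
    {r : ℝ} (hr : 0 < r) (hs : ∀ ξ ∈ tsupport χ, r ≤ ‖ξ‖) (e : ℤ) :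
    ContDiff ℝ ∞ fun ξ => χ ξ * ‖ξ‖ ^ e := by
  rw [contDiff_iff_contDiffAt]
  intro ξ
  by_cases h : ξ ∈ tsupport χ
  · have h0 : ξ ≠ 0 := by
      rintro rfl
      have := hs 0 h
      rw [norm_zero] at this
      linarith
    have h1 : ContDiffAt ℝ ∞ (fun ξ : EuclideanSpace ℝ (Fin d) => ‖ξ‖) ξ := contDiffAt_norm ℝ h0
    have h2 : ContDiffAt ℝ ∞ (fun ξ : EuclideanSpace ℝ (Fin d) => ‖ξ‖ ^ e) ξ := by
      cases e with
      | ofNat n => simpa using h1.pow n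
      | negSucc n =>
        simp only [zpow_negSucc]
        exact (h1.pow (n + 1)).inv (pow_ne_zero _ (norm_ne_zero_iff.2 h0))
    exact hχ.contDiffAt.mul h2
  · have h1 : (fun ξ => χ ξ * ‖ξ‖ ^ e) =ᶠ[nhds ξ] fun _ => 0 := by
      filter_upwards [(isClosed_tsupport χ).isOpen_compl.mem_nhds h] with y hy
      rw [image_eq_zero_of_notMem_tsupport hy, zero_mul]
    exact contDiffAt_const.congr_of_eventuallyEq h1

end QTorus

namespace QTorus

open scoped SchwartzMap ContDiff

variable {d : ℕ}

/-! ### Lattice points -/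

theorem one_le_latticeNorm {m : Fin d → ℤ} (hm : m ≠ 0) : 1 ≤ latticeNorm m := by
  obtain ⟨j, hj⟩ := Function.ne_iff.1 hm
  have h1 : ‖latticePoint m j‖ ≤ ‖latticePoint m‖ := PiLp.norm_apply_le _ j
  have h2 : (1 : ℝ) ≤ ‖latticePoint m j‖ := by
    have : (1 : ℤ) ≤ |m j| := Int.one_le_abs hj
    simp only [latticePoint, Real.norm_eq_abs]
    exact_mod_cast this
  exact h2.trans h1

theorem latticeNorm_zero : latticeNorm (0 : Fin d → ℤ) = 0 := by
  have : latticePoint (0 : Fin d → ℤ) = 0 := by ext; simp [latticePoint]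
  rw [latticeNorm, this, norm_zero]

theorem latticeNorm_nonneg (m : Fin d → ℤ) : 0 ≤ latticeNorm m := norm_nonneg _

theorem latticePoint_sub (m n : Fin d → ℤ) :
    latticePoint m - latticePoint n = latticePoint (m - n) := by
  ext; simp [latticePoint]

theorem finite_latticeNorm_le (d : ℕ) (R : ℝ) : {m : Fin d → ℤ | latticeNorm m ≤ R}.Finite := by
  refine (Set.finite_Icc (fun _ : Fin d => -⌈R⌉) (fun _ => ⌈R⌉)).subset fun m hm => ?_
  have h : ∀ j, |m j| ≤ ⌈R⌉ := by
    intro j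
    have h1 : ‖latticePoint m j‖ ≤ ‖latticePoint m‖ := PiLp.norm_apply_le _ j
    have h2 : ((|m j| : ℤ) : ℝ) ≤ R := by
      simp only [latticePoint, Real.norm_eq_abs] at h1
      push_cast
      exact h1.trans hm
    exact_mod_cast h2.trans (Int.le_ceil R)
  exact ⟨fun j => (abs_le.1 (h j)).1, fun j => (abs_le.1 (h j)).2⟩

/-- The dilated lattice point `2^{-j} m`. -/
def dyadicPoint (j : ℕ) (m : Fin d → ℤ) : EuclideanSpace ℝ (Fin d) :=
  (2 : ℝ) ^ (-(j : ℤ)) • latticePoint m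

theorem norm_dyadicPoint (j : ℕ) (m : Fin d → ℤ) : ‖dyadicPoint j m‖ = latticeNorm m / 2 ^ j := by
  rw [dyadicPoint, norm_smul, zpow_neg, zpow_natCast, norm_inv, norm_pow, Real.norm_two,
    ← div_eq_inv_mul, latticeNorm]

theorem latticeNorm_pow_eq (γ j : ℕ) (m : Fin d → ℤ) :
    latticeNorm m ^ γ = 2 ^ (γ * j) * ‖dyadicPoint j m‖ ^ γ := by
  rw [norm_dyadicPoint, div_pow, ← pow_mul, mul_comm j γ]
  field_simp

/-- A bump function of radius `1/2` about `m` sees no other lattice point, since distinct lattice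
points have distance at least `1`. -/
theorem exists_isMultiplier_single (m : Fin d → ℤ) :
    ∃ K, IsMultiplier (Pi.single m (1 : ℂ)) K := by
  let b : ContDiffBump (latticePoint m) := ⟨1 / 4, 1 / 2, by norm_num, by norm_num⟩
  obtain ⟨K, hK⟩ := exists_isMultiplier_of_contDiff b.contDiff b.hasCompactSupport
  refine ⟨K, ?_⟩
  convert hK 1 using 1
  funext n
  rw [one_smul]
  by_cases h : n = m
  · subst h
    have : b (latticePoint n) = 1 := b.one_of_mem_closedBall (by simp [b])
    simp [this]
  · have : b (latticePoint n) = 0 := by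
      refine b.zero_of_le_dist ?_
      rw [dist_eq_norm, latticePoint_sub]
      have := one_le_latticeNorm (sub_ne_zero.2 h)
      change 1 / 2 ≤ latticeNorm (n - m)
      linarith
    simp [this, h]

/-! ### Radial symbols on dyadic annuli -/

/-- The functions `|ξ|^γ` and `|ξ|^{-γ}` must be replaced by smooth functions of compact support to
be multipliers. Agreement on `1/4 ≤ |ξ| ≤ 4` leaves room for a cutoff `χ` that equals `1` on the
annulus `1/2 ≤ |ξ| ≤ 2` of the Littlewood-Paley pieces. -/
theorem exists_radial_symbols (d γ : ℕ) : ∃ χ η ζ : EuclideanSpace ℝ (Fin d) → ℝ,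
    (ContDiff ℝ ∞ χ ∧ HasCompactSupport χ) ∧ (ContDiff ℝ ∞ η ∧ HasCompactSupport η) ∧
    (ContDiff ℝ ∞ ζ ∧ HasCompactSupport ζ) ∧ (∀ ξ, 1 / 2 ≤ ‖ξ‖ → ‖ξ‖ ≤ 2 → χ ξ = 1) ∧
    (∀ ξ ∈ tsupport χ, 1 / 4 ≤ ‖ξ‖ ∧ ‖ξ‖ ≤ 4) ∧
    ∀ ξ, 1 / 4 ≤ ‖ξ‖ → ‖ξ‖ ≤ 4 → η ξ = ‖ξ‖ ^ γ ∧ ζ ξ = (‖ξ‖ ^ γ)⁻¹ := by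
  obtain ⟨χ, hχ, hχ1, hχs⟩ := exists_annulus_cutoff d (R := 2) (by norm_num)
  obtain ⟨ψ, hψ, hψ1, hψs⟩ := exists_annulus_cutoff d (R := 4) (by norm_num)
  have hψc : HasCompactSupport ψ := hasCompactSupport_of_tsupport_subset fun ξ hξ => (hψs hξ).2
  refine ⟨χ, fun ξ => ψ ξ * ‖ξ‖ ^ (γ : ℤ), fun ξ => ψ ξ * ‖ξ‖ ^ (-(γ : ℤ)), ⟨hχ,
    hasCompactSupport_of_tsupport_subset fun ξ hξ => (hχs hξ).2⟩,
    ⟨contDiff_cutoff_mul_norm_zpow hψ (r := 8⁻¹) (by norm_num) (fun ξ hξ => ?_) _,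
      hψc.mul_right⟩,
    ⟨contDiff_cutoff_mul_norm_zpow hψ (r := 8⁻¹) (by norm_num) (fun ξ hξ => ?_) _,
      hψc.mul_right⟩, fun ξ h1 h2 => hχ1 ξ ?_ h2, fun ξ hξ => ⟨?_, ?_⟩, fun ξ h1 h2 => ?_⟩
  · have := (hψs hξ).1; norm_num at this ⊢; linarith
  · have := (hψs hξ).1; norm_num at this ⊢; linarith
  · norm_num; linarith
  · have := (hχs hξ).1; norm_num at this ⊢; linarith
  · have := (hχs hξ).2; norm_num at this ⊢; linarith
  · have : ψ ξ = 1 := hψ1 ξ (by norm_num; linarith) h2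
    simp [this]

theorem two_pow_tendsto {γ : ℕ} (hγ : 1 ≤ γ) (B : ℝ) : ∃ J : ℕ, ∀ j ≥ J, B ≤ (2 : ℝ) ^ (γ * j) := by
  obtain ⟨J, hJ⟩ := pow_unbounded_of_one_lt B (by norm_num : (1 : ℝ) < 2)
  refine ⟨J, fun j hj => hJ.le.trans (pow_le_pow_right₀ (by norm_num) ?_)⟩
  nlinarith

/-- This treats one factor `|m|^γ + σ` after division by `2^{γj}`. The shift becomes the small
perturbation `σ/2^{γj}`, so for large `j` the reciprocal is `ζ` times a Neumann series. -/
theorem exists_shifted_symbol (d : ℕ) {γ : ℕ} (hγ : 1 ≤ γ) (σ : ℝ) : ∃ (J : ℕ) (K : ℝ), ∀ j ≥ J,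
    ∃ q q' : (Fin d → ℤ) → ℂ, IsMultiplier q K ∧ IsMultiplier q' K ∧
      ∀ m, 1 / 4 ≤ ‖dyadicPoint j m‖ → ‖dyadicPoint j m‖ ≤ 4 →
        q m = ((‖dyadicPoint j m‖ ^ γ + σ / 2 ^ (γ * j) : ℝ) : ℂ) ∧ q m * q' m = 1 := by
  obtain ⟨χ, η, ζ, -, ⟨hη, hηc⟩, ⟨hζ, hζc⟩, -, -, hηζ⟩ := exists_radial_symbols d γ
  obtain ⟨A, hA⟩ := exists_isMultiplier_of_contDiff hη hηc
  obtain ⟨B, hB⟩ := exists_isMultiplier_of_contDiff hζ hζc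
  have hB0 : 0 ≤ B := (hB 0).1
  obtain ⟨J, hJ⟩ := two_pow_tendsto hγ (2 * |σ| * B)
  refine ⟨J, max (A + |σ|) (B * 2), fun j hj => ?_⟩
  have hL1 : (1 : ℝ) ≤ 2 ^ (γ * j) := one_le_pow₀ (by norm_num)
  have hL0 : (0 : ℝ) < 2 ^ (γ * j) := by positivity
  have hq : IsMultiplier (fun m => (η (dyadicPoint j m) : ℂ) + ((σ / 2 ^ (γ * j) : ℝ) : ℂ))
      (A + |σ|) := by
    refine ((hA _).add (IsMultiplier.const ((σ / 2 ^ (γ * j) : ℝ) : ℂ))).mono ?_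
    have : ‖((σ / 2 ^ (γ * j) : ℝ) : ℂ)‖ ≤ |σ| := by
      rw [Complex.norm_real, Real.norm_eq_abs, abs_div, abs_of_pos hL0]
      exact div_le_self (abs_nonneg σ) hL1
    linarith
  have hc : IsMultiplier (fun m => ((-σ / 2 ^ (γ * j) : ℝ) : ℂ) * (ζ (dyadicPoint j m) : ℂ))
      (1 / 2) := by
    refine ((hB _).const_mul ((-σ / 2 ^ (γ * j) : ℝ) : ℂ)).mono ?_
    rw [Complex.norm_real, Real.norm_eq_abs, abs_div, abs_of_pos hL0, abs_neg, div_mul_eq_mul_div,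
      div_le_iff₀ hL0]
    have := hJ j hj
    linarith
  -- The reciprocal of `u + ε` is `u⁻¹ (1 + ε u⁻¹)⁻¹` with `ε = σ/2^{γj}`. The choice of `J` gives
  -- `|ε| B ≤ 1/2`, so the Neumann series costs at most the factor `2`.
  have hq' := (hB ((2 : ℝ) ^ (-(j : ℤ)))).mul (hc.one_sub_inv (by norm_num))
  refine ⟨_, _, hq.mono (le_max_left _ _), hq'.mono ?_, fun m h1 h2 => ?_⟩
  · refine le_trans (le_of_eq ?_) (le_max_right _ _)
    norm_num
  · obtain ⟨e1, e2⟩ := hηζ _ h1 h2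
    have hu : 0 < ‖dyadicPoint j m‖ ^ γ := by
      have : 0 < ‖dyadicPoint j m‖ := by linarith
      positivity
    rw [e1]
    refine ⟨by push_cast; rfl, ?_⟩
    have h3 := hc.norm_le m
    change (_ + _) * ((ζ (dyadicPoint j m) : ℂ) * (1 - ((-σ / 2 ^ (γ * j) : ℝ) : ℂ) * (ζ (dyadicPoint j m) : ℂ))⁻¹) = 1
    simp only [e2, ← Complex.ofReal_mul, ← Complex.ofReal_add, ← Complex.ofReal_one,
      ← Complex.ofReal_sub, ← Complex.ofReal_inv, Complex.norm_real, Real.norm_eq_abs] at h3 ⊢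
    congr 1
    have h4 : 1 - -σ / 2 ^ (γ * j) * (‖dyadicPoint j m‖ ^ γ)⁻¹ ≠ 0 := by
      have := (abs_le.1 h3).2
      intro h
      linarith
    have h5 : ‖dyadicPoint j m‖ ^ γ * (1 - -σ / 2 ^ (γ * j) * (‖dyadicPoint j m‖ ^ γ)⁻¹) =
        ‖dyadicPoint j m‖ ^ γ + σ / 2 ^ (γ * j) := by
      field_simp
      ring
    rw [← h5, mul_mul_mul_comm, mul_inv_cancel₀ hu.ne', mul_inv_cancel₀ h4, one_mul]

theorem exists_prod_shifted_symbol (d : ℕ) {γ : ℕ} (hγ : 1 ≤ γ) (σ : ℕ → ℝ) (n : ℕ) :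
    ∃ (J : ℕ) (K : ℝ), ∀ j ≥ J,
    ∃ q q' : (Fin d → ℤ) → ℂ, IsMultiplier q K ∧ IsMultiplier q' K ∧
      ∀ m, 1 / 4 ≤ ‖dyadicPoint j m‖ → ‖dyadicPoint j m‖ ≤ 4 →
        q m = ((∏ i ∈ Finset.range n, (‖dyadicPoint j m‖ ^ γ + σ i / 2 ^ (γ * j)) : ℝ) : ℂ) ∧
          q m * q' m = 1 := by
  induction n with
  | zero => exact ⟨0, 1, fun j _ => ⟨1, 1, IsMultiplier.one, IsMultiplier.one, fun m _ _ => by simp⟩⟩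
  | succ n ih =>
    obtain ⟨J1, K1, h1⟩ := ih
    obtain ⟨J2, K2, h2⟩ := exists_shifted_symbol d hγ (σ n)
    refine ⟨max J1 J2, K1 * K2, fun j hj => ?_⟩
    obtain ⟨q1, q1', a1, a1', e1⟩ := h1 j ((le_max_left _ _).trans hj)
    obtain ⟨q2, q2', a2, a2', e2⟩ := h2 j ((le_max_right _ _).trans hj)
    refine ⟨q1 * q2, q1' * q2', a1.mul a2, a1'.mul a2', fun m hm hm' => ?_⟩
    obtain ⟨b1, c1⟩ := e1 m hm hm'
    obtain ⟨b2, c2⟩ := e2 m hm hm'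
    refine ⟨?_, ?_⟩
    · rw [Finset.prod_range_succ, Pi.mul_apply, b1, b2]
      push_cast
      rfl
    · rw [Pi.mul_apply, Pi.mul_apply, mul_mul_mul_comm, c1, c2, one_mul]

theorem exists_diffFactor_symbol (d : ℕ) {γ : ℕ} (hγ : 1 ≤ γ) (k : ℤ) : ∃ (J : ℕ) (K : ℝ), ∀ j ≥ J,
    ∃ q q' : (Fin d → ℤ) → ℂ, IsMultiplier q K ∧ IsMultiplier q' K ∧
      ∀ m, 1 / 4 ≤ ‖dyadicPoint j m‖ → ‖dyadicPoint j m‖ ≤ 4 →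
        (diffFactor (latticeNorm m ^ γ) k : ℂ) = (((2 : ℝ) ^ (γ * j)) ^ k : ℝ) * q m ∧
          q m * q' m = 1 := by
  rcases le_or_gt 0 k with hk | hk
  · obtain ⟨J, K, h⟩ := exists_prod_shifted_symbol d hγ (fun i => -(i : ℝ)) k.toNat
    refine ⟨J, K, fun j hj => ?_⟩
    obtain ⟨q, q', a, a', e⟩ := h j hj
    refine ⟨q, q', a, a', fun m hm hm' => ⟨?_, (e m hm hm').2⟩⟩
    rw [(e m hm hm').1, ← Complex.ofReal_mul]
    congr 1
    rw [diffFactor, if_pos hk]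
    have : ((2 : ℝ) ^ (γ * j)) ^ k = ∏ _i ∈ Finset.range k.toNat, (2 : ℝ) ^ (γ * j) := by
      conv_lhs => rw [← Int.toNat_of_nonneg hk, zpow_natCast]
      rw [Finset.prod_const, Finset.card_range]
    rw [this, ← Finset.prod_mul_distrib]
    refine Finset.prod_congr rfl fun i _ => ?_
    rw [latticeNorm_pow_eq γ j, mul_add]
    field_simp
    ring
  · obtain ⟨J, K, h⟩ := exists_prod_shifted_symbol d hγ (fun i => (i : ℝ) + 1) (-k).toNat
    refine ⟨J, K, fun j hj => ?_⟩
    obtain ⟨q, q', a, a', e⟩ := h j hj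
    -- For negative `k` the factor is the reciprocal of a product of shifted symbols, so the symbol
    -- and its inverse exchange roles.
    refine ⟨q', q, a', a, fun m hm hm' => ⟨?_, by rw [mul_comm]; exact (e m hm hm').2⟩⟩
    have h1 : q' m = (q m)⁻¹ := eq_inv_of_mul_eq_one_right (e m hm hm').2
    rw [h1, (e m hm hm').1, ← Complex.ofReal_inv, ← Complex.ofReal_mul]
    congr 1
    rw [diffFactor, if_neg (not_le.2 hk)]
    have : ((2 : ℝ) ^ (γ * j)) ^ k = (∏ _i ∈ Finset.range (-k).toNat, (2 : ℝ) ^ (γ * j))⁻¹ := by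
      have hk' : k = -(((-k).toNat : ℕ) : ℤ) := by lia
      conv_lhs => rw [hk', zpow_neg, zpow_natCast]
      rw [Finset.prod_const, Finset.card_range]
    rw [this, ← mul_inv, ← Finset.prod_mul_distrib, one_div]
    congr 1
    refine Finset.prod_congr rfl fun i _ => ?_
    rw [latticeNorm_pow_eq γ j, mul_add]
    field_simp

/-! ### The symbols of the derivatives of the semigroups -/

/-- The symbol of `𝒥^k_r` of the semigroup with generator `|m|^γ`, without its part of order less
than `k`. -/
def radialSymbol (γ : ℕ) (k : ℤ) (r : ℝ) (m : Fin d → ℤ) : ℝ :=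
  if latticeNorm m ^ γ < k then 0
  else diffFactor (latticeNorm m ^ γ) k * r ^ (latticeNorm m ^ γ - k)

theorem diffFactor_pos {s : ℝ} {k : ℤ} (hs : 0 ≤ s) (h : k ≤ s) : 0 < diffFactor s k := by
  unfold diffFactor
  split_ifs with hk
  · refine Finset.prod_pos fun i hi => ?_
    have h1 : (i : ℤ) < k := by
      have := Finset.mem_range.1 hi
      lia
    have h2 : ((i : ℤ) : ℝ) < k := by exact_mod_cast h1
    push_cast at h2
    linarith
  · refine one_div_pos.2 (Finset.prod_pos fun i _ => ?_)
    positivity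

theorem radialSymbol_of_le {γ : ℕ} {k : ℤ} {r : ℝ} {m : Fin d → ℤ} (h : k ≤ latticeNorm m ^ γ) :
    radialSymbol γ k r m =
      diffFactor (latticeNorm m ^ γ) k * r ^ (latticeNorm m ^ γ - k) := by
  rw [radialSymbol, if_neg (not_lt.2 h)]

theorem radialSymbol_nonneg (γ : ℕ) (k : ℤ) {r : ℝ} (hr : 0 ≤ r) (m : Fin d → ℤ) :
    0 ≤ radialSymbol γ k r m := by
  rcases lt_or_ge (latticeNorm m ^ γ) (k : ℝ) with h | h
  · rw [radialSymbol, if_pos h]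
  · rw [radialSymbol_of_le h]
    exact mul_nonneg (diffFactor_pos (pow_nonneg (latticeNorm_nonneg m) γ) h).le
      (Real.rpow_nonneg hr _)

theorem radialSymbol_le (γ : ℕ) (k : ℤ) {r : ℝ} (hr : 0 ≤ r) (hr1 : r ≤ 1) (m : Fin d → ℤ) :
    radialSymbol γ k r m ≤ |diffFactor (latticeNorm m ^ γ) k| := by
  rcases lt_or_ge (latticeNorm m ^ γ) (k : ℝ) with h | h
  · rw [radialSymbol, if_pos h]
    exact abs_nonneg _
  · rw [radialSymbol_of_le h]
    have h1 := diffFactor_pos (pow_nonneg (latticeNorm_nonneg m) γ) h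
    rw [abs_of_pos h1]
    exact mul_le_of_le_one_right h1.le (Real.rpow_le_one hr hr1 (sub_nonneg.2 h))

/-- At frequency `|m|^γ = L u` the semigroup becomes `e^{-tu}` with `t = -L log r`. On a dyadic
annulus `u` stays in a fixed compact interval of `(0, ∞)`, so the level `j` enters only through `t`
and `L`. -/
theorem rpow_sub_eq_exp {r : ℝ} (hr : 0 < r) (L u : ℝ) (k : ℤ) :
    r ^ (L * u - k) = Real.exp (-(-Real.log r * L) * u) * (r ^ k)⁻¹ := by
  rw [Real.rpow_sub hr, Real.rpow_intCast, div_eq_mul_inv, Real.rpow_def_of_pos hr]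
  congr 2
  ring

/-! ### The semigroup symbol on Littlewood-Paley pieces: inversion and decay -/

section LittlewoodPaley

variable {φ : 𝓢(EuclideanSpace ℝ (Fin d), ℝ)}

theorem IsLittlewoodPaley.norm_bounds (hφ : IsLittlewoodPaley φ) {ξ : EuclideanSpace ℝ (Fin d)}
    (h : φ ξ ≠ 0) : 1 / 2 ≤ ‖ξ‖ ∧ ‖ξ‖ ≤ 2 :=
  hφ.support_subset (subset_tsupport _ h)

theorem IsLittlewoodPaley.exists_isMultiplier (hφ : IsLittlewoodPaley φ) :
    ∃ K, ∀ j : ℕ, IsMultiplier (fun m : Fin d → ℤ => (φ (dyadicPoint j m) : ℂ)) K := by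
  obtain ⟨K, hK⟩ := exists_isMultiplier_of_contDiff (φ.smooth ⊤)
    (hasCompactSupport_of_tsupport_subset fun ξ hξ => (hφ.support_subset hξ).2)
  exact ⟨K, fun j => hK _⟩

theorem neg_log_le {r : ℝ} (hr : 1 / 2 ≤ r) (hr1 : r ≤ 1) : -Real.log r ≤ 2 * (1 - r) := by
  have h1 := Real.one_sub_inv_le_log_of_pos (show 0 < r by linarith)
  have h2 : r⁻¹ - 1 ≤ 2 * (1 - r) := by
    have h3 : r⁻¹ - 1 = (1 - r) * r⁻¹ := by
      field_simp
    have h4 : r⁻¹ ≤ 2 := by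
      rw [inv_le_comm₀ (by linarith) (by norm_num)]
      linarith
    rw [h3, mul_comm]
    exact mul_le_mul_of_nonneg_right h4 (by linarith)
  linarith

theorem abs_zpow_le {r : ℝ} (hr : 1 / 2 ≤ r) (hr1 : r ≤ 1) (k : ℤ) : r ^ k ≤ 2 ^ |k| := by
  rcases le_or_gt 0 k with hk | hk
  · rw [abs_of_nonneg hk]
    exact zpow_le_zpow_left₀ hk (by linarith) (by linarith)
  · have h4 : r⁻¹ ≤ 2 := by
      rw [inv_le_comm₀ (by linarith) (by norm_num)]
      linarith
    have h5 : r ^ k = r⁻¹ ^ (-k) := by rw [inv_zpow', neg_neg]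
    rw [abs_of_neg hk, h5]
    exact zpow_le_zpow_left₀ (by lia) (by positivity) h4

/-- On the shell `1 - r ≈ 2^{-γj}` the Littlewood-Paley piece is a multiplier of the derivative of
the semigroup. -/
theorem IsLittlewoodPaley.exists_inverse_symbol (hφ : IsLittlewoodPaley φ) {γ : ℕ} (hγ : 1 ≤ γ)
    (k : ℤ) : ∃ (J : ℕ) (K : ℝ), 1 ≤ J ∧ ∀ j ≥ J, ∀ r : ℝ, 0 < r → r < 1 →
      1 - r ≤ ((2 : ℝ) ^ (γ * j))⁻¹ → ∃ c : (Fin d → ℤ) → ℂ,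
        IsMultiplier c (K * (((2 : ℝ) ^ (γ * j)) ^ k)⁻¹) ∧
          ∀ m, c m * radialSymbol γ k r m = φ (dyadicPoint j m) := by
  obtain ⟨J1, K1, hJ1⟩ := exists_diffFactor_symbol d hγ k
  obtain ⟨χ, η, ζ, -, ⟨hη, hηc⟩, -, -, -, hηζ⟩ := exists_radial_symbols d γ
  obtain ⟨A, hA⟩ := exists_isMultiplier_of_contDiff hη hηc
  obtain ⟨B, hB⟩ := hφ.exists_isMultiplier
  -- For `j ≥ J2` every frequency seen by the `j`-th piece satisfies `|m|^γ ≥ 2^{γj} 2^{-γ} ≥ |k|`,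
  -- so none of them is cut off in `radialSymbol`. The lower bound `j ≥ 1` below gives `r ≥ 1/2`.
  obtain ⟨J2, hJ2⟩ := two_pow_tendsto hγ (2 ^ γ * |(k : ℝ)|)
  have hA0 : 0 ≤ A := (hA 0).1
  refine ⟨max 1 (max J1 J2), 2 ^ |k| * (B * Real.exp (2 * A) * K1), le_max_left _ _,
    fun j hj r hr0 hr1 hr => ?_⟩
  have hj1 : 1 ≤ j := (le_max_left _ _).trans hj
  obtain ⟨q, q', a, a', e⟩ := hJ1 j (((le_max_left _ _).trans (le_max_right _ _)).trans hj)
  have hjk := hJ2 j (((le_max_right _ _).trans (le_max_right _ _)).trans hj)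
  set L : ℝ := 2 ^ (γ * j) with hL
  have hL0 : 0 < L := by positivity
  have hL2 : 2 ≤ L := by
    have : (2 : ℝ) ^ 1 ≤ 2 ^ (γ * j) := pow_le_pow_right₀ (by norm_num) (by nlinarith)
    simpa using this
  have hr2 : 1 / 2 ≤ r := by
    have : L⁻¹ ≤ 2⁻¹ := inv_anti₀ (by norm_num) hL2
    linarith
  set t := -Real.log r * L with ht
  have ht0 : 0 ≤ t := mul_nonneg (neg_nonneg.2 (Real.log_nonpos hr0.le hr1.le)) hL0.le
  have ht2 : t ≤ 2 := by
    have h1 := neg_log_le hr2 hr1.le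
    have h2 : (1 - r) * L ≤ 1 := by
      calc (1 - r) * L ≤ L⁻¹ * L := mul_le_mul_of_nonneg_right hr hL0.le
        _ = 1 := inv_mul_cancel₀ hL0.ne'
    rw [ht]
    nlinarith
  -- The inverse symbol is `r^k L^{-k} φ e^{tη} q'`. The growing exponential is harmless because `t
  -- ≤ 2` on this range of `r`.
  have hmul := (((hB j).mul ((hA ((2 : ℝ) ^ (-(j : ℤ)))).const_mul (t : ℂ)).exp).mul
    a').const_mul ((r ^ k * (L ^ k)⁻¹ : ℝ) : ℂ)
  refine ⟨_, hmul.mono ?_, fun m => ?_⟩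
  · have h1 : ‖((r ^ k * (L ^ k)⁻¹ : ℝ) : ℂ)‖ ≤ 2 ^ |k| * (L ^ k)⁻¹ := by
      rw [Complex.norm_real, Real.norm_of_nonneg (by positivity)]
      exact mul_le_mul_of_nonneg_right (abs_zpow_le hr2 hr1.le k) (by positivity)
    have h2 : ‖(t : ℂ)‖ * A ≤ 2 * A := by
      rw [Complex.norm_real, Real.norm_of_nonneg ht0]
      exact mul_le_mul_of_nonneg_right ht2 hA0
    have hB0 : 0 ≤ B := (hB 0).1
    calc _ ≤ 2 ^ |k| * (L ^ k)⁻¹ * (B * Real.exp (2 * A) * K1) := by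
          have := a'.1
          gcongr
      _ = _ := by ring
  · by_cases h0 : φ (dyadicPoint j m) = 0
    · simp [h0]
    · obtain ⟨hm, hm'⟩ := hφ.norm_bounds h0
      have hu : (1 / 2) ^ γ ≤ ‖dyadicPoint j m‖ ^ γ := pow_le_pow_left₀ (by norm_num) hm γ
      have hlam : (k : ℝ) ≤ latticeNorm m ^ γ := by
        rw [latticeNorm_pow_eq γ j]
        have h1 : L * (1 / 2) ^ γ ≤ L * ‖dyadicPoint j m‖ ^ γ :=
          mul_le_mul_of_nonneg_left hu hL0.le
        have h2 : |(k : ℝ)| ≤ L * (1 / 2) ^ γ := by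
          rw [one_div, inv_pow, ← div_eq_mul_inv, le_div_iff₀ (by positivity)]
          linarith
        exact (le_abs_self _).trans (h2.trans h1)
      obtain ⟨e1, e2⟩ := e m (by linarith) (by linarith)
      have e3 := (hηζ (dyadicPoint j m) (by linarith) (by linarith)).1
      rw [radialSymbol_of_le hlam]
      have e4 : r ^ (latticeNorm m ^ γ - k) =
          Real.exp (-t * ‖dyadicPoint j m‖ ^ γ) * (r ^ k)⁻¹ := by
        rw [latticeNorm_pow_eq γ j]
        exact rpow_sub_eq_exp hr0 L _ k
      rw [e4]
      change (((r ^ k * (L ^ k)⁻¹ : ℝ) : ℂ) * ((φ (dyadicPoint j m) : ℂ) *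
        Complex.exp ((t : ℂ) * (η (dyadicPoint j m) : ℂ)) * q' m)) * _ = _
      rw [e3, Complex.ofReal_mul (diffFactor _ _), e1]
      have e5 : Complex.exp ((t : ℂ) * ((‖dyadicPoint j m‖ ^ γ : ℝ) : ℂ)) *
          (Real.exp (-t * ‖dyadicPoint j m‖ ^ γ) : ℂ) = 1 := by
        rw [← Complex.ofReal_mul, ← Complex.ofReal_exp, ← Complex.ofReal_mul, ← Real.exp_add]
        simp
      have hrk : (r : ℂ) ^ k ≠ 0 := zpow_ne_zero _ (by exact_mod_cast hr0.ne')
      have hLk : (L : ℂ) ^ k ≠ 0 := zpow_ne_zero _ (by exact_mod_cast hL0.ne')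
      simp only [Complex.ofReal_mul, Complex.ofReal_inv, Complex.ofReal_zpow]
      calc _ = (φ (dyadicPoint j m) : ℂ) * (q m * q' m) *
            (Complex.exp ((t : ℂ) * ((‖dyadicPoint j m‖ ^ γ : ℝ) : ℂ)) *
              (Real.exp (-t * ‖dyadicPoint j m‖ ^ γ) : ℂ)) *
            ((r : ℂ) ^ k * ((r : ℂ) ^ k)⁻¹) * ((L : ℂ) ^ k * ((L : ℂ) ^ k)⁻¹) := by ring
        _ = _ := by rw [e2, e5, mul_inv_cancel₀ hrk, mul_inv_cancel₀ hLk]; ring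

end LittlewoodPaley

end QTorus

namespace QTorus

open scoped SchwartzMap ContDiff

variable {d : ℕ}

theorem exists_isMultiplier_of_finite (S : Finset (Fin d → ℤ)) : ∃ B : (Fin d → ℤ) → ℝ,
    (∀ m, 0 ≤ B m) ∧ ∀ f : (Fin d → ℤ) → ℂ,
      IsMultiplier (fun m => if m ∈ S then f m else 0) (∑ m ∈ S, ‖f m‖ * B m) := by
  classical
  choose B hB using exists_isMultiplier_single (d := d)
  refine ⟨B, fun m => (hB m).1, fun f => ?_⟩
  convert IsMultiplier.sum S fun m _ => (hB m).const_mul (f m) using 1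
  funext n
  simp [Finset.sum_apply, Pi.single_apply]

/-- A Littlewood-Paley piece of the derivative of the semigroup is a multiplier of the
Littlewood-Paley piece, with an exponentially decreasing norm. -/
theorem IsLittlewoodPaley.exists_forward_symbol {φ : 𝓢(EuclideanSpace ℝ (Fin d), ℝ)}
    (hφ : IsLittlewoodPaley φ) {γ : ℕ} (hγ : 1 ≤ γ) (k : ℤ) : ∃ K c₀ : ℝ, 0 ≤ K ∧ 0 < c₀ ∧
      ∀ (j : ℕ) (r : ℝ), 0 < r → r < 1 → ∃ c : (Fin d → ℤ) → ℂ,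
        IsMultiplier c (K * ((2 : ℝ) ^ (γ * j)) ^ k * Real.exp (-(c₀ * ((2 : ℝ) ^ (γ * j) * (1 - r))))) ∧
          ∀ m, c m * φ (dyadicPoint j m) = radialSymbol γ k r m * φ (dyadicPoint j m) := by
  obtain ⟨J1, K1, hJ1⟩ := exists_diffFactor_symbol d hγ k
  obtain ⟨χ, η, ζ, ⟨hχ, hχc⟩, ⟨hη, hηc⟩, -, hχ1, hχs, hηζ⟩ := exists_radial_symbols d γ
  obtain ⟨C, hC0, hC⟩ := exists_isMultiplier_cutoff_exp hχ hχc hη hηc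
    (c := (1 / 4) ^ γ) (by positivity) (fun ξ hξ => by
      obtain ⟨h1, h2⟩ := hχs ξ hξ
      rw [(hηζ ξ h1 h2).1]
      exact pow_le_pow_left₀ (by norm_num) h1 γ)
  -- This threshold means `|k| ≤ c₀ 2^{γj}`. It puts the frequencies of the piece above `k` and also
  -- lets the decay absorb the factor `r^{-k}`, which is not bounded as `r → 0`.
  obtain ⟨J2, hJ2⟩ := two_pow_tendsto hγ (4 * 4 ^ γ * |(k : ℝ)|)
  set J := max J1 J2
  obtain ⟨B, hB0, hB⟩ := exists_isMultiplier_of_finite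
    (finite_latticeNorm_le d (2 * 2 ^ J)).toFinset
  set S := (finite_latticeNorm_le d (2 * 2 ^ J)).toFinset
  have hK1 : 0 ≤ K1 := by
    obtain ⟨q, -, a, -⟩ := hJ1 J1 le_rfl
    exact a.1
  -- The cutoff estimate with `η ≥ (1/4)^γ` on the support of `χ` decays at the rate `(1/4)^γ/2 =
  -- 2c₀`. One `c₀` is spent on `r^{-k} ≤ e^{c₀ t}`, the other remains.
  set c₀ : ℝ := (1 / 4) ^ γ / 4 with hc₀
  have hc₀0 : 0 < c₀ := by positivity
  set M : ℝ := 2 ^ (γ * J) with hM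
  set K2 : ℝ := ∑ m ∈ S, |diffFactor (latticeNorm m ^ γ) k| * B m with hK2
  have hK20 : 0 ≤ K2 := Finset.sum_nonneg fun m _ => mul_nonneg (abs_nonneg _) (hB0 m)
  have hM1 : 1 ≤ M := one_le_pow₀ (by norm_num)
  refine ⟨max (C * K1) (K2 * (M ^ |k| * Real.exp (c₀ * M))), c₀,
    le_max_of_le_left (by positivity), hc₀0, fun j r hr0 hr1 => ?_⟩
  set L : ℝ := 2 ^ (γ * j) with hL
  have hL1 : 1 ≤ L := one_le_pow₀ (by norm_num)
  have hL0 : 0 < L := by linarith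
  rcases le_or_gt J j with hj | hj
  · obtain ⟨q, q', a, -, e⟩ := hJ1 j ((le_max_left _ _).trans hj)
    have hjk := hJ2 j ((le_max_right _ _).trans hj)
    rw [← hL] at hjk
    set t := -Real.log r * L with ht
    have htl : L * (1 - r) ≤ t := by
      have := Real.log_le_sub_one_of_pos hr0
      rw [ht, mul_comm]
      exact mul_le_mul_of_nonneg_right (by linarith) hL0.le
    have ht0 : 0 ≤ t := le_trans (by have : 0 < 1 - r := by linarith
                                     positivity) htl
    have hkt : |(k : ℝ)| * -Real.log r ≤ c₀ * t := by
      rw [ht, mul_comm (-Real.log r), ← mul_assoc]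
      refine mul_le_mul_of_nonneg_right ?_ (neg_nonneg.2 (Real.log_nonpos hr0.le hr1.le))
      rw [hc₀, one_div, inv_pow, div_mul_eq_mul_div, le_div_iff₀ (by norm_num), ← div_eq_inv_mul,
        le_div_iff₀ (by positivity)]
      linarith
    have hmul := ((hC t ht0 ((2 : ℝ) ^ (-(j : ℤ)))).mul a).const_mul ((L ^ k * (r ^ k)⁻¹ : ℝ) : ℂ)
    refine ⟨_, hmul.mono ?_, fun m => ?_⟩
    · have h1 : ‖((L ^ k * (r ^ k)⁻¹ : ℝ) : ℂ)‖ ≤ L ^ k * Real.exp (c₀ * t) := by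
        rw [Complex.norm_real, Real.norm_of_nonneg (by positivity)]
        refine mul_le_mul_of_nonneg_left ?_ (by positivity)
        rw [← zpow_neg, ← Real.rpow_intCast, Real.rpow_def_of_pos hr0, Real.exp_le_exp]
        refine le_trans ?_ hkt
        push_cast
        have h0 : 0 ≤ -Real.log r := neg_nonneg.2 (Real.log_nonpos hr0.le hr1.le)
        have := mul_le_mul_of_nonneg_right (le_abs_self (k : ℝ)) h0
        linarith
      calc _ ≤ L ^ k * Real.exp (c₀ * t) * (C * Real.exp (-((1 / 4) ^ γ / 2 * t)) * K1) := by
            gcongr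
        _ = C * K1 * L ^ k * (Real.exp (c₀ * t) * Real.exp (-((1 / 4) ^ γ / 2 * t))) := by ring
        _ = C * K1 * L ^ k * Real.exp (-(c₀ * t)) := by
            rw [← Real.exp_add]
            congr 2
            rw [hc₀]
            ring
        _ ≤ max (C * K1) (K2 * (M ^ |k| * Real.exp (c₀ * M))) * L ^ k *
              Real.exp (-(c₀ * (L * (1 - r)))) := by
            have h2 : Real.exp (-(c₀ * t)) ≤ Real.exp (-(c₀ * (L * (1 - r)))) := by
              rw [Real.exp_le_exp]
              have := mul_le_mul_of_nonneg_left htl hc₀0.le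
              linarith
            have h3 := le_max_left (C * K1) (K2 * (M ^ |k| * Real.exp (c₀ * M)))
            have h4 : 0 ≤ C * K1 := by positivity
            gcongr
    · by_cases h0 : φ (dyadicPoint j m) = 0
      · simp [h0]
      · congr 1
        obtain ⟨hm, hm'⟩ := hφ.norm_bounds h0
        have hu : (1 / 2) ^ γ ≤ ‖dyadicPoint j m‖ ^ γ := pow_le_pow_left₀ (by norm_num) hm γ
        have hlam : (k : ℝ) ≤ latticeNorm m ^ γ := by
          rw [latticeNorm_pow_eq γ j]
          have h1 : L * (1 / 2) ^ γ ≤ L * ‖dyadicPoint j m‖ ^ γ :=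
            mul_le_mul_of_nonneg_left hu hL0.le
          have h2 : |(k : ℝ)| ≤ L * (1 / 2) ^ γ := by
            rw [one_div, inv_pow, ← div_eq_mul_inv, le_div_iff₀ (by positivity)]
            have h3 : (2 : ℝ) ^ γ ≤ 4 ^ γ := pow_le_pow_left₀ (by norm_num) (by norm_num) γ
            have h4 : |(k : ℝ)| * 2 ^ γ ≤ |(k : ℝ)| * 4 ^ γ :=
              mul_le_mul_of_nonneg_left h3 (abs_nonneg _)
            have h5 : 0 ≤ |(k : ℝ)| * 4 ^ γ := by positivity
            linarith
          exact (le_abs_self _).trans (h2.trans h1)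
        obtain ⟨e1, -⟩ := e m (by linarith) (by linarith)
        rw [← hL] at e1
        have e3 := (hηζ (dyadicPoint j m) (by linarith) (by linarith)).1
        have e4 : r ^ (latticeNorm m ^ γ - k) =
            Real.exp (-t * ‖dyadicPoint j m‖ ^ γ) * (r ^ k)⁻¹ := by
          rw [latticeNorm_pow_eq γ j]
          exact rpow_sub_eq_exp hr0 L _ k
        rw [radialSymbol_of_le hlam, e4]
        change ((L ^ k * (r ^ k)⁻¹ : ℝ) : ℂ) * (((χ (dyadicPoint j m) *
          Real.exp (-t * η (dyadicPoint j m)) : ℝ) : ℂ) * q m) = _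
        rw [e3, hχ1 _ hm hm', Complex.ofReal_mul (diffFactor _ _), e1]
        push_cast
        ring
  -- For `j < J` only the finite set `S` of frequencies occurs and the symbol is bounded uniformly
  -- in `r`. The factors `M^{|k|}` and `e^{c₀M}` compensate for `L^k` and the exponential, since `1
  -- ≤ L ≤ M` and `0 < 1 - r < 1`.
  · refine ⟨_, (hB fun m => radialSymbol γ k r m).mono ?_, fun m => ?_⟩
    · have h1 : ∑ m ∈ S, ‖(radialSymbol γ k r m : ℂ)‖ * B m ≤ K2 := by
        refine Finset.sum_le_sum fun m _ => mul_le_mul_of_nonneg_right ?_ (hB0 m)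
        rw [Complex.norm_real, Real.norm_of_nonneg (radialSymbol_nonneg γ k hr0.le m)]
        exact radialSymbol_le γ k hr0.le hr1.le m
      have hLM : L ≤ M := pow_le_pow_right₀ (by norm_num) (Nat.mul_le_mul_left γ hj.le)
      have h2 : 1 ≤ M ^ |k| * L ^ k := by
        calc (1 : ℝ) = M ^ |k| * M ^ (-|k|) := by
              rw [← zpow_add₀ (by linarith : M ≠ 0), add_neg_cancel, zpow_zero]
          _ ≤ M ^ |k| * L ^ (-|k|) := by
              refine mul_le_mul_of_nonneg_left ?_ (by positivity)
              rw [zpow_neg, zpow_neg]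
              exact inv_anti₀ (by positivity)
                (zpow_le_zpow_left₀ (abs_nonneg k) hL0.le hLM)
          _ ≤ M ^ |k| * L ^ k := by
              refine mul_le_mul_of_nonneg_left ?_ (by positivity)
              exact zpow_le_zpow_right₀ hL1 (neg_abs_le k)
      have h3 : 1 ≤ Real.exp (c₀ * M) * Real.exp (-(c₀ * (L * (1 - r)))) := by
        rw [← Real.exp_add, Real.one_le_exp_iff]
        have : L * (1 - r) ≤ M := by nlinarith
        have := mul_le_mul_of_nonneg_left this hc₀0.le
        linarith
      calc _ ≤ K2 * 1 := by rw [mul_one]; exact h1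
        _ ≤ K2 * ((M ^ |k| * L ^ k) * (Real.exp (c₀ * M) * Real.exp (-(c₀ * (L * (1 - r)))))) :=
            mul_le_mul_of_nonneg_left (one_le_mul_of_one_le_of_one_le h2 h3) hK20
        _ = K2 * (M ^ |k| * Real.exp (c₀ * M)) * L ^ k * Real.exp (-(c₀ * (L * (1 - r)))) := by
            ring
        _ ≤ _ := by
            have := le_max_right (C * K1) (K2 * (M ^ |k| * Real.exp (c₀ * M)))
            gcongr
    · by_cases h0 : φ (dyadicPoint j m) = 0
      · simp [h0]
      · congr 1
        refine if_pos ?_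
        have hm := (hφ.norm_bounds h0).2
        rw [norm_dyadicPoint, div_le_iff₀ (by positivity)] at hm
        have h2 : (2 : ℝ) ^ j ≤ 2 ^ J := pow_le_pow_right₀ (by norm_num) hj.le
        simp only [S, Set.Finite.mem_toFinset, mem_ofPred_eq]
        linarith

end QTorus

namespace QTorus

open Filter Topology

variable {d : ℕ}

/-! ### Growth of the Fourier coefficients of distributions -/

theorem abs_apply_le_latticeNorm (m : Fin d → ℤ) (j : Fin d) : |(m j : ℝ)| ≤ latticeNorm m := by
  have h1 : ‖latticePoint m j‖ ≤ ‖latticePoint m‖ := PiLp.norm_apply_le _ j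
  exact h1

theorem latticeNorm_neg (m : Fin d → ℤ) : latticeNorm (-m) = latticeNorm m := by
  have : latticePoint (-m) = -latticePoint m := by ext; simp [latticePoint]
  rw [latticeNorm, this, norm_neg, latticeNorm]

theorem summable_one_add_latticeNorm (d : ℕ) :
    Summable fun m : Fin d → ℤ => ((1 + latticeNorm m) ^ (2 * d))⁻¹ := by
  classical
  have hf : Summable fun n : ℤ => (1 + (n : ℝ) ^ 2)⁻¹ := by
    refine Summable.of_norm_bounded_eventually
      (g := fun n : ℤ => 1 / (n : ℝ) ^ 2) (Real.summable_one_div_int_pow.2 one_lt_two) ?_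
    refine (eventually_cofinite_ne (0 : ℤ)).mono fun n hn => ?_
    have h0 : (0 : ℝ) < (n : ℝ) ^ 2 := by
      have : (n : ℝ) ≠ 0 := by exact_mod_cast hn
      positivity
    rw [Real.norm_of_nonneg (by positivity), one_div]
    exact inv_anti₀ h0 (by linarith)
  have hF : Summable fun m : Fin d → ℤ => ∏ j, (1 + (m j : ℝ) ^ 2)⁻¹ := by
    refine summable_of_sum_le (c := (∑' n : ℤ, (1 + (n : ℝ) ^ 2)⁻¹) ^ d)
      (fun m => by positivity) fun s => ?_
    calc ∑ m ∈ s, ∏ j, (1 + (m j : ℝ) ^ 2)⁻¹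
        ≤ ∑ m ∈ Fintype.piFinset fun j => s.image fun m : Fin d → ℤ => m j, ∏ j, (1 + (m j : ℝ) ^ 2)⁻¹ := by
          refine Finset.sum_le_sum_of_subset_of_nonneg (fun m hm => ?_) fun m _ _ =>
            Finset.prod_nonneg fun j _ => by positivity
          exact Fintype.mem_piFinset.2 fun j => Finset.mem_image_of_mem (fun m => m j) hm
      _ = ∏ j, ∑ n ∈ s.image fun m : Fin d → ℤ => m j, (1 + (n : ℝ) ^ 2)⁻¹ := by
          rw [Finset.prod_univ_sum]
      _ ≤ ∏ _j : Fin d, ∑' n : ℤ, (1 + (n : ℝ) ^ 2)⁻¹ :=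
          Finset.prod_le_prod (fun j _ => Finset.sum_nonneg fun n _ => by positivity)
            fun j _ => hf.sum_le_tsum _ fun n _ => by positivity
      _ = _ := by simp
  refine Summable.of_nonneg_of_le (fun m => ?_) (fun m => ?_) hF
  · have := latticeNorm_nonneg m
    positivity
  · have h0 := latticeNorm_nonneg m
    rw [Finset.prod_inv_distrib]
    refine inv_anti₀ (Finset.prod_pos fun j _ => by positivity) ?_
    calc ∏ j, (1 + (m j : ℝ) ^ 2) ≤ ∏ _j : Fin d, (1 + latticeNorm m) ^ 2 := by
          refine Finset.prod_le_prod (fun j _ => by positivity) fun j _ => ?_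
          have h1 := abs_apply_le_latticeNorm m j
          have h2 : (m j : ℝ) ^ 2 ≤ latticeNorm m ^ 2 := sq_le_sq' (by
            have := neg_abs_le (m j : ℝ); linarith) ((le_abs_self _).trans h1)
          nlinarith
      _ = _ := by simp [pow_mul]

/-- The exponential series gives `r^s ≤ C (1+s)^{-n}` for every `n`; taking `n = N + 2d` leaves a
summable power. -/
theorem summable_latticeNorm_pow_mul_rpow (d N : ℕ) {r : ℝ} (hr0 : 0 < r) (hr1 : r < 1) :
    Summable fun m : Fin d → ℤ => (1 + latticeNorm m) ^ N * r ^ latticeNorm m := by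
  set c := -Real.log r with hc
  have hc0 : 0 < c := neg_pos.2 (Real.log_neg hr0 hr1)
  set n := N + 2 * d
  refine Summable.of_nonneg_of_le (fun m => ?_) (fun m => ?_)
    ((summable_one_add_latticeNorm d).mul_left (n.factorial * Real.exp c / c ^ n))
  · have := latticeNorm_nonneg m
    positivity
  · have h0 := latticeNorm_nonneg m
    have h1 : r ^ latticeNorm m = Real.exp c * (Real.exp (c * (1 + latticeNorm m)))⁻¹ := by
      rw [← Real.exp_neg, ← Real.exp_add, Real.rpow_def_of_pos hr0, hc]
      ring_nf
    have h2 := Real.pow_div_factorial_le_exp (c * (1 + latticeNorm m)) (by positivity) n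
    have h3 : (Real.exp (c * (1 + latticeNorm m)))⁻¹ ≤
        n.factorial / (c ^ n * (1 + latticeNorm m) ^ n) := by
      rw [← mul_pow, ← inv_div]
      exact inv_anti₀ (by positivity) h2
    rw [h1]
    calc (1 + latticeNorm m) ^ N * (Real.exp c * (Real.exp (c * (1 + latticeNorm m)))⁻¹)
        ≤ (1 + latticeNorm m) ^ N *
            (Real.exp c * (n.factorial / (c ^ n * (1 + latticeNorm m) ^ n))) := by gcongr
      _ = _ := by
          have : (1 + latticeNorm m) ≠ 0 := by positivity
          simp only [n, pow_add]
          field_simp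

theorem partialDeriv_smul_starMonomial (θ : Matrix (Fin d) (Fin d) ℝ) (b : Fin d → ℕ) (c : ℂ)
    (m : Fin d → ℤ) : partialDeriv θ b (c • starMonomial θ m) =
      ((∏ j, (2 * Real.pi * Complex.I * ((-m) j : ℤ)) ^ b j) * (c * Circle.exp (phase θ m m))) •
        monomial θ (-m) := by
  classical
  have h : HasSum (fun n => (Pi.single (-m) (c * Circle.exp (phase θ m m)) : (Fin d → ℤ) → ℂ) n •
      monomial θ n) (Smooth.toOp (c • starMonomial θ m)) := by
    have h1 : Smooth.toOp (c • starMonomial θ m) =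
        (c * Circle.exp (phase θ m m)) • monomial θ (-m) := by
      rw [map_smul, mul_smul, ← star_monomial]
      rfl
    rw [h1]
    convert hasSum_single (-m) ?_ using 1
    · simp
    · intro n hn
      simp [hn]
  simp only [partialDeriv, opCoeff_eq θ h]
  rw [tsum_eq_single (-m)]
  · simp
  · intro n hn
    simp [hn]

theorem norm_partialDeriv_smul_starMonomial_le (θ : Matrix (Fin d) (Fin d) ℝ) (b : Fin d → ℕ)
    (c : ℂ) (m : Fin d → ℤ) : ‖partialDeriv θ b (c • starMonomial θ m)‖ ≤
      (2 * Real.pi) ^ (∑ j, b j) * (1 + latticeNorm m) ^ (∑ j, b j) * ‖c‖ := by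
  rw [partialDeriv_smul_starMonomial, norm_smul, norm_monomial, mul_one, norm_mul, norm_mul,
    Circle.norm_coe, mul_one, ← mul_pow, norm_prod, ← Finset.prod_pow_eq_pow_sum]
  refine mul_le_mul_of_nonneg_right (Finset.prod_le_prod (fun _ _ => norm_nonneg _) fun j _ => ?_)
    (norm_nonneg c)
  rw [norm_pow]
  refine pow_le_pow_left₀ (norm_nonneg _) ?_ _
  have := abs_apply_le_latticeNorm (-m) j
  rw [latticeNorm_neg] at this
  rw [norm_mul, norm_mul, norm_mul, Complex.norm_I, Complex.norm_real, Complex.norm_intCast,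
    Real.norm_of_nonneg Real.pi_pos.le, mul_one]
  norm_num
  have hpi := Real.pi_pos
  rw [← abs_neg, ← Int.cast_neg]
  exact mul_le_mul_of_nonneg_left (this.trans (by linarith)) (by positivity)

theorem tendsto_smooth_zero {θ : Matrix (Fin d) (Fin d) ℝ} {ι : Type*} {f : Filter ι}
    {y : ι → Smooth θ} (h : ∀ b, Tendsto (fun i => partialDeriv θ b (y i)) f (𝓝 0)) :
    Tendsto y f (𝓝 0) := by
  have h0 : ∀ b, partialDeriv θ b 0 = 0 := by
    intro b
    have := partialDeriv_smul_starMonomial θ b 0 0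
    rwa [zero_smul, zero_mul, mul_zero, zero_smul] at this
  rw [nhds_iInf, tendsto_iInf]
  intro b
  rw [nhds_induced, tendsto_comap_iff, h0]
  exact h b

/-- If no polynomial bound held, suitable multiples of monomials would tend to `0` in the smooth
topology while the continuous functional takes the value `1` on each of them. -/
theorem exists_norm_coeff_le {θ : Matrix (Fin d) (Fin d) ℝ} (x : Distribution θ) :
    ∃ (C : ℝ) (N : ℕ), ∀ m, ‖coeff x m‖ ≤ C * (1 + latticeNorm m) ^ N := by
  by_contra! hcon
  -- The order `N` and the constant `N + 1` grow together. The power eventually beats any fixed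
  -- derivative `D^b`, and the constant forces the quotient to tend to `0`.
  choose m hm using fun N : ℕ => hcon (N + 1) N
  have hpos : ∀ N : ℕ, (0 : ℝ) < ((N : ℝ) + 1) * (1 + latticeNorm (m N)) ^ N := fun N => by
    have := latticeNorm_nonneg (m N)
    positivity
  have hne : ∀ N, coeff x (m N) ≠ 0 := fun N => norm_pos_iff.1 ((hpos N).trans (hm N))
  have hy : Tendsto (fun N => (coeff x (m N))⁻¹ • starMonomial θ (m N)) atTop (𝓝 0) := by
    refine tendsto_smooth_zero fun b => ?_
    have hlim : Tendsto (fun N : ℕ => (2 * Real.pi) ^ (∑ j, b j) * (1 / ((N : ℝ) + 1))) atTop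
        (𝓝 0) := by
      simpa using (tendsto_one_div_add_atTop_nhds_zero_nat (𝕜 := ℝ)).const_mul
        ((2 * Real.pi) ^ (∑ j, b j))
    refine squeeze_zero_norm' ?_ hlim
    filter_upwards [eventually_ge_atTop (∑ j, b j)] with N hN
    refine (norm_partialDeriv_smul_starMonomial_le θ b _ _).trans ?_
    rw [mul_assoc]
    refine mul_le_mul_of_nonneg_left ?_ (by positivity)
    have h0 := latticeNorm_nonneg (m N)
    rw [norm_inv, ← div_eq_mul_inv, div_le_div_iff₀ (norm_pos_iff.2 (hne N)) (by positivity)]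
    have h1 : (1 + latticeNorm (m N)) ^ (∑ j, b j) ≤ (1 + latticeNorm (m N)) ^ N :=
      pow_le_pow_right₀ (by linarith) hN
    have := (hm N).le
    nlinarith [hpos N]
  have h1 := (x.continuous.tendsto 0).comp hy
  rw [map_zero] at h1
  have h2 : (x ∘ fun N => (coeff x (m N))⁻¹ • starMonomial θ (m N)) = fun _ => 1 := by
    funext N
    rw [Function.comp_apply, map_smul, smul_eq_mul]
    exact inv_mul_cancel₀ (hne N)
  rw [h2] at h1
  exact one_ne_zero (tendsto_nhds_unique tendsto_const_nhds h1)

theorem abs_diffFactor_le {s : ℝ} {k : ℤ} (hs : 0 ≤ s) (h : k ≤ s) :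
    |diffFactor s k| ≤ (1 + s) ^ k.toNat := by
  rw [abs_of_pos (diffFactor_pos hs h)]
  unfold diffFactor
  split_ifs with hk
  · calc ∏ i ∈ Finset.range k.toNat, (s - i) ≤ ∏ _i ∈ Finset.range k.toNat, (1 + s) := by
          refine Finset.prod_le_prod (fun i hi => ?_) fun i _ => ?_
          · have h1 : (i : ℤ) < k := by
              have := Finset.mem_range.1 hi
              lia
            have h2 : ((i : ℤ) : ℝ) < k := by exact_mod_cast h1
            push_cast at h2
            linarith
          · have : (0 : ℝ) ≤ i := Nat.cast_nonneg i
            linarith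
      _ = _ := by simp
  · refine (div_le_one (Finset.prod_pos fun i _ => by positivity)).2 ?_ |>.trans
      (one_le_pow₀ (by linarith))
    calc (1 : ℝ) = ∏ _i ∈ Finset.range (-k).toNat, 1 := by simp
      _ ≤ _ := Finset.prod_le_prod (fun _ _ => zero_le_one) fun i _ => by
          have : (0 : ℝ) ≤ i := Nat.cast_nonneg i
          linarith

/-- Absolute convergence makes `series` a genuine sum, so that multiplier bounds extend to it from
polynomials. Nonzero lattice points have norm at least `1`, so `|m|^γ ≥ |m|` and the Poisson decay
suffices for all `γ`. -/
theorem summable_radialSymbol_mul {γ : ℕ} (hγ : 1 ≤ γ) (k : ℤ) {r : ℝ} (hr0 : 0 < r)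
    (hr1 : r < 1) {θ : Matrix (Fin d) (Fin d) ℝ} (x : Distribution θ) :
    Summable fun m => ‖(radialSymbol γ k r m : ℂ) * coeff x m‖ := by
  obtain ⟨C, N, hC⟩ := exists_norm_coeff_le x
  refine Summable.of_nonneg_of_le (fun m => norm_nonneg _) (fun m => ?_)
    ((summable_latticeNorm_pow_mul_rpow d (γ * k.toNat + N) hr0 hr1).mul_left (C * (r ^ k)⁻¹))
  have h0 := latticeNorm_nonneg m
  have hC0 : 0 ≤ C * (1 + latticeNorm m) ^ N := (norm_nonneg _).trans (hC m)
  rw [norm_mul, Complex.norm_real, Real.norm_of_nonneg (radialSymbol_nonneg γ k hr0.le m)]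
  have hR : 0 ≤ C * (r ^ k)⁻¹ *
      ((1 + latticeNorm m) ^ (γ * k.toNat + N) * r ^ latticeNorm m) := by
    rw [pow_add]
    have : 0 ≤ (r ^ k)⁻¹ * (1 + latticeNorm m) ^ (γ * k.toNat) * r ^ latticeNorm m := by positivity
    nlinarith [mul_nonneg hC0 this]
  rcases lt_or_ge (latticeNorm m ^ γ) (k : ℝ) with h | h
  · rw [radialSymbol, if_pos h, zero_mul]
    exact hR
  · rw [radialSymbol_of_le h]
    have h1 : diffFactor (latticeNorm m ^ γ) k ≤ (1 + latticeNorm m) ^ (γ * k.toNat) := by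
      refine (le_abs_self _).trans ((abs_diffFactor_le (by positivity) h).trans ?_)
      rw [pow_mul]
      refine pow_le_pow_left₀ (by positivity) ?_ _
      have := pow_add_pow_le (zero_le_one (α := ℝ)) h0 (show γ ≠ 0 by lia)
      simpa using this
    have h2 : r ^ (latticeNorm m ^ γ - k) ≤ (r ^ k)⁻¹ * r ^ latticeNorm m := by
      rw [Real.rpow_sub hr0, Real.rpow_intCast, div_eq_mul_inv, mul_comm]
      refine mul_le_mul_of_nonneg_left ?_ (by positivity)
      refine Real.rpow_le_rpow_of_exponent_ge hr0 hr1.le ?_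
      by_cases hm : m = 0
      · simp [hm, latticeNorm_zero, show γ ≠ 0 by lia]
      · exact le_self_pow₀ (one_le_latticeNorm hm) (by lia)
    calc _ ≤ (1 + latticeNorm m) ^ (γ * k.toNat) * ((r ^ k)⁻¹ * r ^ latticeNorm m) *
          (C * (1 + latticeNorm m) ^ N) := by
          gcongr
          exact hC m
      _ = _ := by rw [pow_add]; ring

/-! ### The Poisson and heat expressions in terms of one radial symbol -/

theorem opCoeff_monomial (θ : Matrix (Fin d) (Fin d) ℝ) (m n : Fin d → ℤ) :
    opCoeff θ (monomial θ m) n = if n = m then 1 else 0 := by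
  classical
  have h : HasSum (fun l => (Pi.single m 1 : (Fin d → ℤ) → ℂ) l • monomial θ l) (monomial θ m) := by
    convert hasSum_single m ?_ using 1
    · simp
    · intro n hn
      simp [hn]
  rw [opCoeff_eq θ h, Pi.single_apply]

theorem coeff_toDistribution_monomial (θ : Matrix (Fin d) (Fin d) ℝ) (m n : Fin d → ℤ) :
    coeff (toDistribution θ (monomial θ m)) n = if n = m then 1 else 0 := by
  rw [← opCoeff_monomial θ m n]
  have h1 : coeff (toDistribution θ (monomial θ m)) n =
    trace (monomial θ m * star (monomial θ n)) := rfl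
  rw [h1, opCoeff, star_monomial, mul_smul_comm, smul_mul_assoc, ← traceL_apply, ← traceL_apply,
    map_smul, map_smul, traceL_apply, traceL_apply, trace_monomial_mul_comm]

theorem coeff_tail (k : ℤ) {θ : Matrix (Fin d) (Fin d) ℝ} (x : Distribution θ) (m : Fin d → ℤ) :
    coeff (tail k x) m = if latticeNorm m < k then 0 else coeff x m := by
  classical
  have hfin : {m : Fin d → ℤ | latticeNorm m < k}.Finite :=
    (finite_latticeNorm_le d k).subset fun m (hm : latticeNorm m < k) => hm.le
  rw [tail, finsum_mem_eq_finite_toFinset_sum _ hfin]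
  have h1 : ∀ y z : Distribution θ, coeff (y - z) m = coeff y m - coeff z m := fun y z => rfl
  have h2 : ∀ (s : Finset (Fin d → ℤ)) (f : (Fin d → ℤ) → Distribution θ),
      coeff (∑ n ∈ s, f n) m = ∑ n ∈ s, coeff (f n) m := fun s f => by
    simp [coeff]
  have h3 : ∀ (c : ℂ) (y : Distribution θ), coeff (c • y) m = c * coeff y m := fun c y => rfl
  rw [h1, h2]
  simp only [h3, coeff_toDistribution_monomial]
  simp only [mul_ite, mul_one, mul_zero, Finset.sum_ite_eq, Set.Finite.mem_toFinset,
    mem_ofPred_eq]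
  split_ifs <;> simp

theorem poissonJ_tail (k : ℤ) (r : ℝ) {θ : Matrix (Fin d) (Fin d) ℝ} (x : Distribution θ) :
    poissonJ k r (tail k x) = series θ fun m => (radialSymbol 1 k r m : ℂ) * coeff x m := by
  unfold poissonJ
  congr 1
  funext m
  rw [coeff_tail, radialSymbol, pow_one]
  split_ifs <;> simp

theorem latticeNorm_sq (m : Fin d → ℤ) : latticeNorm m ^ 2 = ((∑ j, (m j).natAbs ^ 2 : ℕ) : ℝ) := by
  rw [latticeNorm, EuclideanSpace.norm_sq_eq]
  push_cast
  refine Finset.sum_congr rfl fun j _ => ?_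
  simp [latticePoint, Nat.cast_natAbs]

theorem diffFactor_eq_zero {n : ℕ} {k : ℤ} (h : (n : ℤ) < k) : diffFactor n k = 0 := by
  rw [diffFactor, if_pos (by lia)]
  exact Finset.prod_eq_zero (Finset.mem_range.2 (show n < k.toNat by lia)) (sub_self _)

/-- Since `|m|²` is an integer, the product defining the factor contains a zero whenever `|m|² < k`.
Hence no part of `x` has to be subtracted, unlike in the Poisson case, where `|m|` may be
irrational. -/
theorem heatJ_eq (k : ℤ) (r : ℝ) {θ : Matrix (Fin d) (Fin d) ℝ} (x : Distribution θ) :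
    heatJ k r x = series θ fun m => (radialSymbol 2 k r m : ℂ) * coeff x m := by
  unfold heatJ
  congr 1
  funext m
  rw [radialSymbol]
  split_ifs with h
  · rw [latticeNorm_sq] at h ⊢
    have h' : (((∑ j, (m j).natAbs ^ 2 : ℕ) : ℤ) : ℝ) < k := by
      rwa [Int.cast_natCast]
    rw [diffFactor_eq_zero (by exact_mod_cast h'), zero_mul]
  · rfl

theorem lpPiece_eq (φ : SchwartzMap (EuclideanSpace ℝ (Fin d)) ℝ)
    {θ : Matrix (Fin d) (Fin d) ℝ} (x : Distribution θ) (j : ℕ) :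
    lpPiece φ x j = series θ fun m => (φ (dyadicPoint j m) : ℂ) * coeff x m := rfl

end QTorus

namespace QTorus

open Filter Topology

/-! ### Sequence norms and radial norms -/

/-- The `ℓ_q`-norm of a sequence. -/
def seqLq (q : ℝ≥0∞) (b : ℕ → ℝ≥0∞) : ℝ≥0∞ :=
  if q = ∞ then ⨆ j, b j else (∑' j, b j ^ q.toReal) ^ (1 / q.toReal)

/-- The `L_q`-norm with respect to the measure `dr / (1 - r)` on `(0, 1)`. -/
def radialLq (q : ℝ≥0∞) (g : ℝ → ℝ≥0∞) : ℝ≥0∞ :=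
  if q = ∞ then essSup g (volume.restrict (Ioo 0 1))
  else (∫⁻ r in Ioo (0 : ℝ) 1, g r ^ q.toReal * ENNReal.ofReal (1 / (1 - r))) ^ (1 / q.toReal)

theorem rpow_rpow_one_div {t : ℝ} (ht : 0 < t) (a : ℝ≥0∞) : (a ^ t) ^ (1 / t) = a := by
  rw [← ENNReal.rpow_mul, mul_one_div_cancel ht.ne', ENNReal.rpow_one]

theorem add_rpow_one_div_le {t : ℝ} (ht : 1 ≤ t) (a x : ℝ≥0∞) :
    (a ^ t + x) ^ (1 / t) ≤ a + x ^ (1 / t) := by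
  refine (ENNReal.rpow_add_le_add_rpow _ _ (by positivity) ((div_le_one (by linarith)).2 ht)).trans ?_
  rw [rpow_rpow_one_div (by linarith)]

theorem le_add_rpow_one_div {t : ℝ} (ht : 1 ≤ t) (a x : ℝ≥0∞) : a ≤ (a ^ t + x) ^ (1 / t) := by
  conv_lhs => rw [← rpow_rpow_one_div (by linarith : 0 < t) a]
  exact ENNReal.rpow_le_rpow le_self_add (by positivity)

theorem rpow_one_div_le_add {t : ℝ} (ht : 1 ≤ t) (a x : ℝ≥0∞) :
    x ^ (1 / t) ≤ (a ^ t + x) ^ (1 / t) :=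
  ENNReal.rpow_le_rpow le_add_self (by positivity)

theorem radialNorm_le_add {q : ℝ≥0∞} (hq : 1 ≤ q) (a : ℝ≥0∞) (g : ℝ → ℝ≥0∞) :
    radialNorm q a g ≤ a + radialLq q g := by
  unfold radialNorm radialLq
  split_ifs with h
  · exact max_le le_self_add le_add_self
  · exact add_rpow_one_div_le (one_le_toReal hq h) _ _

theorem le_radialNorm {q : ℝ≥0∞} (hq : 1 ≤ q) (a : ℝ≥0∞) (g : ℝ → ℝ≥0∞) :
    a ≤ radialNorm q a g := by
  unfold radialNorm
  split_ifs with h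
  · exact le_max_left _ _
  · exact le_add_rpow_one_div (one_le_toReal hq h) _ _

theorem radialLq_le_radialNorm {q : ℝ≥0∞} (hq : 1 ≤ q) (a : ℝ≥0∞) (g : ℝ → ℝ≥0∞) :
    radialLq q g ≤ radialNorm q a g := by
  unfold radialNorm radialLq
  split_ifs with h
  · exact le_max_right _ _
  · exact rpow_one_div_le_add (one_le_toReal hq h) _ _

section Besov

variable {d : ℕ} {θ : Matrix (Fin d) (Fin d) ℝ} (φ : SchwartzMap (EuclideanSpace ℝ (Fin d)) ℝ)
  (α : ℝ) (p : ℝ≥0∞) {q : ℝ≥0∞} (x : Distribution θ)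

/-- The sequence of the weighted norms of the Littlewood-Paley pieces. -/
def lpSeq (j : ℕ) : ℝ≥0∞ :=
  ENNReal.ofReal ((2 : ℝ) ^ (j * α) * torusLpNorm p (lpPiece φ x j))

theorem besovNorm_le_add (hq : 1 ≤ q) :
    besovNorm φ α p q x ≤ ‖coeff x 0‖ₑ + seqLq q (lpSeq φ α p x) := by
  unfold besovNorm seqLq
  split_ifs with h
  · exact max_le le_self_add le_add_self
  · exact add_rpow_one_div_le (one_le_toReal hq h) _ _

theorem le_besovNorm (hq : 1 ≤ q) : ‖coeff x 0‖ₑ ≤ besovNorm φ α p q x := by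
  unfold besovNorm
  split_ifs with h
  · exact le_max_left _ _
  · exact le_add_rpow_one_div (one_le_toReal hq h) _ _

theorem seqLq_le_besovNorm (hq : 1 ≤ q) : seqLq q (lpSeq φ α p x) ≤ besovNorm φ α p q x := by
  unfold besovNorm seqLq
  split_ifs with h
  · exact le_max_right _ _
  · exact rpow_one_div_le_add (one_le_toReal hq h) _ _

end Besov

theorem le_seqLq {q : ℝ≥0∞} (hq : 1 ≤ q) (b : ℕ → ℝ≥0∞) (j : ℕ) : b j ≤ seqLq q b := by
  unfold seqLq
  split_ifs with h
  · exact le_iSup b j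
  · have ht := one_le_toReal hq h
    conv_lhs => rw [← rpow_rpow_one_div (by linarith : 0 < q.toReal) (b j)]
    exact ENNReal.rpow_le_rpow (ENNReal.le_tsum j) (by positivity)

/-- This replaces constants of the form `n^{1/q}` by ones that do not depend on `q`. -/
theorem natCast_rpow_one_div_le {t : ℝ} (ht : 1 ≤ t) (n : ℕ) :
    (n : ℝ≥0∞) ^ (1 / t) ≤ n := by
  rcases Nat.eq_zero_or_pos n with rfl | hn
  · simp [ENNReal.zero_rpow_of_pos (show 0 < t⁻¹ by positivity)]
  · conv_rhs => rw [← ENNReal.rpow_one (n : ℝ≥0∞)]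
    exact ENNReal.rpow_le_rpow_of_exponent_le (by exact_mod_cast hn)
      ((div_le_one (by linarith)).2 ht)

/-- The first terms of a sequence can be estimated separately. -/
theorem seqLq_le_add {q : ℝ≥0∞} (hq : 1 ≤ q) {b : ℕ → ℝ≥0∞} {J : ℕ} {M : ℝ≥0∞}
    (h : ∀ j < J, b j ≤ M) :
    seqLq q b ≤ J * M + seqLq q fun j => if j < J then 0 else b j := by
  unfold seqLq
  split_ifs with hqt
  · refine iSup_le fun j => ?_
    rcases lt_or_ge j J with hj | hj
    · refine le_trans ?_ le_self_add
      refine (h j hj).trans (le_mul_of_one_le_left zero_le ?_)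
      exact_mod_cast (by lia : 1 ≤ J)
    · refine le_trans ?_ le_add_self
      refine le_trans ?_ (le_iSup _ j)
      simp [not_lt.2 hj]
  · have ht := one_le_toReal hq hqt
    set t := q.toReal
    have h1 : ∑' j, b j ^ t ≤ J * M ^ t + ∑' j, (if j < J then 0 else b j) ^ t := by
      calc ∑' j, b j ^ t ≤ ∑' j, ((if j ∈ Finset.range J then M ^ t else 0) +
            (if j < J then 0 else b j) ^ t) := by
            refine ENNReal.tsum_le_tsum fun j => ?_
            by_cases hj : j < J
            · rw [if_pos (Finset.mem_range.2 hj)]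
              exact (ENNReal.rpow_le_rpow (h j hj) (by positivity)).trans le_self_add
            · simp [hj]
        _ = _ := by
            rw [ENNReal.tsum_add, tsum_eq_sum (s := Finset.range J) fun j hj => if_neg hj,
              Finset.sum_congr rfl fun j hj => if_pos hj, Finset.sum_const, Finset.card_range,
              nsmul_eq_mul]
    refine (ENNReal.rpow_le_rpow h1 (by positivity)).trans ?_
    refine (ENNReal.rpow_add_le_add_rpow _ _ (by positivity)
      ((div_le_one (by linarith)).2 ht)).trans ?_
    refine add_le_add_left ?_ _
    rw [ENNReal.mul_rpow_of_nonneg _ _ (by positivity), rpow_rpow_one_div (by linarith)]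
    gcongr
    exact natCast_rpow_one_div_le ht J

theorem seqLq_mono {q : ℝ≥0∞} {b b' : ℕ → ℝ≥0∞} (h : ∀ j, b j ≤ b' j) :
    seqLq q b ≤ seqLq q b' := by
  unfold seqLq
  split_ifs
  · exact iSup_mono h
  · gcongr
    exact h _

theorem radialLq_mono {q : ℝ≥0∞} {f g : ℝ → ℝ≥0∞} (h : ∀ r ∈ Ioo (0 : ℝ) 1, f r ≤ g r) :
    radialLq q f ≤ radialLq q g := by
  unfold radialLq
  split_ifs with hqt
  · exact essSup_mono_ae ((ae_restrict_iff' measurableSet_Ioo).2 (Eventually.of_forall h))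
  · refine ENNReal.rpow_le_rpow (setLIntegral_mono' measurableSet_Ioo fun r hr => ?_)
      (by positivity)
    gcongr
    exact h r hr

theorem radialLq_const_mul {q : ℝ≥0∞} (hq : 1 ≤ q) (K : ℝ≥0) (g : ℝ → ℝ≥0∞) :
    radialLq q (fun r => K * g r) = K * radialLq q g := by
  unfold radialLq
  split_ifs with hqt
  · exact ENNReal.essSup_const_mul
  · have ht := one_le_toReal hq hqt
    simp only [ENNReal.mul_rpow_of_nonneg _ _ (by positivity : 0 ≤ q.toReal), mul_assoc]
    rw [lintegral_const_mul' _ _ (by finiteness), ENNReal.mul_rpow_of_nonneg _ _ (by positivity),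
      rpow_rpow_one_div (by linarith)]

/-- The intervals of all `r` with `1 - r` of size `2^{-γj}`. -/
def shell (γ j : ℕ) : Set ℝ := Ioo (1 - ((2 : ℝ) ^ (γ * j))⁻¹) (1 - ((2 : ℝ) ^ (γ * j))⁻¹ / 2)

theorem two_mul_two_pow_le {γ : ℕ} (hγ : 1 ≤ γ) {i j : ℕ} (h : i < j) :
    2 * (2 : ℝ) ^ (γ * i) ≤ 2 ^ (γ * j) := by
  rw [← pow_succ']
  exact pow_le_pow_right₀ (by norm_num) (by nlinarith)

theorem shell_subset (γ j : ℕ) : shell γ j ⊆ Ioo (0 : ℝ) 1 := by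
  intro r hr
  have h1 : ((2 : ℝ) ^ (γ * j))⁻¹ ≤ 1 := inv_le_one_of_one_le₀ (one_le_pow₀ (by norm_num))
  have h2 : 0 < ((2 : ℝ) ^ (γ * j))⁻¹ := by positivity
  exact ⟨by linarith [hr.1], by linarith [hr.2]⟩

theorem pairwise_disjoint_shell {γ : ℕ} (hγ : 1 ≤ γ) : Pairwise (Function.onFun Disjoint (shell γ)) := by
  refine (pairwise_disjoint_on _).2 fun i j hij => ?_
  refine Set.disjoint_left.2 fun r hi hj => ?_
  have h1 : ((2 : ℝ) ^ (γ * j))⁻¹ ≤ ((2 : ℝ) ^ (γ * i))⁻¹ / 2 := by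
    rw [div_eq_inv_mul, ← mul_inv]
    exact inv_anti₀ (by positivity) (two_mul_two_pow_le hγ hij)
  linarith [hi.2, hj.1]

/-- The shell has length `l/2` with `l = 2^{-γj}`, and the density `1/(1-r)` is at least `1/l` on
it. -/
theorem half_le_lintegral_shell (γ j : ℕ) :
    2⁻¹ ≤ ∫⁻ r in shell γ j, ENNReal.ofReal (1 / (1 - r)) := by
  set l : ℝ := ((2 : ℝ) ^ (γ * j))⁻¹ with hl
  have hl0 : 0 < l := by positivity
  calc (2⁻¹ : ℝ≥0∞) = ∫⁻ _r in shell γ j, ENNReal.ofReal (1 / l) := by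
        rw [setLIntegral_const, shell, Real.volume_Ioo, ← ENNReal.ofReal_mul (by positivity),
          show 1 / l * (1 - l / 2 - (1 - l)) = 2⁻¹ by field_simp; ring,
          ENNReal.ofReal_inv_of_pos (by norm_num), ENNReal.ofReal_ofNat]
    _ ≤ _ := by
        refine setLIntegral_mono' measurableSet_Ioo fun r hr => ENNReal.ofReal_le_ofReal ?_
        have h1 := hr.1
        have h2 := hr.2
        exact one_div_le_one_div_of_le (by linarith) (by linarith)

/-- A sequence that is dominated on disjoint shells by a function is dominated in norm. -/
theorem seqLq_le_radialLq {q : ℝ≥0∞} (hq : 1 ≤ q) {γ : ℕ} (hγ : 1 ≤ γ) {b : ℕ → ℝ≥0∞}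
    {g : ℝ → ℝ≥0∞} (h : ∀ j, ∀ r ∈ shell γ j, b j ≤ g r) : seqLq q b ≤ 2 * radialLq q g := by
  unfold seqLq radialLq
  split_ifs with hqt
  · refine iSup_le fun j => le_trans ?_ (le_mul_of_one_le_left zero_le one_le_two)
    by_contra hcon
    have h1 : ∀ᵐ r ∂volume.restrict (Ioo (0 : ℝ) 1), r ∉ shell γ j := by
      filter_upwards [ae_le_essSup (f := g) (μ := volume.restrict (Ioo (0 : ℝ) 1))] with r hr hr'
      exact hcon ((h j r hr').trans hr)
    have h2 : volume (shell γ j) = 0 := by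
      rw [ae_restrict_iff' measurableSet_Ioo] at h1
      refine measure_mono_null (fun r hr => ?_) (ae_iff.1 h1)
      simp only [mem_ofPred_eq, Classical.not_imp, not_not]
      exact ⟨shell_subset γ j hr, hr⟩
    have h3 := half_le_lintegral_shell γ j
    rw [setLIntegral_measure_zero _ _ h2] at h3
    simp at h3
  · have ht := one_le_toReal hq hqt
    set t := q.toReal
    have h1 : 2⁻¹ * ∑' j, b j ^ t ≤
        ∫⁻ r in Ioo (0 : ℝ) 1, g r ^ t * ENNReal.ofReal (1 / (1 - r)) := by
      calc 2⁻¹ * ∑' j, b j ^ t = ∑' j, b j ^ t * 2⁻¹ := by rw [ENNReal.tsum_mul_right, mul_comm]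
        _ ≤ ∑' j, ∫⁻ r in shell γ j, g r ^ t * ENNReal.ofReal (1 / (1 - r)) := by
            refine ENNReal.tsum_le_tsum fun j => ?_
            refine (mul_le_mul_right (half_le_lintegral_shell γ j) _).trans ?_
            rw [← lintegral_const_mul _ (by fun_prop)]
            refine setLIntegral_mono' measurableSet_Ioo fun r hr => ?_
            gcongr
            exact h j r hr
        _ = ∫⁻ r in ⋃ j, shell γ j, g r ^ t * ENNReal.ofReal (1 / (1 - r)) :=
            (lintegral_iUnion (fun _ => measurableSet_Ioo) (pairwise_disjoint_shell hγ) _).symm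
        _ ≤ _ := lintegral_mono_set (iUnion_subset fun j => shell_subset γ j)
    have h2 : ∑' j, b j ^ t ≤
        2 * ∫⁻ r in Ioo (0 : ℝ) 1, g r ^ t * ENNReal.ofReal (1 / (1 - r)) := by
      calc ∑' j, b j ^ t = 2 * (2⁻¹ * ∑' j, b j ^ t) := by
            rw [← mul_assoc, ENNReal.mul_inv_cancel (by norm_num) (by norm_num), one_mul]
        _ ≤ _ := by gcongr
    refine (ENNReal.rpow_le_rpow h2 (by positivity)).trans ?_
    rw [ENNReal.mul_rpow_of_nonneg _ _ (by positivity)]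
    gcongr
    exact_mod_cast natCast_rpow_one_div_le ht 2

/-! ### Schur's test -/

/-- Hölder's inequality with respect to the weights `w`, that is, Jensen's inequality for `s ↦ s^t`
before normalization. -/
theorem tsum_mul_rpow_le {t : ℝ} (ht : 1 ≤ t) (w b : ℕ → ℝ≥0∞) :
    (∑' j, w j * b j) ^ t ≤ (∑' j, w j) ^ (t - 1) * ∑' j, w j * b j ^ t := by
  have ht0 : 0 < t := by linarith
  have h1 : ∑' j, w j * b j ≤
      (∑' j, w j) ^ (1 - t⁻¹) * (∑' j, w j * b j ^ t) ^ t⁻¹ := by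
    rw [ENNReal.tsum_eq_iSup_sum]
    refine iSup_le fun s => (ENNReal.inner_le_weight_mul_Lp_of_nonneg s ht w b).trans ?_
    have h2 : 0 ≤ 1 - t⁻¹ := sub_nonneg.2 (inv_le_one_of_one_le₀ ht)
    gcongr
    · exact ENNReal.sum_le_tsum s
    · exact ENNReal.sum_le_tsum s
  refine (ENNReal.rpow_le_rpow h1 ht0.le).trans (le_of_eq ?_)
  rw [ENNReal.mul_rpow_of_nonneg _ _ ht0.le, ← ENNReal.rpow_mul, ← ENNReal.rpow_mul,
    inv_mul_cancel₀ ht0.ne', ENNReal.rpow_one, sub_mul, one_mul, inv_mul_cancel₀ ht0.ne']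

/-- The bound on the sums contributes `S^{t-1}` through Hölder, and the bound on the integrals
contributes one more `S` after exchanging sum and integral. The root of order `t` of `S^t` is free
of `q`. -/
theorem radialLq_tsum_le {q : ℝ≥0∞} (hq : 1 ≤ q) {K : ℕ → ℝ → ℝ≥0∞} (hK : ∀ j, Measurable (K j))
    {S : ℝ≥0} (h1 : ∀ r ∈ Ioo (0 : ℝ) 1, ∑' j, K j r ≤ S)
    (h2 : ∀ j, ∫⁻ r in Ioo (0 : ℝ) 1, K j r * ENNReal.ofReal (1 / (1 - r)) ≤ S)
    (b : ℕ → ℝ≥0∞) : radialLq q (fun r => ∑' j, K j r * b j) ≤ S * seqLq q b := by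
  unfold seqLq radialLq
  split_ifs with hqt
  · refine essSup_le_of_ae_le _ ((ae_restrict_iff' measurableSet_Ioo).2 (Eventually.of_forall
      fun r hr => ?_))
    calc ∑' j, K j r * b j ≤ ∑' j, K j r * ⨆ j, b j :=
          ENNReal.tsum_le_tsum fun j => mul_le_mul_right (le_iSup b j) _
      _ ≤ _ := by
          rw [ENNReal.tsum_mul_right]
          exact mul_le_mul_left (h1 r hr) _
  · have ht := one_le_toReal hq hqt
    set t := q.toReal
    have h3 : ∫⁻ r in Ioo (0 : ℝ) 1, (∑' j, K j r * b j) ^ t * ENNReal.ofReal (1 / (1 - r)) ≤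
        (S : ℝ≥0∞) ^ t * ∑' j, b j ^ t := by
      calc _ ≤ ∫⁻ r in Ioo (0 : ℝ) 1, (S : ℝ≥0∞) ^ (t - 1) *
            ∑' j, b j ^ t * (K j r * ENNReal.ofReal (1 / (1 - r))) := by
            refine setLIntegral_mono' measurableSet_Ioo fun r hr => ?_
            calc _ ≤ (∑' j, K j r) ^ (t - 1) * (∑' j, K j r * b j ^ t) *
                  ENNReal.ofReal (1 / (1 - r)) := by
                  gcongr
                  exact tsum_mul_rpow_le ht _ _
              _ ≤ (S : ℝ≥0∞) ^ (t - 1) * (∑' j, K j r * b j ^ t) *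
                  ENNReal.ofReal (1 / (1 - r)) := by
                  have : 0 ≤ t - 1 := by linarith
                  gcongr
                  exact h1 r hr
              _ = _ := by
                  rw [mul_assoc, ← ENNReal.tsum_mul_right]
                  congr 1
                  exact tsum_congr fun j => by ring
        _ = (S : ℝ≥0∞) ^ (t - 1) * ∑' j, b j ^ t *
              ∫⁻ r in Ioo (0 : ℝ) 1, K j r * ENNReal.ofReal (1 / (1 - r)) := by
            have hm : ∀ j, Measurable fun r => K j r * ENNReal.ofReal (1 / (1 - r)) := fun j =>
              (hK j).mul (by fun_prop)
            rw [lintegral_const_mul _ (Measurable.tsum fun j => (hm j).const_mul _),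
              lintegral_tsum fun j => ((hm j).const_mul _).aemeasurable]
            congr 1
            exact tsum_congr fun j => lintegral_const_mul _ (hm j)
        _ ≤ (S : ℝ≥0∞) ^ (t - 1) * ∑' j, b j ^ t * S := by
            gcongr with j
            exact h2 j
        _ = _ := by
            rw [ENNReal.tsum_mul_right, mul_comm (∑' j, b j ^ t), ← mul_assoc]
            congr 1
            conv_lhs => rw [← ENNReal.rpow_one (S : ℝ≥0∞), ← ENNReal.rpow_mul, one_mul]
            rw [← ENNReal.rpow_add_of_nonneg _ _ (by linarith) zero_le_one, sub_add_cancel]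
    refine (ENNReal.rpow_le_rpow h3 (by positivity)).trans (le_of_eq ?_)
    rw [ENNReal.mul_rpow_of_nonneg _ _ (by positivity), rpow_rpow_one_div (by linarith)]

/-! ### The kernel of the semigroups -/

/-- The kernel `u^κ e^{-c u}` at `u = 2^{γj} v`. -/
def decayKernel (γ : ℕ) (κ c : ℝ) (j : ℕ) (v : ℝ) : ℝ :=
  ((2 : ℝ) ^ (γ * j) * v) ^ κ * Real.exp (-(c * ((2 : ℝ) ^ (γ * j) * v)))

theorem lintegral_rpow_mul_exp {κ c : ℝ} (hκ : 0 < κ) (hc : 0 < c) :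
    ∫⁻ v in Ioi (0 : ℝ), ENNReal.ofReal (v ^ (κ - 1) * Real.exp (-(c * v))) =
      ENNReal.ofReal ((1 / c) ^ κ * Real.Gamma κ) := by
  have h := Real.integral_rpow_mul_exp_neg_mul_Ioi hκ hc
  have hpos : 0 < (1 / c) ^ κ * Real.Gamma κ := by
    have := Real.Gamma_pos_of_pos hκ
    positivity
  have hi : IntegrableOn (fun v : ℝ => v ^ (κ - 1) * Real.exp (-(c * v))) (Ioi 0) :=
    Integrable.of_integral_ne_zero (h ▸ hpos.ne')
  rw [← h, ofReal_integral_eq_lintegral_ofReal hi]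
  refine (ae_restrict_iff' measurableSet_Ioi).2 (Eventually.of_forall fun v hv => ?_)
  have : 0 < v := hv
  simp only [Pi.zero_apply]
  positivity

/-- With `v = 1 - r` the measure becomes `dv/v`, which is invariant under dilations. Extended to
`(0, ∞)`, the integral is therefore the same Gamma integral for every `j`. -/
theorem lintegral_decayKernel_le {γ j : ℕ} {κ c : ℝ} (hκ : 0 < κ) (hc : 0 < c) :
    ∫⁻ r in Ioo (0 : ℝ) 1, ENNReal.ofReal (decayKernel γ κ c j (1 - r)) *
      ENNReal.ofReal (1 / (1 - r)) ≤ ENNReal.ofReal ((1 / c) ^ κ * Real.Gamma κ) := by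
  set L : ℝ := (2 : ℝ) ^ (γ * j) with hL
  have hL0 : 0 < L := by positivity
  set F : ℝ → ℝ≥0∞ := fun v => ENNReal.ofReal (decayKernel γ κ c j v) * ENNReal.ofReal (1 / v)
  calc ∫⁻ r in Ioo (0 : ℝ) 1, F (1 - r)
      = ∫⁻ r, (Ioo (0 : ℝ) 1).indicator F (1 - r) := by
        rw [← lintegral_indicator measurableSet_Ioo]
        refine lintegral_congr fun r => ?_
        by_cases hr : r ∈ Ioo (0 : ℝ) 1
        · rw [indicator_of_mem hr, indicator_of_mem (show 1 - r ∈ Ioo (0 : ℝ) 1 from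
            ⟨by linarith [hr.2], by linarith [hr.1]⟩)]
        · rw [indicator_of_notMem hr, indicator_of_notMem fun h => hr
            ⟨by linarith [h.2], by linarith [h.1]⟩]
    _ = ∫⁻ v in Ioo (0 : ℝ) 1, F v := by
        rw [lintegral_sub_left_eq_self (fun v => (Ioo (0 : ℝ) 1).indicator F v) 1,
          lintegral_indicator measurableSet_Ioo]
    _ ≤ ∫⁻ v in Ioi (0 : ℝ), F v := lintegral_mono_set Ioo_subset_Ioi_self
    _ = ∫⁻ v in Ioi (0 : ℝ), ENNReal.ofReal (L ^ κ) *
          ENNReal.ofReal (v ^ (κ - 1) * Real.exp (-(c * L * v))) := by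
        refine setLIntegral_congr_fun measurableSet_Ioi fun v hv => ?_
        have hv0 : 0 < v := hv
        simp only [F, decayKernel, ← hL]
        rw [← ENNReal.ofReal_mul (by positivity), ← ENNReal.ofReal_mul (by positivity),
          Real.mul_rpow hL0.le hv0.le, Real.rpow_sub_one hv0.ne']
        congr 1
        rw [mul_assoc c L v]
        ring
    _ = ENNReal.ofReal ((1 / c) ^ κ * Real.Gamma κ) := by
        rw [lintegral_const_mul' _ _ ENNReal.ofReal_ne_top,
          lintegral_rpow_mul_exp hκ (mul_pos hc hL0), ← ENNReal.ofReal_mul (by positivity)]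
        congr 1
        rw [← mul_assoc, ← Real.mul_rpow hL0.le (by positivity)]
        congr 2
        field_simp
    _ ≤ _ := le_rfl

/-- The points `u_j = 2^{γj} v` are at least a factor `2` apart, so the intervals `(u_j/2, u_j]` are
disjoint. On each of them the integrand `s^{κ-1} e^{-cs}` is at least `(u_j/2)^κ u_j⁻¹ e^{-c u_j}`.
The length `u_j/2` then explains the constant `2 · 2^κ` in front of the Gamma integral. -/
theorem tsum_decayKernel_le {γ : ℕ} (hγ : 1 ≤ γ) {κ c v : ℝ} (hκ : 0 < κ) (hc : 0 < c)
    (hv : 0 < v) : ∑' j, ENNReal.ofReal (decayKernel γ κ c j v) ≤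
      ENNReal.ofReal (2 * 2 ^ κ * ((1 / c) ^ κ * Real.Gamma κ)) := by
  set I : ℕ → Set ℝ := fun j => Ioc ((2 : ℝ) ^ (γ * j) * v / 2) ((2 : ℝ) ^ (γ * j) * v) with hI
  have hdisj : Pairwise (Function.onFun Disjoint I) := by
    refine (pairwise_disjoint_on _).2 fun i j hij => Set.disjoint_left.2 fun s hi hj => ?_
    have := mul_le_mul_of_nonneg_right (two_mul_two_pow_le hγ hij) hv.le
    linarith [hi.2, hj.1]
  calc ∑' j, ENNReal.ofReal (decayKernel γ κ c j v)
      ≤ ∑' j, ENNReal.ofReal (2 * 2 ^ κ) *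
          ∫⁻ s in I j, ENNReal.ofReal (s ^ (κ - 1) * Real.exp (-(c * s))) := by
        refine ENNReal.tsum_le_tsum fun j => ?_
        set u : ℝ := (2 : ℝ) ^ (γ * j) * v with hu
        have hu0 : 0 < u := by positivity
        calc ENNReal.ofReal (decayKernel γ κ c j v)
            = ENNReal.ofReal (2 * 2 ^ κ) * ∫⁻ _s in I j,
              ENNReal.ofReal ((u / 2) ^ κ / u * Real.exp (-(c * u))) := by
              rw [setLIntegral_const, hI, Real.volume_Ioc, ← ENNReal.ofReal_mul (by positivity),
                ← ENNReal.ofReal_mul (by positivity), decayKernel, ← hu,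
                Real.div_rpow hu0.le (by norm_num)]
              congr 1
              field_simp
              ring
          _ ≤ _ := by
              gcongr ENNReal.ofReal (2 * 2 ^ κ) * ?_
              refine setLIntegral_mono' measurableSet_Ioc fun s hs => ENNReal.ofReal_le_ofReal ?_
              have hs1 := hs.1
              have hs2 : s ≤ u := hs.2
              have hs0 : 0 < s := by linarith
              rw [Real.rpow_sub_one hs0.ne']
              gcongr
    _ = ENNReal.ofReal (2 * 2 ^ κ) *
          ∫⁻ s in ⋃ j, I j, ENNReal.ofReal (s ^ (κ - 1) * Real.exp (-(c * s))) := by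
        rw [ENNReal.tsum_mul_left, lintegral_iUnion (fun _ => measurableSet_Ioc) hdisj]
    _ ≤ ENNReal.ofReal (2 * 2 ^ κ) *
          ∫⁻ s in Ioi (0 : ℝ), ENNReal.ofReal (s ^ (κ - 1) * Real.exp (-(c * s))) := by
        gcongr ENNReal.ofReal (2 * 2 ^ κ) * ?_
        refine lintegral_mono_set (iUnion_subset fun j s hs => ?_)
        have : 0 < (2 : ℝ) ^ (γ * j) * v / 2 := by positivity
        exact this.trans hs.1
    _ = _ := by
        rw [lintegral_rpow_mul_exp hκ hc, ← ENNReal.ofReal_mul (by positivity)]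

theorem radialLq_decayKernel_le {γ : ℕ} (hγ : 1 ≤ γ) {κ c : ℝ} (hκ : 0 < κ) (hc : 0 < c) :
    ∃ S : ℝ≥0, ∀ (q : ℝ≥0∞), 1 ≤ q → ∀ b : ℕ → ℝ≥0∞,
      radialLq q (fun r => ∑' j, ENNReal.ofReal (decayKernel γ κ c j (1 - r)) * b j) ≤
        S * seqLq q b := by
  have hG := Real.Gamma_pos_of_pos hκ
  refine ⟨Real.toNNReal (2 * 2 ^ κ * ((1 / c) ^ κ * Real.Gamma κ)), fun q hq b => ?_⟩
  refine radialLq_tsum_le hq (fun j => ?_) (fun r hr => ?_) (fun j => ?_) b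
  · unfold decayKernel
    fun_prop
  · exact tsum_decayKernel_le hγ hκ hc (by linarith [hr.2])
  · refine (lintegral_decayKernel_le hκ hc).trans (ENNReal.ofReal_le_ofReal ?_)
    refine le_mul_of_one_le_left (by positivity) ?_
    have : (1 : ℝ) ≤ 2 ^ κ := Real.one_le_rpow (by norm_num) hκ.le
    linarith

end QTorus

namespace QTorus

open Filter Topology
open scoped SchwartzMap

variable {d : ℕ}

/-! ### The norm given by the derivatives of a semigroup -/

/-- The derivative `𝒥^k_r` of the semigroup with generator `|m|^γ`, without its part of order less
than `k`. -/
def semigroupJ (γ : ℕ) (k : ℤ) (r : ℝ) {θ : Matrix (Fin d) (Fin d) ℝ} (x : Distribution θ) : Op d :=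
  series θ fun m => (radialSymbol γ k r m : ℂ) * coeff x m

/-- The function whose `L_q`-norm with respect to `dr / (1 - r)` is taken. -/
def radialFun (γ : ℕ) (k : ℤ) (κ : ℝ) (p : ℝ≥0∞) {θ : Matrix (Fin d) (Fin d) ℝ}
    (x : Distribution θ) (r : ℝ) : ℝ≥0∞ :=
  ENNReal.ofReal ((1 - r) ^ κ * torusLpNorm p (semigroupJ γ k r x))

/-- The maximum of the Fourier coefficients of order less than `k`. -/
def maxCoeff (γ : ℕ) (k : ℤ) {θ : Matrix (Fin d) (Fin d) ℝ} (x : Distribution θ) : ℝ≥0∞ :=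
  ⨆ (m : Fin d → ℤ) (_ : latticeNorm m ^ γ < k), ‖coeff x m‖ₑ

/-- The norm given by the derivative of order `k` of the semigroup with generator `|m|^γ`. -/
def semigroupNorm (γ : ℕ) (k : ℤ) (κ : ℝ) (p q : ℝ≥0∞) {θ : Matrix (Fin d) (Fin d) ℝ}
    (x : Distribution θ) : ℝ≥0∞ :=
  radialNorm q (maxCoeff γ k x) (radialFun γ k κ p x)

/-- The Besov weight splits into `L^k`, which belongs to the symbol of the derivative, and `L^{-κ}`,
which belongs to the weight `(1-r)^κ`. -/
theorem two_rpow_eq (γ j : ℕ) {k : ℤ} {α κ : ℝ} (hα : α = γ * (k - κ)) :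
    (2 : ℝ) ^ (j * α) = ((2 : ℝ) ^ (γ * j)) ^ k * (((2 : ℝ) ^ (γ * j)) ^ κ)⁻¹ := by
  rw [← Real.rpow_intCast, ← Real.rpow_neg (by positivity), ← Real.rpow_add (by positivity),
    ← Real.rpow_natCast, ← Real.rpow_mul (by norm_num), hα]
  congr 1
  push_cast
  ring

theorem series_single_mul (θ : Matrix (Fin d) (Fin d) ℝ) (m : Fin d → ℤ)
    (a : (Fin d → ℤ) → ℂ) : series θ (Pi.single m 1 * a) = a m • monomial θ m := by
  classical
  rw [series, tsum_eq_single m]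
  · simp
  · intro n hn
    simp [hn]

theorem exists_norm_apply_le (m : Fin d → ℤ) : ∃ K : ℝ, 0 ≤ K ∧
    ∀ (θ : Matrix (Fin d) (Fin d) ℝ) (p : ℝ≥0∞), 1 ≤ p → ∀ a : (Fin d → ℤ) → ℂ,
      (Summable fun m => ‖a m‖) → ‖a m‖ ≤ K * torusLpNorm p (series θ a) := by
  obtain ⟨K, hK⟩ := exists_isMultiplier_single m
  refine ⟨K, hK.1, fun θ p hp a ha => ?_⟩
  have h := hK.series θ hp ha
  rwa [series_single_mul, torusLpNorm_smul hp, torusLpNorm_monomial, mul_one] at h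

theorem half_le_of_mem_shell {γ j : ℕ} (h : 1 ≤ γ * j) {r : ℝ} (hr : r ∈ shell γ j) : 1 / 2 ≤ r := by
  have h1 : (2 : ℝ) ^ 1 ≤ 2 ^ (γ * j) := pow_le_pow_right₀ (by norm_num) h
  have h2 : ((2 : ℝ) ^ (γ * j))⁻¹ ≤ 2⁻¹ := inv_anti₀ (by norm_num) (by simpa using h1)
  have h3 := hr.1
  linarith

theorem ofReal_le_of_le {a b C : ℝ} (hC : 0 ≤ C) (h : a ≤ C * b) :
    ENNReal.ofReal a ≤ (C.toNNReal : ℝ≥0∞) * ENNReal.ofReal b := by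
  refine (ENNReal.ofReal_le_ofReal h).trans ?_
  rw [ENNReal.ofReal_mul hC]
  rfl

/-- Each Fourier coefficient is dominated by the norm of the semigroup. -/
theorem exists_coeff_le_semigroupNorm {γ : ℕ} (hγ : 1 ≤ γ) (k : ℤ) {κ : ℝ} (hκ : 0 < κ)
    (m : Fin d → ℤ) : ∃ C : ℝ≥0, ∀ (θ : Matrix (Fin d) (Fin d) ℝ) (p q : ℝ≥0∞), 1 ≤ p → 1 ≤ q →
      ∀ x : Distribution θ, ‖coeff x m‖ₑ ≤ C * semigroupNorm γ k κ p q x := by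
  rcases lt_or_ge (latticeNorm m ^ γ) (k : ℝ) with hm | hm
  · refine ⟨1, fun θ p q hp hq x => ?_⟩
    rw [ENNReal.coe_one, one_mul]
    refine le_trans ?_ (le_radialNorm hq _ _)
    exact le_iSup₂_of_le m hm le_rfl
  · obtain ⟨K, hK0, hK⟩ := exists_norm_apply_le m
    have hD := diffFactor_pos (pow_nonneg (latticeNorm_nonneg m) γ) hm
    set s := latticeNorm m ^ γ - k with hs
    -- The coefficient is read off on the shell with `j = 1`, where `r ≥ 1/2` and `1 - r ≥ l`. The
    -- number `δ` bounds the weighted symbol at `m` from below there.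
    set l : ℝ := ((2 : ℝ) ^ γ)⁻¹ / 2
    have hl : 0 < l := by positivity
    set δ := diffFactor (latticeNorm m ^ γ) k * (1 / 2) ^ s * l ^ κ
    have hδ : 0 < δ := by positivity
    refine ⟨2 * (K / δ).toNNReal, fun θ p q hp hq x => ?_⟩
    have h1 : ∀ r ∈ shell γ 1, ‖coeff x m‖ₑ ≤ ((K / δ).toNNReal : ℝ≥0∞) * radialFun γ k κ p x r := by
      intro r hr
      have hr2 := half_le_of_mem_shell (by lia) hr
      have hr1 := (shell_subset γ 1 hr).2
      have hlr : l ≤ 1 - r := by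
        have := hr.2
        rw [mul_one] at this
        change ((2 : ℝ) ^ γ)⁻¹ / 2 ≤ 1 - r
        linarith
      rw [← ofReal_norm]
      refine ofReal_le_of_le (by positivity) ?_
      have h2 := hK θ p hp _ (summable_radialSymbol_mul hγ k (by linarith) hr1 x)
      rw [norm_mul, Complex.norm_real, Real.norm_of_nonneg (radialSymbol_nonneg γ k (by linarith) m),
        radialSymbol_of_le hm, ← hs] at h2
      change _ ≤ K * torusLpNorm p (semigroupJ γ k r x) at h2
      rw [div_mul_eq_mul_div, le_div_iff₀ hδ]
      have h3 : (1 / 2) ^ s ≤ r ^ s := Real.rpow_le_rpow (by norm_num) hr2 (sub_nonneg.2 hm)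
      have h4 : l ^ κ ≤ (1 - r) ^ κ := Real.rpow_le_rpow hl.le hlr hκ.le
      have h5 : 0 ≤ (1 - r) ^ κ := Real.rpow_nonneg (by linarith) _
      have h6 : 0 ≤ torusLpNorm p (semigroupJ γ k r x) := torusLpNorm_nonneg _ _
      calc ‖coeff x m‖ * δ = diffFactor (latticeNorm m ^ γ) k * (1 / 2) ^ s * ‖coeff x m‖ * l ^ κ := by
            simp only [δ]; ring
        _ ≤ diffFactor (latticeNorm m ^ γ) k * r ^ s * ‖coeff x m‖ * (1 - r) ^ κ := by gcongr
        _ ≤ K * torusLpNorm p (semigroupJ γ k r x) * (1 - r) ^ κ := by gcongr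
        _ = _ := by ring
    -- A sequence with a single nonzero term, so that the comparison over shells also serves for one
    -- coefficient.
    set b : ℕ → ℝ≥0∞ := fun j => if j = 1 then ‖coeff x m‖ₑ else 0 with hb
    calc ‖coeff x m‖ₑ = b 1 := by simp [hb]
      _ ≤ seqLq q b := le_seqLq hq b 1
      _ ≤ 2 * radialLq q (fun r => ((K / δ).toNNReal : ℝ≥0∞) * radialFun γ k κ p x r) := by
          refine seqLq_le_radialLq hq hγ fun j r hr => ?_
          by_cases hj : j = 1
          · subst hj
            simpa [hb] using h1 r hr
          · simp [hb, hj]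
      _ ≤ _ := by
          rw [radialLq_const_mul hq, ENNReal.coe_mul, mul_assoc]
          exact mul_le_mul_right (mul_le_mul_right (radialLq_le_radialNorm hq _ _) _) _

section LittlewoodPaley

variable {φ : 𝓢(EuclideanSpace ℝ (Fin d), ℝ)}

theorem IsLittlewoodPaley.apply_eq_zero (hφ : IsLittlewoodPaley φ) {j : ℕ} {m : Fin d → ℤ}
    (hm : 2 * 2 ^ j < latticeNorm m) : φ (dyadicPoint j m) = 0 := by
  by_contra h
  have h1 := (hφ.norm_bounds h).2
  rw [norm_dyadicPoint, div_le_iff₀ (by positivity)] at h1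
  linarith

theorem IsLittlewoodPaley.summable_mul (hφ : IsLittlewoodPaley φ) (j : ℕ) (a : (Fin d → ℤ) → ℂ) :
    Summable fun m => ‖(φ (dyadicPoint j m) : ℂ) * a m‖ := by
  refine summable_of_ne_finset_zero (s := (finite_latticeNorm_le d (2 * 2 ^ j)).toFinset)
    fun m hm => ?_
  rw [Set.Finite.mem_toFinset] at hm
  rw [hφ.apply_eq_zero (not_le.1 hm)]
  simp

/-- This handles the low levels, where the symbol need not be invertible. A piece is a finite sum of
monomials of norm one; the constant may depend on `j`, as only finitely many `j` are needed. -/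
theorem IsLittlewoodPaley.exists_lpSeq_le_semigroupNorm (hφ : IsLittlewoodPaley φ) (α : ℝ)
    {γ : ℕ} (hγ : 1 ≤ γ) (k : ℤ) {κ : ℝ} (hκ : 0 < κ) (j : ℕ) : ∃ C : ℝ≥0,
      ∀ (θ : Matrix (Fin d) (Fin d) ℝ) (p q : ℝ≥0∞), 1 ≤ p → 1 ≤ q →
      ∀ x : Distribution θ, lpSeq φ α p x j ≤ C * semigroupNorm γ k κ p q x := by
  choose C hC using exists_coeff_le_semigroupNorm (d := d) hγ k hκ
  set S := (finite_latticeNorm_le d (2 * 2 ^ j)).toFinset with hS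
  refine ⟨∑ m ∈ S, ((2 : ℝ) ^ (j * α) * |φ (dyadicPoint j m)|).toNNReal * C m,
    fun θ p q hp hq x => ?_⟩
  have h0 : lpPiece φ x j = ∑ m ∈ S, ((φ (dyadicPoint j m) : ℂ) * coeff x m) • monomial θ m := by
    rw [lpPiece_eq, series]
    refine tsum_eq_sum fun m hm => ?_
    rw [hS, Set.Finite.mem_toFinset] at hm
    rw [hφ.apply_eq_zero (not_le.1 hm)]
    simp
  have h1 : (2 : ℝ) ^ (j * α) * torusLpNorm p (lpPiece φ x j) ≤
      ∑ m ∈ S, (2 : ℝ) ^ (j * α) * |φ (dyadicPoint j m)| * ‖coeff x m‖ := by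
    simp only [mul_assoc]
    rw [← Finset.mul_sum]
    refine mul_le_mul_of_nonneg_left ((torusLpNorm_le_norm hp _).trans ?_) (by positivity)
    rw [h0]
    refine (norm_sum_le _ _).trans (Finset.sum_le_sum fun m _ => ?_)
    rw [norm_smul, norm_monomial, mul_one, norm_mul, Complex.norm_real, Real.norm_eq_abs]
  refine (ENNReal.ofReal_le_ofReal h1).trans ?_
  rw [ENNReal.ofReal_sum_of_nonneg fun m _ => by positivity, ENNReal.ofNNReal_finsetSum,
    Finset.sum_mul]
  refine Finset.sum_le_sum fun m _ => ?_
  rw [ENNReal.ofReal_mul (by positivity), ofReal_norm, ENNReal.coe_mul, mul_assoc]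
  exact mul_le_mul_right (hC m θ p q hp hq x) _

/-- The Besov norm is dominated by the norm of the semigroup. -/
theorem IsLittlewoodPaley.exists_besovNorm_le (hφ : IsLittlewoodPaley φ) {γ : ℕ} (hγ : 1 ≤ γ)
    {k : ℤ} {α κ : ℝ} (hκ : 0 < κ) (hα : α = γ * (k - κ)) : ∃ C : ℝ≥0,
      ∀ (θ : Matrix (Fin d) (Fin d) ℝ) (p q : ℝ≥0∞), 1 ≤ p → 1 ≤ q →
      ∀ x : Distribution θ, besovNorm φ α p q x ≤ C * semigroupNorm γ k κ p q x := by
  obtain ⟨C0, hC0⟩ := exists_coeff_le_semigroupNorm hγ k hκ (0 : Fin d → ℤ)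
  choose B hB using hφ.exists_lpSeq_le_semigroupNorm α hγ k hκ
  obtain ⟨J, K, hJ1, hJ⟩ := hφ.exists_inverse_symbol hγ k
  set C1 : ℝ≥0 := (K * 2 ^ κ).toNNReal with hC1
  refine ⟨C0 + (J * ∑ j ∈ Finset.range J, B j + 2 * C1), fun θ p q hp hq x => ?_⟩
  set R := semigroupNorm γ k κ p q x
  have h1 : ∀ j < J, lpSeq φ α p x j ≤ ((∑ j ∈ Finset.range J, B j : ℝ≥0) : ℝ≥0∞) * R := by
    intro j hj
    refine (hB j θ p q hp hq x).trans (mul_le_mul_left ?_ _)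
    exact_mod_cast Finset.single_le_sum (f := B) (fun i _ => zero_le) (Finset.mem_range.2 hj)
  -- On the shell the inverse symbol costs `K L^{-k}`. It cancels the `L^k` of the Besov weight, and
  -- the remaining `L^{-κ}` is comparable with `(1-r)^κ`.
  have h2 : ∀ j, ∀ r ∈ shell γ j, (if j < J then 0 else lpSeq φ α p x j) ≤
      (C1 : ℝ≥0∞) * radialFun γ k κ p x r := by
    intro j r hr
    split_ifs with hj
    · exact zero_le
    have hj' := not_lt.1 hj
    obtain ⟨hr0, hr1⟩ := shell_subset γ j hr
    set L : ℝ := (2 : ℝ) ^ (γ * j) with hL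
    have hL0 : 0 < L := by positivity
    have hrL : 1 - r ≤ L⁻¹ := by linarith [hr.1]
    have hrL' : L⁻¹ / 2 ≤ 1 - r := by linarith [hr.2]
    obtain ⟨c, hc, hcm⟩ := hJ j hj' r hr0 hr1 hrL
    have hK0 : 0 ≤ K := by
      by_contra hneg
      have : K * ((L ^ k)⁻¹) < 0 := mul_neg_of_neg_of_pos (not_le.1 hneg) (by positivity)
      linarith [hc.1]
    have h3 : torusLpNorm p (lpPiece φ x j) ≤
        K * (L ^ k)⁻¹ * torusLpNorm p (semigroupJ γ k r x) := by
      have h4 := hc.series θ hp (summable_radialSymbol_mul hγ k hr0 hr1 x)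
      have h5 : lpPiece φ x j =
          series θ (c * fun m => (radialSymbol γ k r m : ℂ) * coeff x m) := by
        rw [lpPiece_eq]
        congr 1
        funext m
        rw [Pi.mul_apply, ← mul_assoc, hcm m]
      rw [h5]
      exact h4
    refine ofReal_le_of_le (by positivity) ?_
    have h5 : (L ^ κ)⁻¹ ≤ 2 ^ κ * (1 - r) ^ κ := by
      rw [← Real.mul_rpow (by norm_num) (by linarith), ← Real.inv_rpow hL0.le]
      exact Real.rpow_le_rpow (by positivity) (by linarith) hκ.le
    have h6 : 0 ≤ torusLpNorm p (semigroupJ γ k r x) := torusLpNorm_nonneg _ _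
    have hLk : L ^ k ≠ 0 := (zpow_pos hL0 k).ne'
    calc (2 : ℝ) ^ (j * α) * torusLpNorm p (lpPiece φ x j)
        ≤ (L ^ k * (L ^ κ)⁻¹) * (K * (L ^ k)⁻¹ * torusLpNorm p (semigroupJ γ k r x)) := by
          rw [two_rpow_eq γ j hα, ← hL]
          exact mul_le_mul_of_nonneg_left h3 (by positivity)
      _ = K * torusLpNorm p (semigroupJ γ k r x) * (L ^ κ)⁻¹ := by
          field_simp
      _ ≤ K * torusLpNorm p (semigroupJ γ k r x) * (2 ^ κ * (1 - r) ^ κ) := by gcongr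
      _ = _ := by ring
  calc besovNorm φ α p q x ≤ ‖coeff x 0‖ₑ + seqLq q (lpSeq φ α p x) := besovNorm_le_add φ α p x hq
    _ ≤ C0 * R + (J * (((∑ j ∈ Finset.range J, B j : ℝ≥0) : ℝ≥0∞) * R) + 2 * (C1 * R)) := by
        refine add_le_add (hC0 θ p q hp hq x) ((seqLq_le_add hq h1).trans
          (add_le_add le_rfl ((seqLq_le_radialLq hq hγ h2).trans ?_)))
        rw [radialLq_const_mul hq]
        exact mul_le_mul_right (mul_le_mul_right (radialLq_le_radialNorm hq _ _) _) _
    _ = _ := by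
        push_cast
        ring

end LittlewoodPaley

end QTorus

namespace QTorus

open Filter Topology
open scoped SchwartzMap

variable {d : ℕ} {φ : 𝓢(EuclideanSpace ℝ (Fin d), ℝ)}

/-! ### The Littlewood-Paley decomposition -/

namespace IsLittlewoodPaley

/-- The set where `φ ≠ 0` is open, so it lies in the interior of the closed annulus. Strictness
makes `φ` nonnegative everywhere and removes the boundary value `|ξ| = 2` in `hasSum_dyadicPoint`.
-/
theorem norm_bounds_strict (hφ : IsLittlewoodPaley φ) {ξ : EuclideanSpace ℝ (Fin d)}
    (h : φ ξ ≠ 0) : 1 / 2 < ‖ξ‖ ∧ ‖ξ‖ < 2 := by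
  have hopen : IsOpen {ξ | φ ξ ≠ 0} := isOpen_ne_fun φ.continuous continuous_const
  have h1 : {ξ | φ ξ ≠ 0} ⊆ interior (Metric.closedBall 0 2) :=
    interior_maximal (fun ζ hζ => by simpa using (hφ.norm_bounds hζ).2) hopen
  have h2 : {ξ | φ ξ ≠ 0} ⊆ interior (Metric.ball 0 (1 / 2))ᶜ :=
    interior_maximal (fun ζ hζ => by simpa using (hφ.norm_bounds hζ).1) hopen
  rw [interior_closedBall _ (by norm_num)] at h1
  rw [interior_compl, closure_ball _ (by norm_num)] at h2
  have h3 := h1 h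
  have h4 := h2 h
  simp only [mem_ball_zero_iff, mem_compl_iff, mem_closedBall_zero_iff, not_le] at h3 h4
  exact ⟨h4, h3⟩

theorem nonneg (hφ : IsLittlewoodPaley φ) (ξ : EuclideanSpace ℝ (Fin d)) : 0 ≤ φ ξ := by
  by_cases h : φ ξ = 0
  · exact h.ge
  · obtain ⟨h1, h2⟩ := hφ.norm_bounds_strict h
    exact (hφ.pos ξ h1 h2).le

/-- A nonzero lattice point has `|m| ≥ 1`, so negative levels dilate it to norm at least `2`, where
`φ` vanishes. The pieces with `j ≥ 0` and the zero mode thus recover everything. -/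
theorem hasSum_dyadicPoint (hφ : IsLittlewoodPaley φ) {m : Fin d → ℤ} (hm : m ≠ 0) :
    HasSum (fun j : ℕ => φ (dyadicPoint j m)) 1 := by
  have h1 := one_le_latticeNorm hm
  have h0 : latticePoint m ≠ 0 := norm_pos_iff.1 (lt_of_lt_of_le one_pos h1)
  refine (Function.Injective.hasSum_iff (g := ((↑) : ℕ → ℤ)) Nat.cast_injective
    (fun k hk => ?_)).2 (hφ.hasSum_one _ h0)
  have hk0 : k < 0 := by
    by_contra hcon
    exact hk ⟨k.toNat, Int.toNat_of_nonneg (not_lt.1 hcon)⟩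
  by_contra h
  have h2 := (hφ.norm_bounds_strict h).2
  rw [norm_smul, norm_zpow, Real.norm_two] at h2
  have h3 : (2 : ℝ) ^ (1 : ℤ) ≤ 2 ^ (-k) := zpow_le_zpow_right₀ (by norm_num) (by lia)
  rw [zpow_one] at h3
  change 2 ^ (-k) * latticeNorm m < 2 at h2
  nlinarith

theorem apply_dyadicPoint_zero (hφ : IsLittlewoodPaley φ) (j : ℕ) :
    φ (dyadicPoint j (0 : Fin d → ℤ)) = 0 := by
  by_contra h
  have h1 := (hφ.norm_bounds h).1
  rw [norm_dyadicPoint, latticeNorm_zero, zero_div] at h1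
  norm_num at h1

theorem exists_apply_pos (hφ : IsLittlewoodPaley φ) {m : Fin d → ℤ} (hm : m ≠ 0) :
    ∃ j : ℕ, 0 < φ (dyadicPoint j m) := by
  by_contra! h
  have h1 : ∀ j, φ (dyadicPoint j m) = 0 := fun j => le_antisymm (h j) (hφ.nonneg _)
  have h2 := hφ.hasSum_dyadicPoint hm
  simp only [h1] at h2
  exact one_ne_zero (h2.unique hasSum_zero)

/-- Each Fourier coefficient is dominated by the Besov norm. -/
theorem exists_coeff_le_besovNorm (hφ : IsLittlewoodPaley φ) (α : ℝ) (m : Fin d → ℤ) :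
    ∃ C : ℝ≥0, ∀ (θ : Matrix (Fin d) (Fin d) ℝ) (p q : ℝ≥0∞), 1 ≤ p → 1 ≤ q →
      ∀ x : Distribution θ, ‖coeff x m‖ₑ ≤ C * besovNorm φ α p q x := by
  by_cases hm : m = 0
  · subst hm
    refine ⟨1, fun θ p q _ hq x => ?_⟩
    rw [ENNReal.coe_one, one_mul]
    exact le_besovNorm φ α p x hq
  · obtain ⟨j, hj⟩ := hφ.exists_apply_pos hm
    obtain ⟨K, hK0, hK⟩ := exists_norm_apply_le m
    set δ := φ (dyadicPoint j m) * (2 : ℝ) ^ (j * α)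
    have hδ : 0 < δ := by positivity
    refine ⟨(K / δ).toNNReal, fun θ p q hp hq x => ?_⟩
    calc ‖coeff x m‖ₑ ≤ (K / δ).toNNReal * lpSeq φ α p x j := by
          rw [← ofReal_norm]
          refine ofReal_le_of_le (by positivity) ?_
          have h2 := hK θ p hp _ (hφ.summable_mul j (coeff x))
          rw [norm_mul, Complex.norm_real, Real.norm_of_nonneg hj.le] at h2
          rw [div_mul_eq_mul_div, le_div_iff₀ hδ]
          calc ‖coeff x m‖ * δ = 2 ^ (j * α) * (φ (dyadicPoint j m) * ‖coeff x m‖) := by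
                simp only [δ]; ring
            _ ≤ 2 ^ (j * α) * (K * torusLpNorm p (lpPiece φ x j)) := by
                exact mul_le_mul_of_nonneg_left h2 (by positivity)
            _ = _ := by ring
      _ ≤ _ := mul_le_mul_right ((le_seqLq hq _ j).trans (seqLq_le_besovNorm φ α p x hq)) _

theorem tendsto_partial_sum (hφ : IsLittlewoodPaley φ) (m : Fin d → ℤ) :
    Tendsto (fun n => (if m = 0 then 1 else 0) + ∑ j ∈ Finset.range n, φ (dyadicPoint j m))
      atTop (𝓝 1) := by
  by_cases hm : m = 0
  · subst hm
    simp [hφ.apply_dyadicPoint_zero]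
  · simpa [hm] using (hφ.hasSum_dyadicPoint hm).tendsto_sum_nat

theorem abs_partial_sum_le (hφ : IsLittlewoodPaley φ) (m : Fin d → ℤ) (n : ℕ) :
    |(if m = 0 then 1 else 0) + ∑ j ∈ Finset.range n, φ (dyadicPoint j m)| ≤ 1 := by
  by_cases hm : m = 0
  · subst hm
    simp [hφ.apply_dyadicPoint_zero]
  · rw [if_neg hm, zero_add, abs_of_nonneg (Finset.sum_nonneg fun j _ => hφ.nonneg _)]
    exact sum_le_hasSum _ (fun j _ => hφ.nonneg _) (hφ.hasSum_dyadicPoint hm)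

/-- The norm of a series is dominated by the sum of the norms of its Littlewood-Paley pieces. -/
theorem torusLpNorm_series_le (hφ : IsLittlewoodPaley φ) (θ : Matrix (Fin d) (Fin d) ℝ)
    {p : ℝ≥0∞} (hp : 1 ≤ p) {u : (Fin d → ℤ) → ℂ} (hu : Summable fun m => ‖u m‖) :
    ENNReal.ofReal (torusLpNorm p (series θ u)) ≤ ENNReal.ofReal ‖u 0‖ +
      ∑' j : ℕ, ENNReal.ofReal (torusLpNorm p
        (series θ fun m => (φ (dyadicPoint j m) : ℂ) * u m)) := by
  set v : ℕ → Op d := fun j => series θ fun m => (φ (dyadicPoint j m) : ℂ) * u m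
  set w : ℕ → Op d := fun n => u 0 • monomial θ 0 + ∑ j ∈ Finset.range n, v j
  have hv : ∀ j, v j ∈ torusAlgebra θ := fun j => series_mem θ _
  have hw : ∀ n, w n ∈ torusAlgebra θ := fun n =>
    add_mem ((torusAlgebra θ).smul_mem (monomial_mem θ 0) _) (sum_mem fun j _ => hv j)
  have hwn : ∀ n, torusLpNorm p (w n) ≤ ‖u 0‖ + ∑ j ∈ Finset.range n, torusLpNorm p (v j) := by
    intro n
    induction n with
    | zero => simp [w, torusLpNorm_smul hp, torusLpNorm_monomial]
    | succ n ih =>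
      have h1 : w (n + 1) = w n + v n := by
        simp only [w, Finset.sum_range_succ, add_assoc]
      rw [h1, Finset.sum_range_succ, ← add_assoc]
      exact (torusLpNorm_add_le hp (hw n) (hv n)).trans (by gcongr)
  -- The partial sums multiply the coefficients by numbers in `[0, 1]` that tend to `1`, so absolute
  -- summability of `u` gives convergence in operator norm by dominated convergence.
  have hws : ∀ n, w n = ∑' m, (((if m = 0 then 1 else 0) +
      ∑ j ∈ Finset.range n, φ (dyadicPoint j m) : ℝ) : ℂ) • (u m • monomial θ m) := by
    intro n
    have h1 : HasSum (fun m => (if m = 0 then (1 : ℂ) else 0) • (u m • monomial θ m))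
        (u 0 • monomial θ 0) := by
      convert hasSum_single (0 : Fin d → ℤ) ?_ using 1
      · simp
      · intro m hm
        simp [hm]
    have h2 : ∀ j, HasSum (fun m => (φ (dyadicPoint j m) : ℂ) • (u m • monomial θ m)) (v j) := by
      intro j
      simpa only [smul_smul] using hasSum_series θ (hφ.summable_mul j u)
    have h3 := h1.add (hasSum_sum (s := Finset.range n) fun j _ => h2 j)
    refine h3.tsum_eq.symm.trans (tsum_congr fun m => ?_)
    push_cast
    rw [add_smul, Finset.sum_smul]
    split_ifs <;> simp
  have hlim : Tendsto w atTop (𝓝 (series θ u)) := by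
    simp only [funext hws]
    refine tendsto_tsum_of_dominated_convergence (bound := fun m => ‖u m‖) hu (fun m => ?_)
      (Eventually.of_forall fun n m => ?_)
    · have h1 := (Complex.continuous_ofReal.tendsto 1).comp (hφ.tendsto_partial_sum m)
      simpa using h1.smul_const (u m • monomial θ m)
    · rw [norm_smul, norm_smul, norm_monomial, mul_one, Complex.norm_real, Real.norm_eq_abs]
      exact mul_le_of_le_one_left (norm_nonneg _) (hφ.abs_partial_sum_le m n)
  have hlim2 := (ENNReal.continuous_ofReal.tendsto _).comp
    (tendsto_torusLpNorm hp hw (series_mem θ u) hlim)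
  refine le_of_tendsto hlim2 (Eventually.of_forall fun n => ?_)
  refine (ENNReal.ofReal_le_ofReal (hwn n)).trans ?_
  rw [ENNReal.ofReal_add (norm_nonneg _) (Finset.sum_nonneg fun j _ => torusLpNorm_nonneg _ _),
    ENNReal.ofReal_sum_of_nonneg fun j _ => torusLpNorm_nonneg _ _]
  gcongr
  exact ENNReal.sum_le_tsum _

/-- The norm of the derivative of the semigroup is pointwise dominated by the Littlewood-Paley
pieces. -/
theorem exists_radialFun_le (hφ : IsLittlewoodPaley φ) {γ : ℕ} (hγ : 1 ≤ γ)
    {k : ℤ} {α κ : ℝ} (hα : α = γ * (k - κ)) : ∃ (C : ℝ≥0) (c₀ : ℝ), 0 < c₀ ∧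
      ∀ (θ : Matrix (Fin d) (Fin d) ℝ) (p : ℝ≥0∞), 1 ≤ p →
      ∀ x : Distribution θ, ∀ r ∈ Ioo (0 : ℝ) 1, radialFun γ k κ p x r ≤
        C * ∑' j, ENNReal.ofReal (decayKernel γ κ c₀ j (1 - r)) *
          (lpSeq φ α p x j + if j = 0 then ‖coeff x 0‖ₑ else 0) := by
  obtain ⟨K, c₀, hK0, hc₀, hK⟩ := hφ.exists_forward_symbol hγ k
  -- For `k ≤ 0` the zero mode survives in the derivative, although no Littlewood-Paley piece
  -- contains it. It is charged to the level `j = 0`, at the cost `D e^{c₀}`.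
  set D := |diffFactor (latticeNorm (0 : Fin d → ℤ) ^ γ) k|
  have hD : 0 ≤ D := abs_nonneg _
  refine ⟨(K + D * Real.exp c₀).toNNReal, c₀, hc₀, fun θ p hp x r hr => ?_⟩
  obtain ⟨hr0, hr1⟩ := hr
  set v := 1 - r with hv
  have hv0 : 0 < v := by linarith
  have hv1 : v ≤ 1 := by linarith
  set C := K + D * Real.exp c₀
  have hC : 0 ≤ C := by positivity
  have hker : ∀ j, 0 ≤ decayKernel γ κ c₀ j v := fun j => by
    unfold decayKernel
    positivity
  set u : (Fin d → ℤ) → ℂ := fun m => (radialSymbol γ k r m : ℂ) * coeff x m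
  have hu := summable_radialSymbol_mul hγ k hr0 hr1 x
  have h1 : ENNReal.ofReal (v ^ κ) * ENNReal.ofReal ‖u 0‖ ≤
      C.toNNReal * (ENNReal.ofReal (decayKernel γ κ c₀ 0 v) * ‖coeff x 0‖ₑ) := by
    rw [← ENNReal.ofReal_mul (by positivity), ← ofReal_norm, ← ENNReal.ofReal_mul (hker 0)]
    refine ofReal_le_of_le hC ?_
    have h2 : ‖u 0‖ ≤ D * ‖coeff x 0‖ := by
      simp only [u]
      rw [norm_mul, Complex.norm_real, Real.norm_of_nonneg (radialSymbol_nonneg γ k hr0.le 0)]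
      exact mul_le_mul_of_nonneg_right (radialSymbol_le γ k hr0.le hr1.le 0) (norm_nonneg _)
    -- At `j = 0` the kernel is `v^κ e^{-c₀v}`, and `v ≤ 1`.
    have h3 : v ^ κ ≤ Real.exp c₀ * decayKernel γ κ c₀ 0 v := by
      simp only [decayKernel, mul_zero, pow_zero, one_mul]
      have h4 : 1 ≤ Real.exp c₀ * Real.exp (-(c₀ * v)) := by
        rw [← Real.exp_add, Real.one_le_exp_iff]
        nlinarith
      have h5 : 0 ≤ v ^ κ := by positivity
      nlinarith
    calc v ^ κ * ‖u 0‖ ≤ (Real.exp c₀ * decayKernel γ κ c₀ 0 v) * (D * ‖coeff x 0‖) := by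
          gcongr
          exact mul_nonneg (Real.exp_pos _).le (hker 0)
      _ = (D * Real.exp c₀) * (decayKernel γ κ c₀ 0 v * ‖coeff x 0‖) := by ring
      _ ≤ C * (decayKernel γ κ c₀ 0 v * ‖coeff x 0‖) := by
          refine mul_le_mul_of_nonneg_right (by simp only [C]; linarith) ?_
          exact mul_nonneg (hker 0) (norm_nonneg _)
  have h2 : ∀ j, ENNReal.ofReal (v ^ κ) * ENNReal.ofReal (torusLpNorm p
      (series θ fun m => (φ (dyadicPoint j m) : ℂ) * u m)) ≤
      C.toNNReal * (ENNReal.ofReal (decayKernel γ κ c₀ j v) * lpSeq φ α p x j) := by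
    intro j
    obtain ⟨c, hc, hcm⟩ := hK j r hr0 hr1
    set L : ℝ := (2 : ℝ) ^ (γ * j) with hL
    have hL0 : 0 < L := by positivity
    have h3 : torusLpNorm p (series θ fun m => (φ (dyadicPoint j m) : ℂ) * u m) ≤
        K * L ^ k * Real.exp (-(c₀ * (L * v))) * torusLpNorm p (lpPiece φ x j) := by
      have h4 := hc.series θ hp (hφ.summable_mul j (coeff x))
      have h5 : (fun m => (φ (dyadicPoint j m) : ℂ) * u m) =
          c * fun m => (φ (dyadicPoint j m) : ℂ) * coeff x m := by
        funext m
        simp only [u, Pi.mul_apply]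
        rw [← mul_assoc, ← mul_assoc, hcm m, mul_comm (φ (dyadicPoint j m) : ℂ)]
      rw [h5]
      exact h4
    have hN : 0 ≤ torusLpNorm p (lpPiece φ x j) := torusLpNorm_nonneg _ _
    rw [← ENNReal.ofReal_mul (by positivity), lpSeq, ← ENNReal.ofReal_mul (hker j)]
    refine ofReal_le_of_le hC ?_
    calc _ ≤ v ^ κ * (K * L ^ k * Real.exp (-(c₀ * (L * v))) *
          torusLpNorm p (lpPiece φ x j)) := by gcongr
      _ = K * (decayKernel γ κ c₀ j v * (2 ^ (j * α) * torusLpNorm p (lpPiece φ x j))) := by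
          rw [two_rpow_eq γ j hα, decayKernel, ← hL, Real.mul_rpow hL0.le hv0.le]
          have : L ^ κ ≠ 0 := by positivity
          field_simp
      _ ≤ _ := by
          refine mul_le_mul_of_nonneg_right ?_ (mul_nonneg (hker j) (by positivity))
          simp only [C]
          have := mul_nonneg hD (Real.exp_pos c₀).le
          linarith
  have h3 : ∑' j, ENNReal.ofReal (decayKernel γ κ c₀ j v) *
      (if j = 0 then ‖coeff x 0‖ₑ else 0) =
        ENNReal.ofReal (decayKernel γ κ c₀ 0 v) * ‖coeff x 0‖ₑ := by
    rw [tsum_eq_single 0 fun j hj => by simp [hj]]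
    simp
  calc radialFun γ k κ p x r
      = ENNReal.ofReal (v ^ κ) * ENNReal.ofReal (torusLpNorm p (series θ u)) := by
        rw [radialFun, ENNReal.ofReal_mul (by positivity)]
        rfl
    _ ≤ ENNReal.ofReal (v ^ κ) * (ENNReal.ofReal ‖u 0‖ + ∑' j : ℕ, ENNReal.ofReal (torusLpNorm p
          (series θ fun m => (φ (dyadicPoint j m) : ℂ) * u m))) :=
        mul_le_mul_right (hφ.torusLpNorm_series_le θ hp hu) _
    _ ≤ C.toNNReal * (ENNReal.ofReal (decayKernel γ κ c₀ 0 v) * ‖coeff x 0‖ₑ) +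
          ∑' j, C.toNNReal * (ENNReal.ofReal (decayKernel γ κ c₀ j v) * lpSeq φ α p x j) := by
        rw [mul_add, ← ENNReal.tsum_mul_left]
        exact add_le_add h1 (ENNReal.tsum_le_tsum h2)
    _ = _ := by
        simp only [mul_add]
        rw [ENNReal.tsum_add, h3, ENNReal.tsum_mul_left, mul_add, add_comm]

theorem finite_latticeNorm_pow_lt (d : ℕ) {γ : ℕ} (hγ : 1 ≤ γ) (k : ℝ) :
    {m : Fin d → ℤ | latticeNorm m ^ γ < k}.Finite := by
  refine (finite_latticeNorm_le d (max 1 k)).subset fun m (hm : latticeNorm m ^ γ < k) => ?_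
  rcases le_total (latticeNorm m) 1 with h | h
  · exact h.trans (le_max_left _ _)
  · exact ((le_self_pow₀ h (by lia)).trans hm.le).trans (le_max_right _ _)

/-- The norm of the semigroup is dominated by the Besov norm. -/
theorem exists_semigroupNorm_le (hφ : IsLittlewoodPaley φ) {γ : ℕ} (hγ : 1 ≤ γ)
    {k : ℤ} {α κ : ℝ} (hκ : 0 < κ) (hα : α = γ * (k - κ)) : ∃ C : ℝ≥0,
      ∀ (θ : Matrix (Fin d) (Fin d) ℝ) (p q : ℝ≥0∞), 1 ≤ p → 1 ≤ q →
      ∀ x : Distribution θ, semigroupNorm γ k κ p q x ≤ C * besovNorm φ α p q x := by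
  choose A hA using hφ.exists_coeff_le_besovNorm α
  obtain ⟨C, c₀, hc₀, hC⟩ := hφ.exists_radialFun_le hγ hα
  obtain ⟨S, hS⟩ := radialLq_decayKernel_le hγ hκ hc₀
  set F := (finite_latticeNorm_pow_lt d hγ k).toFinset with hF
  refine ⟨∑ m ∈ F, A m + C * (S * 3), fun θ p q hp hq x => ?_⟩
  set B := besovNorm φ α p q x
  have h1 : maxCoeff γ k x ≤ ((∑ m ∈ F, A m : ℝ≥0) : ℝ≥0∞) * B := by
    refine iSup₂_le fun m hm => (hA m θ p q hp hq x).trans (mul_le_mul_left ?_ _)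
    exact_mod_cast Finset.single_le_sum (f := A) (fun i _ => zero_le)
      ((Set.Finite.mem_toFinset _).2 hm)
  set b : ℕ → ℝ≥0∞ := fun j => lpSeq φ α p x j + if j = 0 then ‖coeff x 0‖ₑ else 0 with hb
  have hlp := seqLq_le_besovNorm φ α p x hq
  -- The term `j = 0` consists of two quantities bounded by `B`, and the remaining terms form a
  -- sequence of norm at most `B`.
  have h2 : seqLq q b ≤ 3 * B := by
    have h3 : ∀ j < 1, b j ≤ 2 * B := by
      intro j hj
      obtain rfl : j = 0 := by lia
      simp only [hb, if_true, two_mul]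
      exact add_le_add ((le_seqLq hq _ 0).trans hlp) (le_besovNorm φ α p x hq)
    refine (seqLq_le_add hq h3).trans ?_
    have h4 : seqLq q (fun j => if j < 1 then 0 else b j) ≤ B := by
      refine le_trans (seqLq_mono fun j => ?_) hlp
      split_ifs with hj
      · exact zero_le
      · simp [hb, show j ≠ 0 by lia]
    calc _ ≤ ((1 : ℕ) : ℝ≥0∞) * (2 * B) + B := add_le_add le_rfl h4
      _ = 3 * B := by
          push_cast
          ring
  have h5 : radialLq q (radialFun γ k κ p x) ≤ C * (S * (3 * B)) := by
    refine (radialLq_mono (hC θ p hp x)).trans ?_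
    rw [radialLq_const_mul hq]
    exact mul_le_mul_right ((hS q hq b).trans (mul_le_mul_right h2 _)) _
  calc semigroupNorm γ k κ p q x ≤ maxCoeff γ k x + radialLq q (radialFun γ k κ p x) :=
        radialNorm_le_add hq _ _
    _ ≤ _ := add_le_add h1 h5
    _ = _ := by
        push_cast
        ring

end IsLittlewoodPaley

/-! ### The two equivalences as the cases `γ = 1` and `γ = 2` -/

theorem poissonNorm_eq (k : ℤ) (α : ℝ) (p q : ℝ≥0∞) {θ : Matrix (Fin d) (Fin d) ℝ}
    (x : Distribution θ) : poissonNorm k α p q x = semigroupNorm 1 k (k - α) p q x := by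
  simp only [poissonNorm, semigroupNorm, maxCoeff, pow_one]
  congr 1
  funext r
  rw [poissonJ_tail]
  rfl

theorem heatNorm_eq (k : ℤ) (α : ℝ) (p q : ℝ≥0∞) {θ : Matrix (Fin d) (Fin d) ℝ}
    (x : Distribution θ) : heatNorm k α p q x = semigroupNorm 2 k (k - α / 2) p q x := by
  simp only [heatNorm, semigroupNorm, maxCoeff]
  congr 1
  funext r
  rw [heatJ_eq]
  rfl

theorem IsLittlewoodPaley.exists_equivalence (hφ : IsLittlewoodPaley φ) {γ : ℕ} (hγ : 1 ≤ γ)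
    {k : ℤ} {α κ : ℝ} (hκ : 0 < κ) (hα : α = γ * (k - κ)) : ∃ C : ℝ≥0,
      ∀ (θ : Matrix (Fin d) (Fin d) ℝ) (p q : ℝ≥0∞), 1 ≤ p → 1 ≤ q → ∀ x : Distribution θ,
        besovNorm φ α p q x ≤ C * semigroupNorm γ k κ p q x ∧
        semigroupNorm γ k κ p q x ≤ C * besovNorm φ α p q x := by
  obtain ⟨A, hA⟩ := hφ.exists_besovNorm_le hγ hκ hα
  obtain ⟨B, hB⟩ := hφ.exists_semigroupNorm_le hγ hκ hα
  refine ⟨max A B, fun θ p q hp hq x => ⟨(hA θ p q hp hq x).trans (mul_le_mul_left ?_ _),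
    (hB θ p q hp hq x).trans (mul_le_mul_left ?_ _)⟩⟩
  · exact_mod_cast le_max_left A B
  · exact_mod_cast le_max_right A B

end QTorus

end

theorem mainTheorem7 (d : ℕ) (hd : 2 ≤ d) (φ : SchwartzMap (EuclideanSpace ℝ (Fin d)) ℝ)
    (hφ : QTorus.IsLittlewoodPaley φ) (α : ℝ) (k : ℤ) :
    (α < k →
      ∃ C : ℝ≥0, ∀ θ : Matrix (Fin d) (Fin d) ℝ, θ.transpose = -θ →
        ∀ p q : ℝ≥0∞, 1 ≤ p → 1 ≤ q → ∀ x : QTorus.Distribution θ,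
          QTorus.besovNorm φ α p q x ≤ C * QTorus.poissonNorm k α p q x ∧
          QTorus.poissonNorm k α p q x ≤ C * QTorus.besovNorm φ α p q x) ∧
    (α / 2 < k →
      ∃ C : ℝ≥0, ∀ θ : Matrix (Fin d) (Fin d) ℝ, θ.transpose = -θ →
        ∀ p q : ℝ≥0∞, 1 ≤ p → 1 ≤ q → ∀ x : QTorus.Distribution θ,
          QTorus.besovNorm φ α p q x ≤ C * QTorus.heatNorm k α p q x ∧
          QTorus.heatNorm k α p q x ≤ C * QTorus.besovNorm φ α p q x) := by
  refine ⟨fun h => ?_, fun h => ?_⟩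
  -- Here `κ = k - α`, and in the heat case `κ = k - α/2`; the hypothesis of each part says exactly
  -- that `κ > 0`.
  · obtain ⟨C, hC⟩ := hφ.exists_equivalence (γ := 1) le_rfl (k := k) (α := α) (sub_pos.2 h)
      (by push_cast; ring)
    refine ⟨C, fun θ _ p q hp hq x => ?_⟩
    rw [QTorus.poissonNorm_eq]
    exact hC θ p q hp hq x
  · obtain ⟨C, hC⟩ := hφ.exists_equivalence (γ := 2) one_le_two (k := k) (α := α) (sub_pos.2 h)
      (by push_cast; ring)
    refine ⟨C, fun θ _ p q hp hq x => ?_⟩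
    rw [QTorus.heatNorm_eq]
    exact hC θ p q hp hq x
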